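/- Let $k\ge 2$ be a standard natural number. Work in second order arithmetic; $\omega$ denotes the set of all numbers of the (possibly nonstandard) model, and numbers code finite sequences. Let $(\omega)^k$ be the class of surjective functions $p:\omega\to k$ that are ordered, i.e. if $p(n)=i$ then each $j<i$ equals $p(m)$ for some $m<n$; let $(\omega)^k_{\mathrm{fin}}$ be the set of ordered finite sequences over $k$ in which every $i<k$ appears, and let $\tau_0,\tau_1,\dots$ be an enumeration of $(\omega)^k_{\mathrm{fin}}$ (such an enumeration exists provably in $\mathsf{RCA}_0$; the result holds for each one). Write $\sigma\prec p$ if $\sigma$ is an initial segment of $p$. A code for an open set is a set $O\subseteq\omega\times(\omega)^k_{\mathrm{fin}}$, and $p\in O$ means $\sigma\prec p$ for some $\langle n,\sigma\rangle\in O$; sequences of open sets are coded by subsets of $\omega\times\omega\times(\omega)^k_{\mathrm{fin}}$. $O$ is dense if for every $\tau\in(\omega)^k_{\mathrm{fin}}$ there is $\langle n,\sigma\rangle\in O$ with $\sigma$ and $\tau$ comparable. A Borel code (for a subset of $(\omega)^k$) is a tree $B\subseteq\omega^{<\omega}$ with no infinite path such that there is exactly one $m_B$ with $\langle m_B\rangle\in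 B$. An evaluation map for $B$ at $p\in(\omega)^k$ is a function $f:B\to\{0,1\}$ such that, for each $\sigma\in B$ other than the empty sequence $\lambda$, with last entry $a$: if $\sigma$ is a leaf, then $f(\sigma)=1$ iff $a=1$, or $a=2m+2$ and $\tau_m\prec p$, or $a=2m+3$ and $\tau_m\not\prec p$, for some $m$; if $\sigma$ is not a leaf and $a$ is even, then $f(\sigma)=1$ iff $f(\sigma^\smallfrown m)=1$ for some $\sigma^\smallfrown m\in B$; if $\sigma$ is not a leaf and $a$ is odd, then $f(\sigma)=1$ iff $f(\sigma^\smallfrown m)=1$ for all $\sigma^\smallfrown m\in B$; and $f(\lambda)=f(\langle m_B\rangle)$. Write $p\in B$ (respectively $p\notin B$) if there is an evaluation map $f$ for $B$ at $p$ with $f(\lambda)=1$ (respectively $f(\lambda)=0$). A Baire code for $B$ consists of open sets $U,V$ and a sequence $\langle D_n:n\in\omega\rangle$ of dense open sets such that $U\cup V$ is dense and, for every $x\in(\omega)^k$ with $x\in\bigcap_n D_n$: if $x\in U$ then $x\in B$, and if $x\in V$ then $x\notin B$. Theorem. Over $\mathsf{RCA}_0$ (that is, in every model of $\mathsf{RCA}_0$,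 not only in $\omega$-models) the following are equivalent. 1. $\mathsf{ATR}_0$. 2. For every Borel code $B$ for a subset of $(\omega)^k$ there is an $x\in(\omega)^k$ such that $x\in B$ or $x\notin B$. 3. Every Borel code $B$ for a subset of $(\omega)^k$ has a Baire code. -/

import Mathlib

/-!
Second order arithmetic, its subsystems `RCA₀` and `ATR₀`, and Borel and Baire codes for subsets of
the space `(ω)^k` of partitions of `ω` into `k` blocks.

Provability over `RCA₀` is expressed through all (Henkin) models of `RCA₀`: the first order part is
an arbitrary, possibly nonstandard structure, and the set variables range over an arbitrary family
of subsets of it.  Every notion below is the interpretation in such a model of the corresponding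
notion of second order arithmetic: number quantifiers range over `M.Num`, set quantifiers over
`M.Sets`, and finite sequences are the ones coded by elements of `M.Num`.
-/

universe u

/-- A structure for the language of second order arithmetic. -/
structure L2Structure where
  /-- the range of the number variables -/
  Num : Type u
  [instZero : Zero Num]
  [instOne : One Num]
  [instAdd : Add Num]
  [instMul : Mul Num]
  [instLT : LT Num]
  /-- the range of the set variables -/
  Sets : Set (Set Num)
  sets_nonempty : Sets.Nonempty

attribute [instance] L2Structure.instZero L2Structure.instOne L2Structure.instAdd
  L2Structure.instMul L2Structure.instLT

/-! ### Arithmetical formulas -/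

/-- Numerical terms; number variables are de Bruijn indices. -/
inductive ATerm : Type
  | var (i : ℕ)
  | zero
  | one
  | add (s t : ATerm)
  | mul (s t : ATerm)

/-- Arithmetical formulas: free set variables are allowed (`mem t X` says that `t` belongs to the
`X`-th set variable), set quantifiers are not.  Each quantifier binds the number variable `0`; the
bounding term of `allLt` and `exLt` is read outside of the quantifier. -/
inductive AFormula : Type
  | eq (s t : ATerm)
  | lt (s t : ATerm)
  | mem (t : ATerm) (X : ℕ)
  | neg (φ : AFormula)
  | and (φ ψ : AFormula)
  | or (φ ψ : AFormula)
  | imp (φ ψ : AFormula)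
  | allLt (t : ATerm) (φ : AFormula)
  | exLt (t : ATerm) (φ : AFormula)
  | all (φ : AFormula)
  | ex (φ : AFormula)

/-- The assignment that sends the variable `0` to `x` and the variable `n + 1` to `e n`. -/
def pushVar {α : Type u} (x : α) (e : ℕ → α) : ℕ → α
  | 0 => x
  | n + 1 => e n

namespace AFormula

/-- All quantifiers are bounded. -/
def IsDelta0 : AFormula → Prop
  | eq _ _ => True
  | lt _ _ => True
  | mem _ _ => True
  | neg φ => φ.IsDelta0
  | and φ ψ => φ.IsDelta0 ∧ ψ.IsDelta0
  | or φ ψ => φ.IsDelta0 ∧ ψ.IsDelta0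
  | imp φ ψ => φ.IsDelta0 ∧ ψ.IsDelta0
  | allLt _ φ => φ.IsDelta0
  | exLt _ φ => φ.IsDelta0
  | all _ => False
  | ex _ => False

/-- `Σ⁰₁` formulas: `∃ n, θ` with `θ` bounded. -/
def IsSigma1 (φ : AFormula) : Prop := ∃ θ : AFormula, θ.IsDelta0 ∧ φ = ex θ

/-- `Π⁰₁` formulas: `∀ n, θ` with `θ` bounded. -/
def IsPi1 (φ : AFormula) : Prop := ∃ θ : AFormula, θ.IsDelta0 ∧ φ = all θ

end AFormula

namespace L2Structure

variable (M : L2Structure.{u})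

/-- The value of a term under the assignment `e`. -/
def termVal (e : ℕ → M.Num) : ATerm → M.Num
  | .var i => e i
  | .zero => 0
  | .one => 1
  | .add s t => termVal e s + termVal e t
  | .mul s t => termVal e s * termVal e t

/-- Satisfaction of an arithmetical formula under the assignments `e` of the number variables and
`E` of the set variables. -/
def Sat : AFormula → (ℕ → M.Num) → (ℕ → Set M.Num) → Prop
  | .eq s t, e, _ => M.termVal e s = M.termVal e t
  | .lt s t, e, _ => M.termVal e s < M.termVal e t
  | .mem t X, e, E => M.termVal e t ∈ E X
  | .neg φ, e, E => ¬ Sat φ e E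
  | .and φ ψ, e, E => Sat φ e E ∧ Sat ψ e E
  | .or φ ψ, e, E => Sat φ e E ∨ Sat ψ e E
  | .imp φ ψ, e, E => Sat φ e E → Sat ψ e E
  | .allLt t φ, e, E => ∀ x, x < M.termVal e t → Sat φ (pushVar x e) E
  | .exLt t φ, e, E => ∃ x, x < M.termVal e t ∧ Sat φ (pushVar x e) E
  | .all φ, e, E => ∀ x, Sat φ (pushVar x e) E
  | .ex φ, e, E => ∃ x, Sat φ (pushVar x e) E

/-! ### `RCA₀` and `ACA₀` -/

/-- The basic axioms of second order arithmetic. -/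
structure BasicAxioms : Prop where
  succ_ne_zero : ∀ n : M.Num, n + 1 ≠ 0
  succ_inj : ∀ m n : M.Num, m + 1 = n + 1 → m = n
  add_zero : ∀ m : M.Num, m + 0 = m
  add_succ : ∀ m n : M.Num, m + (n + 1) = (m + n) + 1
  mul_zero : ∀ m : M.Num, m * 0 = 0
  mul_succ : ∀ m n : M.Num, m * (n + 1) = m * n + m
  not_lt_zero : ∀ m : M.Num, ¬ m < 0
  lt_succ_iff : ∀ m n : M.Num, m < n + 1 ↔ m < n ∨ m = n

/-- The scheme of `Σ⁰₁` induction, with number and set parameters. -/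
def Sigma1Induction : Prop :=
  ∀ φ : AFormula, φ.IsSigma1 →
    ∀ (e : ℕ → M.Num) (E : ℕ → Set M.Num), (∀ i, E i ∈ M.Sets) →
      M.Sat φ (pushVar 0 e) E →
      (∀ n, M.Sat φ (pushVar n e) E → M.Sat φ (pushVar (n + 1) e) E) →
      ∀ n, M.Sat φ (pushVar n e) E

/-- The scheme of `Δ⁰₁` (recursive) comprehension, with number and set parameters. -/
def Delta1Comprehension : Prop :=
  ∀ φ ψ : AFormula, φ.IsSigma1 → ψ.IsPi1 →
    ∀ (e : ℕ → M.Num) (E : ℕ → Set M.Num), (∀ i, E i ∈ M.Sets) →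
      (∀ n, M.Sat φ (pushVar n e) E ↔ M.Sat ψ (pushVar n e) E) →
      ∃ X ∈ M.Sets, ∀ n, n ∈ X ↔ M.Sat φ (pushVar n e) E

/-- `M` is a model of `RCA₀`. -/
structure RCA0 : Prop where
  basic : M.BasicAxioms
  sigma1_induction : M.Sigma1Induction
  delta1_comprehension : M.Delta1Comprehension

/-- The scheme of arithmetical comprehension, with number and set parameters. -/
def ArithmeticalComprehension : Prop :=
  ∀ φ : AFormula, ∀ (e : ℕ → M.Num) (E : ℕ → Set M.Num), (∀ i, E i ∈ M.Sets) →
    ∃ X ∈ M.Sets, ∀ n, n ∈ X ↔ M.Sat φ (pushVar n e) E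

/-- `M` is a model of `ACA₀`. -/
structure ACA0 : Prop where
  rca0 : M.RCA0
  arithmetical_comprehension : M.ArithmeticalComprehension

variable {M}

/-! ### Pairs, functions, well orders and `ATR₀` -/

/-- The code `(i + j)² + i` of the ordered pair of `i` and `j`. -/
def pair (i j : M.Num) : M.Num := (i + j) * (i + j) + i

/-- The set `F` of codes of pairs is (the graph of) a function from `A` to `B`. -/
def IsFun (F A B : Set M.Num) : Prop :=
  (∀ z ∈ F, ∃ a ∈ A, ∃ b ∈ B, z = pair a b) ∧ ∀ a ∈ A, ∃! b, pair a b ∈ F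

/-- `i ≤_X j`, where `X` is a set of codes of pairs. -/
def relLE (X : Set M.Num) (i j : M.Num) : Prop := pair i j ∈ X

/-- `i <_X j`. -/
def relLT (X : Set M.Num) (i j : M.Num) : Prop := relLE X i j ∧ ¬ relLE X j i

/-- The field of the reflexive relation coded by `X`. -/
def field (X : Set M.Num) : Set M.Num := {i | relLE X i i}

/-- `X` codes a (reflexive) linear order of its field. -/
structure IsLO (X : Set M.Num) : Prop where
  refl : ∀ i j, relLE X i j → i ∈ field X ∧ j ∈ field X
  trans : ∀ i j k, relLE X i j → relLE X j k → relLE X i k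
  antisymm : ∀ i j, relLE X i j → relLE X j i → i = j
  total : ∀ i ∈ field X, ∀ j ∈ field X, relLE X i j ∨ relLE X j i

/-- `X` codes a well order in the sense of `M`: a linear order such that no function of `M` is an
infinite descending sequence. -/
def IsWO (X : Set M.Num) : Prop :=
  IsLO X ∧ ¬ ∃ f ∈ M.Sets, IsFun f Set.univ (field X) ∧
    ∀ n a b, pair n a ∈ f → pair (n + 1) b ∈ f → relLT X b a

/-- `Y^j = {⟨m, a⟩ ∈ Y : a <_X j}`. -/
def below (X Y : Set M.Num) (j : M.Num) : Set M.Num :=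
  {z | ∃ m a, z = pair m a ∧ relLT X a j ∧ pair m a ∈ Y}

/-- `H_θ(X, Y)`: `X` is a linear order and `Y = {⟨n, j⟩ : j ∈ field(X) ∧ θ(n, Y^j)}`.  In `θ`, the
number variable `0` stands for `n`, the set variable `0` for `Y^j`, and all the others are
parameters. -/
def IsHierarchy (θ : AFormula) (e : ℕ → M.Num) (E : ℕ → Set M.Num) (X Y : Set M.Num) : Prop :=
  IsLO X ∧ ∀ z, z ∈ Y ↔
    ∃ n j, z = pair n j ∧ j ∈ field X ∧ M.Sat θ (pushVar n e) (pushVar (below X Y j) E)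

variable (M)

/-- The scheme of arithmetical transfinite recursion, with number and set parameters. -/
def ArithmeticalTransfiniteRecursion : Prop :=
  ∀ θ : AFormula, ∀ (e : ℕ → M.Num) (E : ℕ → Set M.Num), (∀ i, E i ∈ M.Sets) →
    ∀ X ∈ M.Sets, IsWO X → ∃ Y ∈ M.Sets, IsHierarchy θ e E X Y

/-- `M` is a model of `ATR₀`. -/
structure ATR0 : Prop where
  aca0 : M.ACA0
  transfinite_recursion : M.ArithmeticalTransfiniteRecursion

/-- The standard numerals. -/
def num : ℕ → M.Num
  | 0 => 0
  | n + 1 => num n + 1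

variable {M}

/-! ### Codes of finite sequences -/

/-- `a` divides `b`. -/
def Divides (a b : M.Num) : Prop := ∃ q, b = a * q

/-- `i` belongs to the finite set `{i < k : m(i + 1) + 1 divides n}` presented by the triple
`c = ⟨k, ⟨m, n⟩⟩`. -/
def FinMem (i c : M.Num) : Prop :=
  ∃ k m n, c = pair k (pair m n) ∧ i < k ∧ Divides (m * (i + 1) + 1) n

/-- `c` is a triple. -/
def IsTriple (c : M.Num) : Prop := ∃ k m n : M.Num, c = pair k (pair m n)

/-- `c` is the code of a finite set: the least triple that presents it. -/
def IsFinCode (c : M.Num) : Prop :=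
  IsTriple c ∧ ∀ c', c' < c → IsTriple c' → ¬ ∀ i, FinMem i c' ↔ FinMem i c

/-- The entry of the finite sequence `σ` at the place `i` is `x`. -/
def Entry (σ i x : M.Num) : Prop := FinMem (pair i x) σ

/-- `σ` is the code of a finite sequence of length `l`, that is, of a finite set of pairs that is
a function with domain `{i : i < l}`. -/
def IsSeqLen (σ l : M.Num) : Prop :=
  IsFinCode σ ∧ (∀ z, FinMem z σ → ∃ i x, i < l ∧ z = pair i x) ∧ ∀ i, i < l → ∃! x, Entry σ i x

/-- `σ` is an initial segment of the finite sequence `τ` (possibly `τ` itself). -/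
def InitSeg (σ τ : M.Num) : Prop :=
  ∃ l l', IsSeqLen σ l ∧ IsSeqLen τ l' ∧ (l < l' ∨ l = l') ∧
    ∀ i, i < l → ∀ x, Entry σ i x ↔ Entry τ i x

/-- `σ'` is the extension of the finite sequence `σ` by the single entry `m`. -/
def IsSnoc (σ m σ' : M.Num) : Prop :=
  ∃ l, IsSeqLen σ l ∧ IsSeqLen σ' (l + 1) ∧ (∀ i, i < l → ∀ x, Entry σ i x ↔ Entry σ' i x) ∧
    Entry σ' l m

/-- `σ` is the sequence `⟨m⟩` of length one. -/
def IsSingleton (σ m : M.Num) : Prop := IsSeqLen σ 1 ∧ Entry σ 0 m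

/-- `a` is the last entry of the nonempty finite sequence `σ`. -/
def IsLast (σ a : M.Num) : Prop := ∃ n, IsSeqLen σ (n + 1) ∧ Entry σ n a

/-- `σ` is the restriction of the function `p` to `{i : i < l}`. -/
def IsRestriction (p : Set M.Num) (l σ : M.Num) : Prop :=
  IsSeqLen σ l ∧ ∀ i, i < l → ∀ x, Entry σ i x ↔ pair i x ∈ p

/-- `σ ≺ p`: the finite sequence `σ` is an initial segment of the function `p`. -/
def PrecFun (σ : M.Num) (p : Set M.Num) : Prop := ∃ l, IsRestriction p l σ

/-! ### The space `(ω)^k` and its open sets -/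

variable (M)

/-- `(ω)^k`: the ordered surjective functions of `M` from the natural numbers to `k`. -/
def Partition (k : ℕ) : Set (Set M.Num) :=
  {p | p ∈ M.Sets ∧ IsFun p Set.univ {i | i < M.num k} ∧
    (∀ n i, pair n i ∈ p → ∀ j, j < i → ∃ m, m < n ∧ pair m j ∈ p) ∧
    ∀ i, i < M.num k → ∃ n, pair n i ∈ p}

/-- `(ω)^k_fin`: the (codes of) ordered finite sequences of numbers below `k` in which all numbers
below `k` appear. -/
def FinPartition (k : ℕ) : Set M.Num :=
  {σ | ∃ l, IsSeqLen σ l ∧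
    (∀ n i, n < l → Entry σ n i → i < M.num k) ∧
    (∀ n i, n < l → Entry σ n i → ∀ j, j < i → ∃ m, m < n ∧ Entry σ m j) ∧
    ∀ i, i < M.num k → ∃ n, n < l ∧ Entry σ n i}

/-- `τ` is a function of `M` that enumerates `(ω)^k_fin` as `τ_0, τ_1, …`. -/
def IsEnumeration (k : ℕ) (τ : Set M.Num) : Prop :=
  τ ∈ M.Sets ∧ IsFun τ Set.univ (M.FinPartition k) ∧
    ∀ σ ∈ M.FinPartition k, ∃ m, pair m σ ∈ τ

/-- `O` is a code for an open set in `(ω)^k`. -/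
def IsOpenCode (k : ℕ) (O : Set M.Num) : Prop :=
  O ∈ M.Sets ∧ ∀ z ∈ O, ∃ n, ∃ σ ∈ M.FinPartition k, z = pair n σ

/-- `D` is a code for a sequence of open sets in `(ω)^k`. -/
def IsOpenSeqCode (k : ℕ) (D : Set M.Num) : Prop :=
  D ∈ M.Sets ∧ ∀ z ∈ D, ∃ i n, ∃ σ ∈ M.FinPartition k, z = pair i (pair n σ)

variable {M}

/-- The partition `p` is in the open set coded by `O`. -/
def MemOpen (p O : Set M.Num) : Prop := ∃ n σ, pair n σ ∈ O ∧ PrecFun σ p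

/-- The code of the `i`-th open set of the sequence coded by `D`. -/
def openSlice (D : Set M.Num) (i : M.Num) : Set M.Num :=
  {z | ∃ n σ, z = pair n σ ∧ pair i (pair n σ) ∈ D}

/-- The finite sequences `σ` and `τ` are comparable. -/
def Comparable (σ τ : M.Num) : Prop := InitSeg σ τ ∨ InitSeg τ σ

/-- The open set coded by `O` is dense in `(ω)^k`.  (The union of two open codes is a code for the
union of the open sets.) -/
def IsDenseOpen (k : ℕ) (O : Set M.Num) : Prop :=
  ∀ τ ∈ M.FinPartition k, ∃ n σ, pair n σ ∈ O ∧ Comparable σ τ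

/-! ### Borel codes -/

/-- `T` is a tree: a set of finite sequences closed under initial segments. -/
def IsTree (T : Set M.Num) : Prop :=
  (∀ σ ∈ T, ∃ l, IsSeqLen σ l) ∧ ∀ σ ∈ T, ∀ ρ, InitSeg ρ σ → ρ ∈ T

variable (M)

/-- `B` is a Borel code: a tree of `M` without an infinite path in `M`, such that there is exactly
one `m` with `⟨m⟩ ∈ B`. -/
structure IsBorelCode (B : Set M.Num) : Prop where
  mem_sets : B ∈ M.Sets
  tree : IsTree B
  no_path : ¬ ∃ g ∈ M.Sets, IsFun g Set.univ Set.univ ∧ ∀ n, ∃ σ ∈ B, IsRestriction g n σ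
  root : ∃! m, ∃ σ ∈ B, IsSingleton σ m

variable {M}

/-- `σ` is a leaf of the tree `B`. -/
def IsLeaf (B : Set M.Num) (σ : M.Num) : Prop := σ ∈ B ∧ ¬ ∃ m, ∃ σ' ∈ B, IsSnoc σ m σ'

/-- The clopen set coded by the label `a` of a leaf contains `p`: the labels `0`, `1`, `2m + 2` and
`2m + 3` stand for `∅`, `(ω)^k`, `[τ_m]` and the complement of `[τ_m]`. -/
def LeafHolds (τ p : Set M.Num) (a : M.Num) : Prop :=
  a = 1 ∨ ∃ m t, pair m t ∈ τ ∧
    ((a = M.num 2 * m + M.num 2 ∧ PrecFun t p) ∨ (a = M.num 2 * m + M.num 3 ∧ ¬ PrecFun t p))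

variable (M)

/-- `f` is an evaluation map for the Borel code `B` at `p ∈ (ω)^k` (with respect to the enumeration
`τ` of `(ω)^k_fin`): a function `f : B → {0, 1}` of `M` that takes the right values at the leaves
and respects unions (last entry even) and intersections (last entry odd) at the interior nodes. -/
structure IsEvaluation (τ B p f : Set M.Num) : Prop where
  mem_sets : f ∈ M.Sets
  isFun : IsFun f B {0, 1}
  leaf : ∀ σ a, IsLeaf B σ → IsLast σ a → (pair σ 1 ∈ f ↔ LeafHolds τ p a)
  union : ∀ σ a, σ ∈ B → ¬ IsLeaf B σ → IsLast σ a → (∃ c, a = M.num 2 * c) →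
    (pair σ 1 ∈ f ↔ ∃ m, ∃ σ' ∈ B, IsSnoc σ m σ' ∧ pair σ' 1 ∈ f)
  inter : ∀ σ a, σ ∈ B → ¬ IsLeaf B σ → IsLast σ a → (∃ c, a = M.num 2 * c + 1) →
    (pair σ 1 ∈ f ↔ ∀ m, ∀ σ' ∈ B, IsSnoc σ m σ' → pair σ' 1 ∈ f)
  root : ∀ σ ρ m, IsSeqLen σ 0 → ρ ∈ B → IsSingleton ρ m → (pair σ 1 ∈ f ↔ pair ρ 1 ∈ f)

/-- `p ∈ B`: there is an evaluation map for `B` at `p` with value `1` at the empty sequence. -/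
def MemBorel (τ B p : Set M.Num) : Prop :=
  ∃ f, M.IsEvaluation τ B p f ∧ ∃ σ, IsSeqLen σ 0 ∧ pair σ 1 ∈ f

/-- `p ∉ B`: there is an evaluation map for `B` at `p` with value `0` at the empty sequence. -/
def NotMemBorel (τ B p : Set M.Num) : Prop :=
  ∃ f, M.IsEvaluation τ B p f ∧ ∃ σ, IsSeqLen σ 0 ∧ pair σ 0 ∈ f

/-- The open sets `U`, `V` and the sequence `D` of dense open sets form a Baire code for `B`. -/
structure IsBaireCode (k : ℕ) (τ B U V D : Set M.Num) : Prop where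
  openU : M.IsOpenCode k U
  openV : M.IsOpenCode k V
  openD : M.IsOpenSeqCode k D
  denseD : ∀ n, IsDenseOpen k (openSlice D n)
  denseUV : IsDenseOpen k (U ∪ V)
  mem_of_mem : ∀ x ∈ M.Partition k, (∀ n, MemOpen x (openSlice D n)) →
    MemOpen x U → M.MemBorel τ B x
  not_mem_of_mem : ∀ x ∈ M.Partition k, (∀ n, MemOpen x (openSlice D n)) →
    MemOpen x V → M.NotMemBorel τ B x

/-- For every Borel code `B` for a subset of `(ω)^k`, there is an `x ∈ (ω)^k` such that `x ∈ B` or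
`x ∉ B`. -/
def BorelCodesHaveEvaluatedPoint (k : ℕ) (τ : Set M.Num) : Prop :=
  ∀ B, M.IsBorelCode B → ∃ x ∈ M.Partition k, M.MemBorel τ B x ∨ M.NotMemBorel τ B x

/-- Every Borel code for a subset of `(ω)^k` has a Baire code. -/
def BorelCodesHaveBaireCode (k : ℕ) (τ : Set M.Num) : Prop :=
  ∀ B, M.IsBorelCode B → ∃ U V D, M.IsBaireCode k τ B U V D

end L2Structure

/-!
`ATR₀` implies that every Borel code has a Baire code: by transfinite recursion along the
Kleene–Brouwer order of the code, one defines for each node which conditions `σ ∈ (ω)^k_fin` force a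
generic partition into, or out of, the set coded at that node.  Deciding a given node is a dense
open property of conditions, so that the partitions deciding all nodes form an intersection of dense
open sets, and the truth values decided by such a partition are an evaluation map.  The open sets
`U` and `V` of the Baire code consist of the conditions that force the root in and out.

A Baire code provides an evaluated point by the Baire category theorem, which holds in `RCA₀`
because a point of the intersection can be found by primitive recursion.

For the way back to `ATR₀`, a tree of paths through a well founded game is a Borel code once unions
and intersections alternate along with the players and every leaf is `∅` or the whole space.  Its
evaluation map does not depend on the partition at which it is evaluated, and picks out the winning
positions of the game.  The truth of an arithmetical formula is the outcome of a game, whence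
`ACA₀`; the hierarchy of an arithmetical operator along a well order is given by the outcomes of a
game in which a query about an earlier level becomes a move to that level, whence `ATR₀`.
-/

namespace L2Structure

/-! ### The ordered semiring of the numbers -/

namespace RCA0

variable {M : L2Structure.{u}} (hM : M.RCA0)
include hM

/-- Bounded formulas satisfy induction as `Σ⁰₁` formulas with a dummy quantifier, which binds the
variable `0`. -/
theorem delta0_induction (θ : AFormula) (hθ : θ.IsDelta0) (e : ℕ → M.Num) {P : M.Num → Prop}
    (hP : ∀ E w n, M.Sat θ (pushVar w (pushVar n e)) E ↔ P n)
    (zero : P 0) (succ : ∀ n, P n → P (n + 1)) (n : M.Num) : P n := by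
  obtain ⟨S, hS⟩ := M.sets_nonempty
  obtain ⟨w, hw⟩ := hM.sigma1_induction (.ex θ) ⟨θ, hθ, rfl⟩ e (fun _ => S) (fun _ => hS)
    ⟨0, (hP _ _ _).2 zero⟩ (fun n ⟨_, hw⟩ => ⟨0, (hP _ _ _).2 (succ n ((hP _ _ _).1 hw))⟩) n
  exact (hP _ _ _).1 hw

protected theorem zero_add (n : M.Num) : 0 + n = n := by
  refine hM.delta0_induction (.eq (.add .zero (.var 1)) (.var 1)) trivial (fun _ => 0)
    (P := fun n => 0 + n = n) (fun _ _ _ => Iff.rfl) (hM.basic.add_zero 0) (fun n ih => ?_) n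
  rw [hM.basic.add_succ, ih]

protected theorem succ_add (m n : M.Num) : m + 1 + n = m + n + 1 := by
  refine hM.delta0_induction (.eq (.add (.add (.var 2) .one) (.var 1))
    (.add (.add (.var 2) (.var 1)) .one)) trivial (fun _ => m)
    (P := fun n => m + 1 + n = m + n + 1) (fun _ _ _ => Iff.rfl) ?_ (fun n ih => ?_) n
  · rw [hM.basic.add_zero, hM.basic.add_zero]
  · rw [hM.basic.add_succ, ih, hM.basic.add_succ]

protected theorem add_comm (m n : M.Num) : m + n = n + m := by
  refine hM.delta0_induction (.eq (.add (.var 2) (.var 1)) (.add (.var 1) (.var 2)))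
    trivial (fun _ => m) (P := fun n => m + n = n + m) (fun _ _ _ => Iff.rfl) ?_ (fun n ih => ?_) n
  · rw [hM.basic.add_zero, hM.zero_add]
  · rw [hM.basic.add_succ, ih, hM.succ_add]

protected theorem add_assoc (a b n : M.Num) : a + b + n = a + (b + n) := by
  refine hM.delta0_induction (.eq (.add (.add (.var 2) (.var 3)) (.var 1))
    (.add (.var 2) (.add (.var 3) (.var 1)))) trivial (pushVar a fun _ => b)
    (P := fun n => a + b + n = a + (b + n)) (fun _ _ _ => Iff.rfl) ?_ (fun n ih => ?_) n
  · rw [hM.basic.add_zero, hM.basic.add_zero]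
  · rw [hM.basic.add_succ, ih, hM.basic.add_succ, hM.basic.add_succ]

protected theorem zero_mul (n : M.Num) : 0 * n = 0 := by
  refine hM.delta0_induction (.eq (.mul .zero (.var 1)) .zero) trivial (fun _ => 0)
    (P := fun n => 0 * n = 0) (fun _ _ _ => Iff.rfl) (hM.basic.mul_zero 0) (fun n ih => ?_) n
  rw [hM.basic.mul_succ, ih, hM.basic.add_zero]

protected theorem succ_mul (m n : M.Num) : (m + 1) * n = m * n + n := by
  refine hM.delta0_induction (.eq (.mul (.add (.var 2) .one) (.var 1))
    (.add (.mul (.var 2) (.var 1)) (.var 1))) trivial (fun _ => m)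
    (P := fun n => (m + 1) * n = m * n + n) (fun _ _ _ => Iff.rfl) ?_ (fun n ih => ?_) n
  · rw [hM.basic.mul_zero, hM.basic.mul_zero, hM.basic.add_zero]
  · rw [hM.basic.mul_succ, ih, hM.basic.mul_succ, hM.basic.add_succ, hM.basic.add_succ,
      hM.add_assoc (m * n) n m, hM.add_assoc (m * n) m n, hM.add_comm n m]

protected theorem mul_comm (m n : M.Num) : m * n = n * m := by
  refine hM.delta0_induction (.eq (.mul (.var 2) (.var 1)) (.mul (.var 1) (.var 2)))
    trivial (fun _ => m) (P := fun n => m * n = n * m) (fun _ _ _ => Iff.rfl) ?_ (fun n ih => ?_) n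
  · rw [hM.basic.mul_zero, hM.zero_mul]
  · rw [hM.basic.mul_succ, ih, hM.succ_mul]

protected theorem mul_add (a b n : M.Num) : a * (b + n) = a * b + a * n := by
  refine hM.delta0_induction (.eq (.mul (.var 2) (.add (.var 3) (.var 1)))
    (.add (.mul (.var 2) (.var 3)) (.mul (.var 2) (.var 1)))) trivial (pushVar a fun _ => b)
    (P := fun n => a * (b + n) = a * b + a * n) (fun _ _ _ => Iff.rfl) ?_ (fun n ih => ?_) n
  · rw [hM.basic.add_zero, hM.basic.mul_zero, hM.basic.add_zero]
  · rw [hM.basic.add_succ, hM.basic.mul_succ, ih, hM.basic.mul_succ, hM.add_assoc]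

protected theorem mul_assoc (a b n : M.Num) : a * b * n = a * (b * n) := by
  refine hM.delta0_induction (.eq (.mul (.mul (.var 2) (.var 3)) (.var 1))
    (.mul (.var 2) (.mul (.var 3) (.var 1)))) trivial (pushVar a fun _ => b)
    (P := fun n => a * b * n = a * (b * n)) (fun _ _ _ => Iff.rfl) ?_ (fun n ih => ?_) n
  · rw [hM.basic.mul_zero, hM.basic.mul_zero, hM.basic.mul_zero]
  · rw [hM.basic.mul_succ, ih, hM.basic.mul_succ, hM.mul_add]

protected theorem add_right_cancel {a b : M.Num} (n : M.Num) : a + n = b + n → a = b := by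
  refine hM.delta0_induction (.imp (.eq (.add (.var 2) (.var 1)) (.add (.var 3) (.var 1)))
    (.eq (.var 2) (.var 3))) ⟨trivial, trivial⟩ (pushVar a fun _ => b)
    (P := fun n => a + n = b + n → a = b) (fun _ _ _ => Iff.rfl) ?_ (fun n ih h => ?_) n
  · rw [hM.basic.add_zero, hM.basic.add_zero]; exact id
  · rw [hM.basic.add_succ, hM.basic.add_succ] at h
    exact ih (hM.basic.succ_inj _ _ h)

protected theorem lt_add_succ (m d : M.Num) : m < m + d + 1 := by
  refine hM.delta0_induction (.lt (.var 2) (.add (.add (.var 2) (.var 1)) .one)) trivial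
    (fun _ => m) (P := fun d => m < m + d + 1) (fun _ _ _ => Iff.rfl) ?_ (fun n ih => ?_) d
  · rw [hM.basic.add_zero]; exact (hM.basic.lt_succ_iff _ _).2 (Or.inr rfl)
  · rw [hM.basic.add_succ]; exact (hM.basic.lt_succ_iff _ _).2 (Or.inl ih)

protected theorem exists_add_succ_of_lt {m n : M.Num} (h : m < n) : ∃ d, m + d + 1 = n := by
  obtain ⟨S, hS⟩ := M.sets_nonempty
  suffices ∀ n, ∃ d, m < n → m + d + 1 = n from (this n).imp fun _ hd => hd h
  refine hM.sigma1_induction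
    (.ex (.imp (.lt (.var 2) (.var 1)) (.eq (.add (.add (.var 2) (.var 0)) .one) (.var 1))))
    (by refine ⟨_, ?_, rfl⟩; exact ⟨trivial, trivial⟩) (fun _ => m) (fun _ => S) (fun _ => hS)
    ⟨0, fun h => absurd h (hM.basic.not_lt_zero _)⟩ ?_
  rintro n ⟨d, hd : m < n → m + d + 1 = n⟩
  by_cases hmn : m < n
  · refine ⟨d + 1, fun _ => ?_⟩
    change m + (d + 1) + 1 = n + 1
    rw [hM.basic.add_succ, hd hmn]
  · refine ⟨0, fun hmn' : m < n + 1 => ?_⟩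
    change m + 0 + 1 = n + 1
    rw [hM.basic.add_zero, show m = n from ((hM.basic.lt_succ_iff _ _).1 hmn').resolve_left hmn]

protected theorem lt_iff_exists_add_succ {m n : M.Num} : m < n ↔ ∃ d, m + d + 1 = n :=
  ⟨hM.exists_add_succ_of_lt, fun ⟨d, hd⟩ => hd ▸ hM.lt_add_succ m d⟩

protected theorem eq_zero_or_pos (n : M.Num) : n = 0 ∨ 0 < n := by
  refine hM.delta0_induction (.or (.eq (.var 1) .zero) (.lt .zero (.var 1))) ⟨trivial, trivial⟩
    (fun _ => 0) (P := fun n => n = 0 ∨ 0 < n) (fun _ _ _ => Iff.rfl) (Or.inl rfl)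
    (fun n ih => ?_) n
  exact Or.inr ((hM.basic.lt_succ_iff _ _).2 (ih.symm.imp id Eq.symm))

protected theorem lt_trichotomy (m n : M.Num) : m < n ∨ m = n ∨ n < m := by
  refine hM.delta0_induction (.or (.lt (.var 2) (.var 1)) (.or (.eq (.var 2) (.var 1))
    (.lt (.var 1) (.var 2)))) ⟨trivial, trivial, trivial⟩ (fun _ => m)
    (P := fun n => m < n ∨ m = n ∨ n < m) (fun _ _ _ => Iff.rfl)
    (Or.inr (hM.eq_zero_or_pos m)) (fun n ih => ?_) n
  rcases ih with h | h | h
  · exact Or.inl ((hM.basic.lt_succ_iff _ _).2 (Or.inl h))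
  · exact Or.inl ((hM.basic.lt_succ_iff _ _).2 (Or.inr h))
  · obtain ⟨d, rfl⟩ := hM.exists_add_succ_of_lt h
    rcases hM.eq_zero_or_pos d with rfl | hd
    · rw [hM.basic.add_zero]; exact Or.inr (Or.inl rfl)
    · obtain ⟨c, rfl⟩ := hM.exists_add_succ_of_lt hd
      refine Or.inr (Or.inr (hM.lt_iff_exists_add_succ.2 ⟨c, ?_⟩))
      rw [hM.zero_add, hM.basic.add_succ, hM.succ_add]

protected theorem lt_trans {a b c : M.Num} (hab : a < b) (hbc : b < c) : a < c := by
  obtain ⟨d, rfl⟩ := hM.exists_add_succ_of_lt hab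
  obtain ⟨d', rfl⟩ := hM.exists_add_succ_of_lt hbc
  refine hM.lt_iff_exists_add_succ.2 ⟨d + 1 + d', ?_⟩
  rw [← hM.add_assoc, hM.basic.add_succ]

protected theorem lt_irrefl (a : M.Num) : ¬ a < a := by
  intro h
  obtain ⟨d, hd⟩ := hM.exists_add_succ_of_lt h
  rw [hM.add_assoc, hM.add_comm a] at hd
  exact hM.basic.succ_ne_zero d (hM.add_right_cancel a (hd.trans (hM.zero_add a).symm))

end RCA0

section OrderedSemiring

variable {M : L2Structure.{u}} [hM : Fact M.RCA0]

noncomputable instance : CommSemiring M.Num where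
  add_assoc := hM.out.add_assoc
  zero_add := hM.out.zero_add
  add_zero := hM.out.basic.add_zero
  add_comm := hM.out.add_comm
  nsmul := nsmulRec
  npow := npowRec
  left_distrib := hM.out.mul_add
  right_distrib a b c := by
    rw [hM.out.mul_comm, hM.out.mul_add, hM.out.mul_comm c, hM.out.mul_comm c]
  zero_mul := hM.out.zero_mul
  mul_zero := hM.out.basic.mul_zero
  mul_assoc := hM.out.mul_assoc
  one_mul a := by
    have h := hM.out.succ_mul 0 a
    rwa [hM.out.zero_add, hM.out.zero_mul, hM.out.zero_add] at h
  mul_one a := by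
    have h := hM.out.basic.mul_succ a 0
    rwa [hM.out.zero_add, hM.out.basic.mul_zero, hM.out.zero_add] at h
  mul_comm := hM.out.mul_comm

instance : IsStrictTotalOrder M.Num (· < ·) where
  irrefl := hM.out.lt_irrefl
  trans _ _ _ := hM.out.lt_trans
  trichotomous a b hab hba := ((hM.out.lt_trichotomy a b).resolve_left hab).resolve_right hba

open Classical in
noncomputable instance : LinearOrder M.Num := linearOrderOfSTO (· < ·)

theorem lt_iff_exists_add_succ {m n : M.Num} : m < n ↔ ∃ d, m + d + 1 = n :=
  hM.out.lt_iff_exists_add_succ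

instance : IsStrictOrderedRing M.Num :=
  have add_lt_add_left' (a : M.Num) {b c : M.Num} (h : b < c) : a + b < a + c := by
    obtain ⟨d, rfl⟩ := lt_iff_exists_add_succ.1 h
    exact lt_iff_exists_add_succ.2 ⟨d, by ring⟩
  have mul_lt_mul_left' {a b c : M.Num} (ha : 0 < a) (h : b < c) : a * b < a * c := by
    obtain ⟨d, rfl⟩ := lt_iff_exists_add_succ.1 h
    obtain ⟨d', rfl⟩ := lt_iff_exists_add_succ.1 ha
    exact lt_iff_exists_add_succ.2 ⟨d + d' * d + d', by ring⟩
  { add_le_add_left := fun a b h c => by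
      rcases h.lt_or_eq with h | rfl
      · rw [add_comm a, add_comm b]; exact (add_lt_add_left' c h).le
      · exact le_refl _
    le_of_add_le_add_left := fun a b c h => by
      by_contra! hlt
      exact absurd (add_lt_add_left' a hlt) h.not_gt
    zero_le_one := (hM.out.eq_zero_or_pos 1).elim (fun h => h.ge) le_of_lt
    exists_pair_ne := ⟨0, 1, fun h => hM.out.basic.succ_ne_zero 0 (by rw [zero_add, ← h])⟩
    mul_lt_mul_of_pos_left := fun _ ha _ _ h => mul_lt_mul_left' ha h
    mul_lt_mul_of_pos_right := fun a ha b c h => by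
      rw [mul_comm b, mul_comm c]; exact mul_lt_mul_left' ha h }

instance : CanonicallyOrderedAdd M.Num :=
  have le_self_add' (a b : M.Num) : a ≤ a + b := by
    refine le_add_of_nonneg_right ((hM.out.eq_zero_or_pos b).elim (fun h => h.ge) le_of_lt)
  { exists_add_of_le := fun {a b} h => by
      rcases h.lt_or_eq with h | rfl
      · obtain ⟨d, rfl⟩ := lt_iff_exists_add_succ.1 h
        exact ⟨d + 1, by ring⟩
      · exact ⟨0, by ring⟩
    le_add_self := fun a b => add_comm a b ▸ le_self_add' a b
    le_self_add := le_self_add' }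

instance : SuccAddOrder M.Num where
  succ a := a + 1
  le_succ _ := le_self_add
  max_of_succ_le h := absurd (lt_add_one _) h.not_gt
  succ_le_of_lt h := by
    obtain ⟨d, rfl⟩ := lt_iff_exists_add_succ.1 h
    rw [add_right_comm]; exact le_self_add
  succ_eq_add_one _ := rfl

theorem eq_zero_or_exists_add_one (n : M.Num) : n = 0 ∨ ∃ m, n = m + 1 := by
  refine (hM.out.eq_zero_or_pos n).imp id fun h => ?_
  obtain ⟨d, hd⟩ := lt_iff_exists_add_succ.1 h
  exact ⟨d, by rw [← hd, zero_add]⟩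

end OrderedSemiring

/-! ### Pairs -/

section Pairing

variable {M : L2Structure.{u}} [hM : Fact M.RCA0]

theorem le_pair_left (a b : M.Num) : a ≤ pair a b := le_add_self

theorem le_pair_right (a b : M.Num) : b ≤ pair a b := by
  rcases eq_zero_or_exists_add_one b with rfl | ⟨c, rfl⟩
  · exact zero_le
  · calc c + 1 ≤ a + (c + 1) := le_add_self
      _ ≤ (a + (c + 1)) * (a + (c + 1)) :=
        le_mul_of_one_le_left zero_le (le_add_self.trans (add_assoc a c 1).le)
      _ ≤ pair a (c + 1) := le_self_add

theorem lt_pair_add_one_left (a b : M.Num) : a < pair a b + 1 :=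
  Order.lt_add_one_iff.2 (le_pair_left a b)

theorem lt_pair_add_one_right (a b : M.Num) : b < pair a b + 1 :=
  Order.lt_add_one_iff.2 (le_pair_right a b)

theorem pair_lt_of_add_lt {a b a' b' : M.Num} (h : a + b < a' + b') : pair a b < pair a' b' := by
  have h' : a + b + 1 ≤ a' + b' := Order.add_one_le_iff.2 h
  calc pair a b = (a + b) * (a + b) + a := rfl
    _ ≤ (a + b) * (a + b) + (a + b) := by gcongr; exact le_self_add
    _ < (a + b) * (a + b) + (a + b) + (a + b + 1) :=
        lt_add_of_pos_right _ (Order.lt_add_one_iff.2 zero_le)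
    _ = (a + b + 1) * (a + b + 1) := by ring
    _ ≤ (a' + b') * (a' + b') := mul_le_mul h' h' zero_le zero_le
    _ ≤ pair a' b' := le_self_add

theorem pair_inj {a b a' b' : M.Num} (h : pair a b = pair a' b') : a = a' ∧ b = b' := by
  rcases lt_trichotomy (a + b) (a' + b') with hlt | heq | hgt
  · exact absurd h (pair_lt_of_add_lt hlt).ne
  · obtain rfl : a = a' := by
      unfold pair at h
      rw [heq] at h
      exact add_left_cancel h
    exact ⟨rfl, add_left_cancel heq⟩
  · exact absurd h.symm (pair_lt_of_add_lt hgt).ne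

@[simp] theorem pair_eq_pair {a b a' b' : M.Num} : pair a b = pair a' b' ↔ a = a' ∧ b = b' :=
  ⟨pair_inj, fun ⟨h, h'⟩ => h ▸ h' ▸ rfl⟩

/-- The pairs; as `pair` is not surjective, not every number is one. -/
def IsPair (z : M.Num) : Prop := ∃ a b, z = pair a b

open Classical in
/-- The first component of a pair, and `0` at a number that is not a pair. -/
noncomputable def fst (z : M.Num) : M.Num := if h : IsPair z then h.choose else 0

open Classical in
/-- The second component of a pair, and `0` at a number that is not a pair. -/
noncomputable def snd (z : M.Num) : M.Num := if h : IsPair z then h.choose_spec.choose else 0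

omit hM in
theorem isPair_pair (a b : M.Num) : IsPair (pair a b) := ⟨a, b, rfl⟩

omit hM in
theorem pair_fst_snd {z : M.Num} (h : IsPair z) : pair (fst z) (snd z) = z := by
  unfold fst snd
  rw [dif_pos h, dif_pos h]
  exact h.choose_spec.choose_spec.symm

@[simp] theorem fst_pair (a b : M.Num) : fst (pair a b) = a :=
  (pair_inj (pair_fst_snd (isPair_pair a b))).1

@[simp] theorem snd_pair (a b : M.Num) : snd (pair a b) = b :=
  (pair_inj (pair_fst_snd (isPair_pair a b))).2

theorem fst_eq_iff {z y : M.Num} :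
    fst z = y ↔ (∃ b, b < z + 1 ∧ z = pair y b) ∨ y = 0 ∧ ¬ IsPair z := by
  by_cases hz : IsPair z
  · obtain ⟨a, b, rfl⟩ := hz
    simp only [fst_pair, pair_eq_pair, isPair_pair, not_true, and_false, or_false]
    exact ⟨fun h => ⟨b, lt_pair_add_one_right a b, h, rfl⟩, fun ⟨_, _, h, _⟩ => h⟩
  · have hfst : fst z = 0 := dif_neg hz
    rw [hfst, eq_comm]
    exact ⟨fun h => .inr ⟨h, hz⟩, fun h => (h.resolve_left fun ⟨b, _, h⟩ => hz ⟨y, b, h⟩).1⟩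

theorem snd_eq_iff {z y : M.Num} :
    snd z = y ↔ (∃ a, a < z + 1 ∧ z = pair a y) ∨ y = 0 ∧ ¬ IsPair z := by
  by_cases hz : IsPair z
  · obtain ⟨a, b, rfl⟩ := hz
    simp only [snd_pair, pair_eq_pair, isPair_pair, not_true, and_false, or_false]
    exact ⟨fun h => ⟨a, lt_pair_add_one_left a b, rfl, h⟩, fun ⟨_, _, _, h⟩ => h⟩
  · have hsnd : snd z = 0 := dif_neg hz
    rw [hsnd, eq_comm]
    exact ⟨fun h => .inr ⟨h, hz⟩, fun h => (h.resolve_left fun ⟨a, _, h⟩ => hz ⟨a, y, h⟩).1⟩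

theorem fst_le (z : M.Num) : fst z ≤ z := by
  rcases fst_eq_iff.1 (rfl : fst z = fst z) with ⟨b, -, h⟩ | ⟨h, -⟩
  · exact (le_pair_left _ b).trans h.ge
  · exact h ▸ zero_le

end Pairing

/-! ### Sets and functions of the model -/

variable {M : L2Structure.{u}}

/-- The property `P` of numbers defines a set of the model. A binary property `P` is treated as the
property `fun z => P (fst z) (snd z)` of pairs. -/
@[fun_prop]
def Internal (P : M.Num → Prop) : Prop := {c | P c} ∈ M.Sets

/-- The graph of a function on the numbers, as a set of numbers. -/
def graph (f : M.Num → M.Num) : Set M.Num := {z | ∃ c, z = pair c (f c)}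

/-- The function `f` on the numbers has its graph in the model. -/
@[fun_prop]
def InternalFun (f : M.Num → M.Num) : Prop := graph f ∈ M.Sets

/-- The term for the pair of `s` and `t`. -/
def pairTerm (s t : ATerm) : ATerm := .add (.mul (.add s t) (.add s t)) s

/-- An arbitrary set of the model, the value of the set variables that do not occur in a formula. -/
noncomputable def someSet (M : L2Structure.{u}) : Set M.Num := M.sets_nonempty.choose

theorem someSet_mem (M : L2Structure.{u}) : someSet M ∈ M.Sets := M.sets_nonempty.choose_spec

theorem pushVar_mem_sets {A : Set M.Num} {E : ℕ → Set M.Num} (hA : A ∈ M.Sets)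
    (hE : ∀ i, E i ∈ M.Sets) : ∀ i, pushVar A E i ∈ M.Sets
  | 0 => hA
  | _ + 1 => hE _

protected theorem Internal.congr {P Q : M.Num → Prop} (hP : Internal P) (h : ∀ c, Q c ↔ P c) :
    Internal Q := by
  rwa [show Q = P from funext fun c => propext (h c)]

variable [hM : Fact M.RCA0]

theorem Internal.of_delta1 (θ θ' : AFormula) (hθ : θ.IsDelta0) (hθ' : θ'.IsDelta0)
    (e : ℕ → M.Num) (E : ℕ → Set M.Num) (hE : ∀ i, E i ∈ M.Sets) {P : M.Num → Prop}
    (h : ∀ n, (∃ w, M.Sat θ (pushVar w (pushVar n e)) E) ↔ P n)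
    (h' : ∀ n, (∀ w, M.Sat θ' (pushVar w (pushVar n e)) E) ↔ P n) : Internal P := by
  obtain ⟨X, hX, hX'⟩ := hM.out.delta1_comprehension (.ex θ) (.all θ') ⟨θ, hθ, rfl⟩
    ⟨θ', hθ', rfl⟩ e E hE (fun n => (h n).trans (h' n).symm)
  exact Internal.congr (P := (· ∈ X)) hX fun n => ((hX' n).trans (h n)).symm

theorem Internal.of_delta0 (θ : AFormula) (hθ : θ.IsDelta0) (e : ℕ → M.Num) (E : ℕ → Set M.Num)
    (hE : ∀ i, E i ∈ M.Sets) {P : M.Num → Prop}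
    (h : ∀ w n, M.Sat θ (pushVar w (pushVar n e)) E ↔ P n) : Internal P :=
  .of_delta1 θ θ hθ hθ e E hE
    (fun n => ⟨fun ⟨w, hw⟩ => (h w n).1 hw, fun hn => ⟨0, (h 0 n).2 hn⟩⟩)
    (fun n => ⟨fun hn => (h 0 n).1 (hn 0), fun hn w => (h w n).2 hn⟩)

theorem Internal.of_pair_delta0 (θ : AFormula) (hθ : θ.IsDelta0) (e : ℕ → M.Num)
    (E : ℕ → Set M.Num) (hE : ∀ i, E i ∈ M.Sets) {P : M.Num → M.Num → Prop}
    (h : ∀ w n a b, M.Sat θ (pushVar b (pushVar a (pushVar w (pushVar n e)))) E ↔ P a b) :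
    Internal fun z => ∃ a b, z = pair a b ∧ P a b := by
  refine .of_delta0 (.exLt (.add (.var 1) .one) (.exLt (.add (.var 2) .one)
    (.and (.eq (.var 3) (pairTerm (.var 1) (.var 0))) θ))) ⟨trivial, hθ⟩ e E hE
    fun w n => ⟨?_, ?_⟩
  · rintro ⟨a, -, b, -, hn, hab⟩
    exact ⟨a, b, hn, (h w n a b).1 hab⟩
  · rintro ⟨a, b, rfl, hab⟩
    exact ⟨a, lt_pair_add_one_left a b, b, lt_pair_add_one_right a b, rfl, (h _ _ a b).2 hab⟩

theorem InternalFun.of_pair_delta0 (θ : AFormula) (hθ : θ.IsDelta0) (e : ℕ → M.Num)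
    (E : ℕ → Set M.Num) (hE : ∀ i, E i ∈ M.Sets) {f : M.Num → M.Num}
    (h : ∀ w n a b, M.Sat θ (pushVar b (pushVar a (pushVar w (pushVar n e)))) E ↔ f a = b) :
    InternalFun f :=
  (Internal.of_pair_delta0 θ hθ e E hE h).congr fun _ =>
    ⟨fun ⟨c, hc⟩ => ⟨c, f c, hc, rfl⟩, fun ⟨a, _, hz, hb⟩ => ⟨a, hb ▸ hz⟩⟩

theorem pair_mem_graph {f : M.Num → M.Num} {a b : M.Num} :
    pair a b ∈ graph f ↔ f a = b := by
  refine ⟨?_, fun h => ⟨a, h ▸ rfl⟩⟩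
  rintro ⟨c, hc⟩
  obtain ⟨rfl, rfl⟩ := pair_inj hc
  rfl

@[fun_prop]
protected theorem Internal.not {P : M.Num → Prop} (hP : Internal P) : Internal fun c => ¬ P c :=
  .of_delta0 (.neg (.mem (.var 1) 0)) trivial (fun _ => 0) (fun _ => {c | P c}) (fun _ => hP)
    fun _ _ => Iff.rfl

@[fun_prop]
protected theorem Internal.and {P Q : M.Num → Prop} (hP : Internal P) (hQ : Internal Q) :
    Internal fun c => P c ∧ Q c :=
  .of_delta0 (.and (.mem (.var 1) 0) (.mem (.var 1) 1)) ⟨trivial, trivial⟩ (fun _ => 0)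
    (pushVar {c | P c} fun _ => {c | Q c}) (pushVar_mem_sets hP fun _ => hQ) fun _ _ => Iff.rfl

@[fun_prop]
protected theorem Internal.or {P Q : M.Num → Prop} (hP : Internal P) (hQ : Internal Q) :
    Internal fun c => P c ∨ Q c :=
  (hP.not.and hQ.not).not.congr fun c => by tauto

@[fun_prop]
protected theorem Internal.imp {P Q : M.Num → Prop} (hP : Internal P) (hQ : Internal Q) :
    Internal fun c => P c → Q c :=
  (hP.and hQ.not).not.congr fun c => by tauto

@[fun_prop]
protected theorem Internal.iff {P Q : M.Num → Prop} (hP : Internal P) (hQ : Internal Q) :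
    Internal fun c => P c ↔ Q c :=
  ((hP.imp hQ).and (hQ.imp hP)).congr fun c => by tauto

@[fun_prop]
protected theorem InternalFun.id : InternalFun fun c : M.Num => c :=
  .of_pair_delta0 (.eq (.var 1) (.var 0)) trivial (fun _ => 0) _ (fun _ => someSet_mem M)
    fun _ _ _ _ => Iff.rfl

@[fun_prop]
protected theorem InternalFun.const (k : M.Num) : InternalFun fun _ : M.Num => k :=
  .of_pair_delta0 (.eq (.var 4) (.var 0)) trivial (fun _ => k) _ (fun _ => someSet_mem M)
    fun _ _ _ _ => Iff.rfl

@[fun_prop]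
protected theorem Internal.comp {P : M.Num → Prop} {f : M.Num → M.Num} (hP : Internal P)
    (hf : InternalFun f) : Internal fun c => P (f c) := by
  refine .of_delta1 (.and (.mem (pairTerm (.var 1) (.var 0)) 0) (.mem (.var 0) 1))
    (.imp (.mem (pairTerm (.var 1) (.var 0)) 0) (.mem (.var 0) 1)) ⟨trivial, trivial⟩
    ⟨trivial, trivial⟩ (fun _ => 0) (pushVar _ fun _ => _) (pushVar_mem_sets hf fun _ => hP)
    (fun n => ⟨?_, fun h => ⟨f n, pair_mem_graph.2 rfl, h⟩⟩)
    (fun n => ⟨fun h => h (f n) (pair_mem_graph.2 rfl), fun h w hw => ?_⟩)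
  · rintro ⟨w, hw, hPw⟩
    obtain rfl : f n = w := pair_mem_graph.1 hw
    exact hPw
  · obtain rfl : f n = w := pair_mem_graph.1 hw
    exact h

@[fun_prop]
protected theorem InternalFun.comp {f g : M.Num → M.Num} (hf : InternalFun f)
    (hg : InternalFun g) : InternalFun fun c => f (g c) := by
  have hgf : Internal fun z => ∃ a b, z = pair a b ∧ f (g a) = b := by
    let splits : AFormula → AFormula := fun θ => .exLt (.add (.var 1) .one)
      (.exLt (.add (.var 2) .one) (.and (.eq (.var 3) (pairTerm (.var 1) (.var 0))) θ))
    refine .of_delta1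
      (splits (.and (.mem (pairTerm (.var 1) (.var 2)) 1) (.mem (pairTerm (.var 2) (.var 0)) 0)))
      (splits (.imp (.mem (pairTerm (.var 1) (.var 2)) 1) (.mem (pairTerm (.var 2) (.var 0)) 0)))
      ⟨trivial, trivial, trivial⟩ ⟨trivial, trivial, trivial⟩ (fun _ => 0)
      (pushVar _ fun _ => _) (pushVar_mem_sets hf fun _ => hg)
      (fun n => ⟨?_, ?_⟩) (fun n => ⟨fun hw => ?_, ?_⟩)
    · rintro ⟨w, a, -, b, -, hn, hga, hfw⟩
      obtain rfl : g a = w := pair_mem_graph.1 hga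
      exact ⟨a, b, hn, pair_mem_graph.1 hfw⟩
    · rintro ⟨a, b, rfl, rfl⟩
      exact ⟨g a, a, lt_pair_add_one_left _ _, _, lt_pair_add_one_right _ _, rfl,
        pair_mem_graph.2 rfl, pair_mem_graph.2 rfl⟩
    · obtain ⟨a, -, b, -, (hn : n = pair a b), -⟩ := hw 0
      obtain ⟨a', -, b', -, (hn' : n = pair a' b'), hfg⟩ := hw (g a)
      obtain ⟨rfl, rfl⟩ := pair_inj (hn.symm.trans hn')
      exact ⟨a, b, hn, pair_mem_graph.1 (hfg (pair_mem_graph.2 rfl))⟩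
    · rintro ⟨a, b, rfl, rfl⟩ w
      refine ⟨a, lt_pair_add_one_left _ _, _, lt_pair_add_one_right _ _, rfl, fun hw => ?_⟩
      obtain rfl : g a = w := pair_mem_graph.1 hw
      exact pair_mem_graph.2 rfl
  exact hgf.congr fun _ =>
    ⟨fun ⟨c, hc⟩ => ⟨c, _, hc, rfl⟩, fun ⟨a, b, hz, hb⟩ => ⟨a, hz.trans (congrArg _ hb.symm)⟩⟩

@[fun_prop]
protected theorem Internal.mem {X : Set M.Num} (hX : X ∈ M.Sets) {f : M.Num → M.Num}
    (hf : InternalFun f) : Internal fun c => f c ∈ X :=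
  Internal.comp (P := fun c => c ∈ X) hX hf

@[fun_prop]
protected theorem InternalFun.pair {f g : M.Num → M.Num} (hf : InternalFun f)
    (hg : InternalFun g) : InternalFun fun c => pair (f c) (g c) := by
  refine .of_pair_delta0 (.exLt (.add (.var 0) .one) (.exLt (.add (.var 1) .one)
    (.and (.eq (.var 2) (pairTerm (.var 1) (.var 0))) (.and
      (.mem (pairTerm (.var 3) (.var 1)) 0) (.mem (pairTerm (.var 3) (.var 0)) 1)))))
    ⟨trivial, trivial, trivial⟩ (fun _ => 0) (pushVar _ fun _ => _)
    (pushVar_mem_sets hf fun _ => hg) fun _ _ a b => ⟨?_, ?_⟩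
  · rintro ⟨x, -, y, -, (rfl : b = pair x y), hx, hy⟩
    exact pair_eq_pair.2 ⟨pair_mem_graph.1 hx, pair_mem_graph.1 hy⟩
  · rintro rfl
    exact ⟨f a, lt_pair_add_one_left _ _, g a, lt_pair_add_one_right _ _, rfl,
      pair_mem_graph.2 rfl, pair_mem_graph.2 rfl⟩

@[fun_prop]
protected theorem Internal.isPair {f : M.Num → M.Num} (hf : InternalFun f) :
    Internal fun c => IsPair (f c) := by
  have h := Internal.of_pair_delta0 (M := M) (P := fun a _ => a = a) (.eq (.var 1) (.var 1))
    trivial (fun _ => 0) _ (fun _ => someSet_mem M) fun _ _ _ _ => Iff.rfl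
  exact (h.comp hf).congr fun c => exists₂_congr fun a b => (and_iff_left rfl).symm

@[fun_prop]
protected theorem InternalFun.fst {f : M.Num → M.Num} (hf : InternalFun f) :
    InternalFun fun c => fst (f c) :=
  .comp (f := fst) (.of_pair_delta0 (.or
      (.exLt (.add (.var 1) .one) (.eq (.var 2) (pairTerm (.var 1) (.var 0))))
      (.and (.eq (.var 0) .zero) (.neg (.mem (.var 1) 0)))) ⟨trivial, trivial, trivial⟩
    (fun _ => 0) (fun _ => _) (fun _ => Internal.isPair .id) fun _ _ _ _ => fst_eq_iff.symm) hf

@[fun_prop]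
protected theorem InternalFun.snd {f : M.Num → M.Num} (hf : InternalFun f) :
    InternalFun fun c => snd (f c) :=
  .comp (f := snd) (.of_pair_delta0 (.or
      (.exLt (.add (.var 1) .one) (.eq (.var 2) (pairTerm (.var 0) (.var 1))))
      (.and (.eq (.var 0) .zero) (.neg (.mem (.var 1) 0)))) ⟨trivial, trivial, trivial⟩
    (fun _ => 0) (fun _ => _) (fun _ => Internal.isPair .id) fun _ _ _ _ => snd_eq_iff.symm) hf

theorem Internal.comp_of_pair {P : M.Num → M.Num → Prop}
    (hP : Internal fun z => ∃ a b, z = L2Structure.pair a b ∧ P a b) {f g : M.Num → M.Num}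
    (hf : InternalFun f) (hg : InternalFun g) : Internal fun c => P (f c) (g c) :=
  (hP.comp (hf.pair hg)).congr fun c => by simp

theorem Internal.comp₂ {P : M.Num → M.Num → Prop} (hP : Internal fun z => P (fst z) (snd z))
    {f g : M.Num → M.Num} (hf : InternalFun f) (hg : InternalFun g) :
    Internal fun c => P (f c) (g c) :=
  (hP.comp (hf.pair hg)).congr fun c => by simp only [fst_pair, snd_pair]

@[fun_prop]
protected theorem Internal.eq {f g : M.Num → M.Num} (hf : InternalFun f) (hg : InternalFun g) :
    Internal fun c => f c = g c :=
  (Internal.of_pair_delta0 (.eq (.var 1) (.var 0)) trivial (fun _ => 0) _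
    (fun _ => someSet_mem M) fun _ _ _ _ => Iff.rfl).comp_of_pair hf hg

@[fun_prop]
protected theorem Internal.lt {f g : M.Num → M.Num} (hf : InternalFun f) (hg : InternalFun g) :
    Internal fun c => f c < g c :=
  (Internal.of_pair_delta0 (.lt (.var 1) (.var 0)) trivial (fun _ => 0) _
    (fun _ => someSet_mem M) fun _ _ _ _ => Iff.rfl).comp_of_pair hf hg

@[fun_prop]
protected theorem Internal.le {f g : M.Num → M.Num} (hf : InternalFun f) (hg : InternalFun g) :
    Internal fun c => f c ≤ g c :=
  (Internal.lt hg hf).not.congr fun _ => not_lt.symm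

@[fun_prop]
protected theorem Internal.const (p : Prop) : Internal fun _ : M.Num => p := by
  have h : Internal fun _ : M.Num => (0 : M.Num) = 0 := .eq (.const 0) (.const 0)
  by_cases hp : p
  · exact h.congr fun _ => by simp only [hp]
  · exact h.not.congr fun _ => by simp only [hp, not_true]

theorem InternalFun.of_graph {f : M.Num → M.Num} (P : M.Num → M.Num → Prop)
    (hP : Internal fun z => P (fst z) (snd z)) (h : ∀ c y, f c = y ↔ P c y) : InternalFun f := by
  have hpair : Internal fun z : M.Num => IsPair z := .isPair .id
  refine (hpair.and hP).congr fun z => ⟨?_, ?_⟩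
  · rintro ⟨c, rfl⟩
    exact ⟨isPair_pair _ _, by rw [← h, fst_pair, snd_pair]⟩
  · rintro ⟨hz, hPz⟩
    exact ⟨fst z, by rw [(h _ _).2 hPz, pair_fst_snd hz]⟩

theorem InternalFun.of_term (t : ATerm) {op : M.Num → M.Num → M.Num}
    (ht : ∀ x y e, M.termVal (pushVar y (pushVar x e)) t = op x y) {f g : M.Num → M.Num}
    (hf : InternalFun f) (hg : InternalFun g) : InternalFun fun c => op (f c) (g c) := by
  have h : Internal fun z => ∃ a b, z = L2Structure.pair a b ∧
      op (fst a) (snd a) = b ∧ IsPair a := by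
    refine .of_pair_delta0 (.exLt (.add (.var 1) .one) (.exLt (.add (.var 2) .one)
      (.and (.eq (.var 3) (pairTerm (.var 1) (.var 0))) (.eq t (.var 2))))) ⟨trivial, trivial⟩
      (fun _ => 0) _ (fun _ => someSet_mem M) fun w n a b => ⟨?_, ?_⟩
    · rintro ⟨x, -, y, -, (rfl : a = L2Structure.pair x y), hop⟩
      exact ⟨by rw [fst_pair, snd_pair, ← ht]; exact hop, isPair_pair x y⟩
    · rintro ⟨hop, x, y, rfl⟩
      rw [fst_pair, snd_pair] at hop
      exact ⟨x, lt_pair_add_one_left x y, y, lt_pair_add_one_right x y, rfl, (ht x y _).trans hop⟩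
  exact .of_graph (fun c y => op (f c) (g c) = y)
    ((h.comp_of_pair ((hf.comp (.fst .id)).pair (hg.comp (.fst .id))) (.snd .id)).congr fun z => by
      simp only [fst_pair, snd_pair, isPair_pair, and_true]) fun _ _ => Iff.rfl

@[fun_prop]
protected theorem InternalFun.add {f g : M.Num → M.Num} (hf : InternalFun f)
    (hg : InternalFun g) : InternalFun fun c => f c + g c :=
  .of_term (.add (.var 1) (.var 0)) (fun _ _ _ => rfl) hf hg

@[fun_prop]
protected theorem InternalFun.mul {f g : M.Num → M.Num} (hf : InternalFun f)
    (hg : InternalFun g) : InternalFun fun c => f c * g c :=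
  .of_term (.mul (.var 1) (.var 0)) (fun _ _ _ => rfl) hf hg

@[fun_prop]
protected theorem Internal.exists_lt {P : M.Num → M.Num → Prop} {b : M.Num → M.Num}
    (hb : InternalFun b) (hP : Internal fun z => P (fst z) (snd z)) :
    Internal fun c => ∃ y, y < b c ∧ P c y := by
  refine (Internal.of_pair_delta0 (P := fun c d => ∃ y, y < d ∧ P c y)
    (.exLt (.var 0) (.mem (pairTerm (.var 2) (.var 0)) 0)) trivial (fun _ => 0) (fun _ => _)
    (fun _ => hP) fun _ _ c d => ?_).comp_of_pair .id hb
  change (∃ y, y < d ∧ P (fst (pair c y)) (snd (pair c y))) ↔ _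
  simp only [fst_pair, snd_pair]

@[fun_prop]
protected theorem Internal.exists_le {P : M.Num → M.Num → Prop} {b : M.Num → M.Num}
    (hb : InternalFun b) (hP : Internal fun z => P (fst z) (snd z)) :
    Internal fun c => ∃ y, y ≤ b c ∧ P c y :=
  (Internal.exists_lt (hb.add (.const 1)) hP).congr fun _ => by simp only [Order.lt_add_one_iff]

@[fun_prop]
protected theorem Internal.forall_lt {P : M.Num → M.Num → Prop} {b : M.Num → M.Num}
    (hb : InternalFun b) (hP : Internal fun z => P (fst z) (snd z)) :
    Internal fun c => ∀ y, y < b c → P c y :=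
  (Internal.exists_lt (P := fun c y => ¬ P c y) hb hP.not).not.congr fun _ => by push Not; rfl

@[fun_prop]
protected theorem InternalFun.ite {P : M.Num → Prop} [∀ c, Decidable (P c)]
    {f g : M.Num → M.Num} (hP : Internal P) (hf : InternalFun f) (hg : InternalFun g) :
    InternalFun fun c => if P c then f c else g c := by
  refine .of_graph (fun c y => P c ∧ f c = y ∨ ¬ P c ∧ g c = y) (by fun_prop) fun c y => ?_
  by_cases h : P c <;> simp [h]

/-! ### Induction -/

theorem sigma1_induction {P : M.Num → M.Num → Prop} (hP : Internal fun z => P (fst z) (snd z))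
    (zero : ∃ y, P 0 y) (succ : ∀ n, (∃ y, P n y) → ∃ y, P (n + 1) y) (n : M.Num) :
    ∃ y, P n y := by
  have hSat : ∀ n, M.Sat (.ex (.mem (pairTerm (.var 1) (.var 0)) 0)) (pushVar n fun _ => 0)
      (fun _ => {c | P (fst c) (snd c)}) ↔ ∃ y, P n y := by
    intro n
    change (∃ w, P (fst (pair n w)) (snd (pair n w))) ↔ _
    simp only [fst_pair, snd_pair]
  refine (hSat n).1 (hM.out.sigma1_induction _ ⟨_, ?_, rfl⟩ _ _ (fun _ => hP) ((hSat 0).2 zero)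
    (fun n hn => (hSat _).2 (succ n ((hSat n).1 hn))) n)
  trivial

protected theorem Internal.induction {P : M.Num → Prop} (hP : Internal P) (zero : P 0)
    (succ : ∀ n, P n → P (n + 1)) (n : M.Num) : P n := by
  obtain ⟨-, h⟩ := sigma1_induction (P := fun n _ => P n) (hP.comp (.fst .id)) ⟨0, zero⟩
    (fun n ⟨_, h⟩ => ⟨0, succ n h⟩) n
  exact h

protected theorem Internal.strong_induction {P : M.Num → Prop} (hP : Internal P)
    (ind : ∀ n, (∀ m < n, P m) → P n) (n : M.Num) : P n := by
  have forall_lt : ∀ n, ∀ m, m < n → P m := by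
    refine (Internal.forall_lt .id (hP.comp (.snd .id))).induction ?_ fun n ih m hm => ?_
    · exact fun m hm => absurd hm (zero_le (a := m)).not_gt
    · rcases (Order.lt_add_one_iff.1 hm).lt_or_eq with hlt | rfl
      · exact ih m hlt
      · exact ind m ih
  exact ind n (forall_lt n)

protected theorem Internal.exists_least {P : M.Num → Prop} (hP : Internal P) {n : M.Num}
    (hn : P n) : ∃ m, P m ∧ ∀ k < m, ¬ P k := by
  by_contra! hc
  exact hP.not.strong_induction (fun m hm h => by
    obtain ⟨k, hk, hk'⟩ := hc m h
    exact hm k hk hk') n hn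

end L2Structure

namespace L2Structure

variable {M : L2Structure.{u}} [hM : Fact M.RCA0]

/-! ### Codes of finite sets -/

theorem dvd_of_dvd_add_right {a x y : M.Num} (h : a ∣ x + y) (hx : a ∣ x) : a ∣ y := by
  obtain ⟨q, rfl⟩ := hx
  obtain ⟨r, hr⟩ := h
  rcases le_total q r with hqr | hrq
  · obtain ⟨s, rfl⟩ := exists_add_of_le hqr
    rw [mul_add] at hr
    exact ⟨s, add_left_cancel hr⟩
  · have hle : a * q + y ≤ a * q := hr ▸ mul_le_mul_of_nonneg_left hrq zero_le
    obtain rfl : y = 0 := nonpos_iff_eq_zero.1 ((add_le_iff_nonpos_right _).1 hle)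
    exact dvd_zero a

@[fun_prop]
protected theorem Internal.dvd {f g : M.Num → M.Num} (hf : InternalFun f) (hg : InternalFun g) :
    Internal fun c => f c ∣ g c := by
  have h : Internal fun c => ∃ q, q ≤ g c ∧ g c = f c * q := by fun_prop
  refine h.congr fun c => ⟨?_, fun ⟨q, _, hq⟩ => ⟨q, hq⟩⟩
  rintro ⟨q, hq⟩
  rcases eq_or_ne (f c) 0 with h0 | h0
  · exact ⟨0, zero_le, by rw [hq, h0, zero_mul, zero_mul]⟩
  · exact ⟨q, hq ▸ le_mul_of_one_le_left zero_le (Order.one_le_iff_ne_zero.2 h0), hq⟩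

omit hM in
theorem isTriple_pair (k m n : M.Num) : IsTriple (pair k (pair m n)) := ⟨k, m, n, rfl⟩

theorem isTriple_iff {c : M.Num} : IsTriple c ↔ IsPair c ∧ IsPair (snd c) := by
  constructor
  · rintro ⟨k, m, n, rfl⟩
    exact ⟨isPair_pair _ _, by rw [snd_pair]; exact isPair_pair _ _⟩
  · rintro ⟨⟨k, b, rfl⟩, h⟩
    rw [snd_pair] at h
    obtain ⟨m, n, rfl⟩ := h
    exact isTriple_pair k m n

theorem finMem_pair {i k m n : M.Num} :
    FinMem i (pair k (pair m n)) ↔ i < k ∧ m * (i + 1) + 1 ∣ n := by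
  constructor
  · rintro ⟨k', m', n', h, hi, hdvd⟩
    simp only [pair_eq_pair] at h
    obtain ⟨rfl, rfl, rfl⟩ := h
    exact ⟨hi, hdvd⟩
  · rintro ⟨hi, hdvd⟩
    exact ⟨k, m, n, rfl, hi, hdvd⟩

theorem finMem_iff {i c : M.Num} : FinMem i c ↔
    IsTriple c ∧ i < fst c ∧ (fst (snd c) * (i + 1) + 1) ∣ snd (snd c) := by
  constructor
  · rintro ⟨k, m, n, rfl, hi, hdvd⟩
    simp only [fst_pair, snd_pair]
    exact ⟨isTriple_pair k m n, hi, hdvd⟩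
  · rintro ⟨⟨k, m, n, rfl⟩, h⟩
    simp only [fst_pair, snd_pair] at h
    exact finMem_pair.2 h

@[fun_prop]
protected theorem Internal.isTriple {f : M.Num → M.Num} (hf : InternalFun f) :
    Internal fun c => IsTriple (f c) := by
  simp only [isTriple_iff]
  fun_prop

@[fun_prop]
protected theorem Internal.finMem {f g : M.Num → M.Num} (hf : InternalFun f)
    (hg : InternalFun g) : Internal fun c => FinMem (f c) (g c) := by
  simp only [finMem_iff]
  fun_prop

theorem FinMem.lt {i c : M.Num} (h : FinMem i c) : i < c :=
  (finMem_iff.1 h).2.1.trans_le (fst_le c)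

theorem forall_finMem_iff {c c' : M.Num} : (∀ i, FinMem i c' ↔ FinMem i c) ↔
    ∀ i < c' + c, FinMem i c' ↔ FinMem i c := by
  refine ⟨fun h i _ => h i, fun h i => ⟨fun hi => ?_, fun hi => ?_⟩⟩
  · exact (h i (hi.lt.trans_le le_self_add)).1 hi
  · exact (h i (hi.lt.trans_le le_add_self)).2 hi

@[fun_prop]
protected theorem Internal.isFinCode {f : M.Num → M.Num} (hf : InternalFun f) :
    Internal fun c => IsFinCode (f c) := by
  simp only [IsFinCode, forall_finMem_iff]
  fun_prop

theorem exists_common_multiple (b : M.Num) : ∃ m : M.Num, m ≠ 0 ∧ ∀ i < b, i + 1 ∣ m := by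
  refine sigma1_induction (P := fun b m => m ≠ 0 ∧ ∀ i < b, i + 1 ∣ m) (by fun_prop)
    ⟨1, one_ne_zero, fun i hi => absurd hi not_lt_zero⟩ ?_ b
  rintro n ⟨m, hm0, hm⟩
  refine ⟨m * (n + 1), mul_ne_zero hm0 (hM.out.basic.succ_ne_zero n), fun i hi => ?_⟩
  rcases (Order.lt_add_one_iff.1 hi).lt_or_eq with h | rfl
  · exact (hm i h).mul_right _
  · exact dvd_mul_left _ _

theorem beta_dvd_of_dvd_mul {m d i n : M.Num} (hd : d ∣ m) (h : m * (i + 1) + 1 ∣ n * d) :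
    m * (i + 1) + 1 ∣ n := by
  obtain ⟨e, rfl⟩ := hd
  refine dvd_of_dvd_add_right (x := n * d * (e * (i + 1))) ?_ (h.mul_right _)
  exact ⟨n, by ring⟩

/-- The numbers `m * (i + 1) + 1` and `m * (j + 1) + 1` are coprime, as their difference is
`m * (j - i)` and `j - i` divides `m`. -/
theorem beta_dvd_of_dvd_mul_beta {b m i j n : M.Num} (hm : ∀ i < b, i + 1 ∣ m) (hi : i < b)
    (hj : j < b) (hij : i ≠ j) (h : m * (i + 1) + 1 ∣ n * (m * (j + 1) + 1)) :
    m * (i + 1) + 1 ∣ n := by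
  have lt_of_add_succ (k d : M.Num) (h : k + d + 1 < b) : d < b :=
    (le_add_self.trans le_self_add).trans_lt h
  rcases lt_or_gt_of_ne hij with hlt | hlt
  · obtain ⟨d, rfl⟩ := lt_iff_exists_add_succ.1 hlt
    refine beta_dvd_of_dvd_mul (hm d (lt_of_add_succ i d hj)) ?_
    have hsum : n * (m * (i + d + 1 + 1) + 1) * (i + 1) + n * (d + 1) =
      (m * (i + 1) + 1) * (n * (i + d + 1 + 1)) := by ring
    exact dvd_of_dvd_add_right (hsum ▸ dvd_mul_right _ _) (h.mul_right _)
  · obtain ⟨d, rfl⟩ := lt_iff_exists_add_succ.1 hlt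
    refine beta_dvd_of_dvd_mul (hm d (lt_of_add_succ j d hi)) ?_
    have hsum : n * (m * (j + 1) + 1) * (j + d + 1 + 1) =
      (m * (j + d + 1 + 1) + 1) * (n * (j + 1)) + n * (d + 1) := by ring
    exact dvd_of_dvd_add_right (hsum ▸ h.mul_right _) (dvd_mul_right _ _)

theorem beta_not_dvd_one {m : M.Num} (hm : m ≠ 0) (i : M.Num) : ¬ m * (i + 1) + 1 ∣ 1 := by
  rintro ⟨q, hq⟩
  have hq0 : q ≠ 0 := by
    rintro rfl
    exact one_ne_zero (hq.trans (mul_zero _))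
  have hle : m * (i + 1) + 1 ≤ 1 :=
    (le_mul_of_one_le_right zero_le (Order.one_le_iff_ne_zero.2 hq0)).trans hq.ge
  have hpos : 0 < m * (i + 1) := pos_iff_ne_zero.2 (mul_ne_zero hm (hM.out.basic.succ_ne_zero i))
  exact hle.not_gt (lt_add_of_pos_left 1 hpos)

theorem exists_beta_dvd_iff {P : M.Num → Prop} (hP : Internal P) {b m : M.Num} (hm0 : m ≠ 0)
    (hm : ∀ i < b, i + 1 ∣ m) (j : M.Num) :
    ∃ n, ∀ i < b, (m * (i + 1) + 1 ∣ n ↔ i < j ∧ P i) := by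
  refine sigma1_induction (P := fun j n => ∀ i < b, (m * (i + 1) + 1 ∣ n ↔ i < j ∧ P i))
    (by fun_prop) ⟨1, fun i _ => ?_⟩ ?_ j
  · simp only [beta_not_dvd_one hm0 i, not_lt_zero, false_and]
  rintro j ⟨n, hn⟩
  by_cases hj : j < b ∧ P j
  · refine ⟨n * (m * (j + 1) + 1), fun i hi => ?_⟩
    rcases eq_or_ne i j with rfl | hij
    · simp [hj.2]
    · have hdvd : m * (i + 1) + 1 ∣ n * (m * (j + 1) + 1) ↔ m * (i + 1) + 1 ∣ n :=
        ⟨beta_dvd_of_dvd_mul_beta hm hi hj.1 hij, fun h => h.mul_right _⟩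
      rw [hdvd, hn i hi, Order.lt_add_one_iff, le_iff_lt_or_eq, or_iff_left hij]
  · refine ⟨n, fun i hi => ?_⟩
    rw [hn i hi, Order.lt_add_one_iff, le_iff_lt_or_eq]
    refine ⟨fun h => ⟨.inl h.1, h.2⟩, ?_⟩
    rintro ⟨h | rfl, hPi⟩
    · exact ⟨h, hPi⟩
    · exact absurd ⟨hi, hPi⟩ hj

theorem exists_isTriple {P : M.Num → Prop} (hP : Internal P) (b : M.Num) :
    ∃ c, IsTriple c ∧ ∀ i, FinMem i c ↔ i < b ∧ P i := by
  obtain ⟨m, hm0, hm⟩ := exists_common_multiple b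
  obtain ⟨n, hn⟩ := exists_beta_dvd_iff hP hm0 hm b
  refine ⟨pair b (pair m n), isTriple_pair b m n, fun i => finMem_pair.trans ?_⟩
  exact (and_congr_right (hn i)).trans (and_congr_right fun hi => and_iff_right hi)

theorem exists_isFinCode {P : M.Num → Prop} (hP : Internal P) (b : M.Num) :
    ∃ c, IsFinCode c ∧ ∀ i, FinMem i c ↔ i < b ∧ P i := by
  obtain ⟨c₀, hc₀, hmem₀⟩ := exists_isTriple hP b
  have hsame : Internal fun c => IsTriple c ∧ ∀ i, FinMem i c ↔ FinMem i c₀ := by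
    simp only [forall_finMem_iff]
    fun_prop
  obtain ⟨c, ⟨hc, hmem⟩, hmin⟩ :=
    Internal.exists_least hsame (n := c₀) ⟨hc₀, fun _ => Iff.rfl⟩
  refine ⟨c, ⟨hc, fun c' hlt hc' heq => ?_⟩, fun i => (hmem i).trans (hmem₀ i)⟩
  exact hmin c' hlt ⟨hc', fun i => (heq i).trans (hmem i)⟩

theorem IsFinCode.ext {c c' : M.Num} (hc : IsFinCode c) (hc' : IsFinCode c')
    (h : ∀ i, FinMem i c ↔ FinMem i c') : c = c' := by
  rcases lt_trichotomy c c' with hlt | heq | hgt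
  · exact absurd h (hc'.2 c hlt hc.1)
  · exact heq
  · exact absurd (fun i => (h i).symm) (hc.2 c' hgt hc'.1)

/-! ### Codes of finite sequences -/

theorem InternalFun.exists_bound {f : M.Num → M.Num} (hf : InternalFun f) (l : M.Num) :
    ∃ b, ∀ i < l, f i < b := by
  refine sigma1_induction (P := fun l b => ∀ i < l, f i < b) (by fun_prop)
    ⟨0, fun i hi => absurd hi not_lt_zero⟩ ?_ l
  rintro n ⟨b, hb⟩
  refine ⟨b + f n + 1, fun i hi => Order.lt_add_one_iff.2 ?_⟩
  rcases (Order.lt_add_one_iff.1 hi).lt_or_eq with h | rfl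
  · exact (hb i h).le.trans le_self_add
  · exact le_add_self

/-- The codes of finite sequences. -/
def IsSeq (σ : M.Num) : Prop := ∃ l, IsSeqLen σ l

open Classical in
/-- The length of a finite sequence, and `0` at a number that codes none. -/
noncomputable def len (σ : M.Num) : M.Num := if h : IsSeq σ then h.choose else 0

open Classical in
/-- The entry of a finite sequence at the place `i`, and `0` where there is none. -/
noncomputable def entry (σ i : M.Num) : M.Num :=
  if h : IsSeq σ ∧ ∃ x, Entry σ i x then h.2.choose else 0

theorem Entry.lt_left {σ i x : M.Num} (h : Entry σ i x) : i < σ :=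
  (le_pair_left i x).trans_lt (FinMem.lt h)

theorem Entry.lt_right {σ i x : M.Num} (h : Entry σ i x) : x < σ :=
  (le_pair_right i x).trans_lt (FinMem.lt h)

theorem IsSeqLen.entry_lt {σ l i x : M.Num} (h : IsSeqLen σ l) (hx : Entry σ i x) : i < l := by
  obtain ⟨j, y, hj, hpair⟩ := h.2.1 _ hx
  exact (pair_inj hpair).1 ▸ hj

theorem IsSeqLen.unique {σ l l' : M.Num} (h : IsSeqLen σ l) (h' : IsSeqLen σ l') : l = l' := by
  rcases lt_trichotomy l l' with hlt | heq | hgt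
  · obtain ⟨x, hx, _⟩ := h'.2.2 l hlt
    exact absurd (h.entry_lt hx) (lt_irrefl _)
  · exact heq
  · obtain ⟨x, hx, _⟩ := h.2.2 l' hgt
    exact absurd (h'.entry_lt hx) (lt_irrefl _)

theorem IsSeqLen.len_eq {σ l : M.Num} (h : IsSeqLen σ l) : len σ = l := by
  have hσ : IsSeq σ := ⟨l, h⟩
  unfold len
  rw [dif_pos hσ]
  exact hσ.choose_spec.unique h

theorem IsSeq.isSeqLen {σ : M.Num} (h : IsSeq σ) : IsSeqLen σ (len σ) := by
  obtain ⟨l, hl⟩ := h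
  rw [hl.len_eq]; exact hl

theorem isSeqLen_iff {σ l : M.Num} : IsSeqLen σ l ↔ IsSeq σ ∧ len σ = l :=
  ⟨fun h => ⟨⟨l, h⟩, h.len_eq⟩, fun ⟨h, h'⟩ => h' ▸ h.isSeqLen⟩

theorem IsSeqLen.le {σ l : M.Num} (h : IsSeqLen σ l) : l ≤ σ := by
  by_contra! hlt
  obtain ⟨x, hx, _⟩ := h.2.2 σ hlt
  exact absurd hx.lt_left (lt_irrefl _)

theorem IsSeqLen.entry_unique {σ l i x y : M.Num} (h : IsSeqLen σ l) (hx : Entry σ i x)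
    (hy : Entry σ i y) : x = y :=
  (h.2.2 i (h.entry_lt hx)).unique hx hy

theorem IsSeqLen.entry_eq {σ l i x : M.Num} (h : IsSeqLen σ l) (hx : Entry σ i x) :
    entry σ i = x := by
  have hσi : IsSeq σ ∧ ∃ x, Entry σ i x := ⟨⟨l, h⟩, x, hx⟩
  unfold entry
  rw [dif_pos hσi]
  exact h.entry_unique hσi.2.choose_spec hx

theorem IsSeqLen.entry_iff {σ l i x : M.Num} (h : IsSeqLen σ l) :
    Entry σ i x ↔ i < l ∧ entry σ i = x := by
  refine ⟨fun hx => ⟨h.entry_lt hx, h.entry_eq hx⟩, ?_⟩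
  rintro ⟨hi, rfl⟩
  obtain ⟨x, hx, _⟩ := h.2.2 i hi
  rw [h.entry_eq hx]; exact hx

theorem IsSeq.entry_iff {σ i x : M.Num} (h : IsSeq σ) :
    Entry σ i x ↔ i < len σ ∧ entry σ i = x := h.isSeqLen.entry_iff

@[fun_prop]
protected theorem Internal.entry {f g h : M.Num → M.Num} (hf : InternalFun f) (hg : InternalFun g)
    (hh : InternalFun h) :
    Internal fun c => Entry (f c) (g c) (h c) := by
  unfold Entry
  fun_prop

theorem isSeqLen_iff_bounded {σ l : M.Num} : IsSeqLen σ l ↔ IsFinCode σ ∧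
    (∀ z < σ, FinMem z σ → IsPair z ∧ fst z < l) ∧
    ∀ i < l, ∃ x < σ, Entry σ i x ∧ ∀ y < σ, Entry σ i y → y = x := by
  constructor
  · rintro ⟨hcode, hmem, hentry⟩
    refine ⟨hcode, fun z _ hz => ?_, fun i hi => ?_⟩
    · obtain ⟨i, x, hi, rfl⟩ := hmem z hz
      exact ⟨isPair_pair _ _, by rwa [fst_pair]⟩
    · obtain ⟨x, hx, huniq⟩ := hentry i hi
      exact ⟨x, hx.lt_right, hx, fun y _ hy => huniq y hy⟩
  · rintro ⟨hcode, hmem, hentry⟩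
    refine ⟨hcode, fun z hz => ?_, fun i hi => ?_⟩
    · obtain ⟨hpair, hlt⟩ := hmem z hz.lt hz
      exact ⟨fst z, snd z, hlt, (pair_fst_snd hpair).symm⟩
    · obtain ⟨x, _, hx, huniq⟩ := hentry i hi
      exact ⟨x, hx, fun y hy => huniq y hy.lt_right hy⟩

@[fun_prop]
protected theorem Internal.isSeqLen {f g : M.Num → M.Num} (hf : InternalFun f)
    (hg : InternalFun g) :
    Internal fun c => IsSeqLen (f c) (g c) := by
  simp only [isSeqLen_iff_bounded]
  fun_prop

@[fun_prop]
protected theorem Internal.isSeq {f : M.Num → M.Num} (hf : InternalFun f) :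
    Internal fun c => IsSeq (f c) := by
  have : Internal (fun c => ∃ l ≤ f c, IsSeqLen (f c) l) := by fun_prop
  exact this.congr fun c => ⟨fun ⟨l, hl⟩ => ⟨l, hl.le, hl⟩, fun ⟨l, _, hl⟩ => ⟨l, hl⟩⟩

@[fun_prop]
protected theorem InternalFun.len {f : M.Num → M.Num} (hf : InternalFun f) :
    InternalFun fun c => len (f c) := by
  refine .of_graph (fun c l => IsSeqLen (f c) l ∨ ¬ IsSeq (f c) ∧ l = 0) (by fun_prop)
    fun c l => ?_
  by_cases h : IsSeq (f c)
  · simp only [h, not_true, false_and, or_false, isSeqLen_iff, true_and]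
  · have hlen : len (f c) = 0 := dif_neg h
    simp only [h, not_false_eq_true, isSeqLen_iff, false_and, false_or, true_and, hlen]
    exact eq_comm

theorem entry_eq_zero {σ i : M.Num} (h : ¬ (IsSeq σ ∧ i < len σ)) : entry σ i = 0 :=
  dif_neg fun ⟨hσ, _, hx⟩ => h ⟨hσ, hσ.isSeqLen.entry_lt hx⟩

theorem entry_eq_iff {σ i x : M.Num} : entry σ i = x ↔
    IsSeq σ ∧ Entry σ i x ∨ ¬ (IsSeq σ ∧ i < len σ) ∧ x = 0 := by
  by_cases h : IsSeq σ ∧ i < len σ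
  · simp only [h.1, h.1.entry_iff, h.2, true_and, not_true, false_and, or_false]
  · rw [entry_eq_zero h, eq_comm, and_iff_right h]
    exact (or_iff_right fun ⟨hσ, hx⟩ => h ⟨hσ, hσ.isSeqLen.entry_lt hx⟩).symm

@[fun_prop]
protected theorem InternalFun.entry {f g : M.Num → M.Num} (hf : InternalFun f)
    (hg : InternalFun g) : InternalFun fun c => entry (f c) (g c) :=
  .of_graph _ (by fun_prop) fun _ _ => entry_eq_iff

theorem IsSeq.ext {σ ρ : M.Num} (hσ : IsSeq σ) (hρ : IsSeq ρ) (hlen : len σ = len ρ)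
    (h : ∀ i < len σ, entry σ i = entry ρ i) : σ = ρ := by
  have hentry (i x : M.Num) : Entry σ i x ↔ Entry ρ i x := by
    rw [hσ.entry_iff, hρ.entry_iff, ← hlen]
    exact and_congr_right fun hi => by rw [h i hi]
  refine hσ.isSeqLen.1.ext hρ.isSeqLen.1 fun z => ⟨fun hz => ?_, fun hz => ?_⟩
  · obtain ⟨i, x, _, rfl⟩ := hσ.isSeqLen.2.1 z hz
    exact (hentry i x).1 hz
  · obtain ⟨i, x, _, rfl⟩ := hρ.isSeqLen.2.1 z hz
    exact (hentry i x).2 hz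

theorem InternalFun.exists_seq {f : M.Num → M.Num} (hf : InternalFun f) (l : M.Num) :
    ∃ σ, IsSeq σ ∧ len σ = l ∧ ∀ i < l, entry σ i = f i := by
  obtain ⟨b, hb⟩ := InternalFun.exists_bound (.pair .id hf) l
  obtain ⟨σ, hσ, hmem⟩ := exists_isFinCode
    (P := fun z => IsPair z ∧ L2Structure.fst z < l ∧
      f (L2Structure.fst z) = L2Structure.snd z) (by fun_prop) b
  have hentry (i x : M.Num) : Entry σ i x ↔ i < l ∧ f i = x := by
    unfold Entry
    rw [hmem]
    simp only [isPair_pair, fst_pair, snd_pair, true_and]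
    exact and_iff_right_of_imp fun ⟨hi, hx⟩ => hx ▸ hb i hi
  have hlen : IsSeqLen σ l := by
    refine ⟨hσ, fun z hz => ?_, fun i hi => ⟨f i, (hentry _ _).2 ⟨hi, rfl⟩, fun y hy => ?_⟩⟩
    · obtain ⟨_, hpair, hlt, _⟩ := (hmem z).1 hz
      exact ⟨_, _, hlt, (pair_fst_snd hpair).symm⟩
    · exact ((hentry _ _).1 hy).2.symm
  exact ⟨σ, ⟨l, hlen⟩, hlen.len_eq, fun i hi => hlen.entry_eq ((hentry _ _).2 ⟨hi, rfl⟩)⟩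

/-- The code of the empty sequence. -/
noncomputable def nil : M.Num := ((InternalFun.const (M := M) 0).exists_seq 0).choose

theorem isSeq_nil : IsSeq (nil : M.Num) :=
  ((InternalFun.const (M := M) 0).exists_seq 0).choose_spec.1

@[simp] theorem len_nil : len (nil : M.Num) = 0 :=
  ((InternalFun.const (M := M) 0).exists_seq 0).choose_spec.2.1

theorem IsSeq.eq_nil {σ : M.Num} (h : IsSeq σ) (hlen : len σ = 0) : σ = nil :=
  h.ext isSeq_nil (hlen.trans len_nil.symm) fun _ hi => absurd (hlen ▸ hi) not_lt_zero

open Classical in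
theorem exists_snoc (σ m : M.Num) : ∃ ρ, IsSeq ρ ∧ len ρ = len σ + 1 ∧
    ∀ i < len σ + 1, entry ρ i = if i < len σ then entry σ i else m :=
  InternalFun.exists_seq (by fun_prop) _

/-- The finite sequence `σ⌢m`. -/
noncomputable def snoc (σ m : M.Num) : M.Num := (exists_snoc σ m).choose

theorem isSeq_snoc (σ m : M.Num) : IsSeq (snoc σ m) := (exists_snoc σ m).choose_spec.1

@[simp] theorem len_snoc (σ m : M.Num) : len (snoc σ m) = len σ + 1 :=
  (exists_snoc σ m).choose_spec.2.1

theorem entry_snoc_of_lt {σ m i : M.Num} (h : i < len σ) : entry (snoc σ m) i = entry σ i :=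
  ((exists_snoc σ m).choose_spec.2.2 i (h.trans (lt_add_one _))).trans (if_pos h)

@[simp] theorem entry_snoc_last (σ m : M.Num) : entry (snoc σ m) (len σ) = m :=
  ((exists_snoc σ m).choose_spec.2.2 _ (lt_add_one _)).trans (if_neg (lt_irrefl _))

theorem snoc_eq_iff {σ m ρ : M.Num} : snoc σ m = ρ ↔ IsSeq ρ ∧ len ρ = len σ + 1 ∧
    (∀ i < len σ, entry ρ i = entry σ i) ∧ entry ρ (len σ) = m := by
  constructor
  · rintro rfl
    exact ⟨isSeq_snoc _ _, len_snoc _ _, fun i hi => entry_snoc_of_lt hi, entry_snoc_last _ _⟩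
  · rintro ⟨hρ, hlen, hlt, hlast⟩
    refine (isSeq_snoc σ m).ext hρ (by rw [len_snoc, hlen]) fun i hi => ?_
    rw [len_snoc, Order.lt_add_one_iff] at hi
    rcases hi.lt_or_eq with h | rfl
    · rw [entry_snoc_of_lt h, hlt i h]
    · rw [entry_snoc_last, hlast]

@[fun_prop]
protected theorem InternalFun.snoc {f g : M.Num → M.Num} (hf : InternalFun f) (hg : InternalFun g) :
    InternalFun fun c => snoc (f c) (g c) :=
  .of_graph _ (by fun_prop) fun _ _ => snoc_eq_iff

/-! ### Initial segments -/

/-- The relation `InitSeg` in terms of `len` and `entry`, which are total. -/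
def IsPrefix (σ ρ : M.Num) : Prop := len σ ≤ len ρ ∧ ∀ i < len σ, entry σ i = entry ρ i

@[fun_prop]
protected theorem Internal.isPrefix {f g : M.Num → M.Num} (hf : InternalFun f)
    (hg : InternalFun g) :
    Internal fun c => IsPrefix (f c) (g c) := by
  unfold IsPrefix
  fun_prop

theorem IsPrefix.refl (σ : M.Num) : IsPrefix σ σ := ⟨le_rfl, fun _ _ => rfl⟩

theorem IsPrefix.trans {σ ρ π : M.Num} (h : IsPrefix σ ρ) (h' : IsPrefix ρ π) : IsPrefix σ π :=
  ⟨h.1.trans h'.1, fun i hi => (h.2 i hi).trans (h'.2 i (hi.trans_le h.1))⟩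

theorem isPrefix_snoc (σ m : M.Num) : IsPrefix σ (snoc σ m) :=
  ⟨by rw [len_snoc]; exact le_self_add, fun i hi => (entry_snoc_of_lt hi).symm⟩

theorem initSeg_iff {σ ρ : M.Num} : InitSeg σ ρ ↔ IsSeq σ ∧ IsSeq ρ ∧ IsPrefix σ ρ := by
  constructor
  · rintro ⟨l, l', hl, hl', hle, h⟩
    obtain ⟨hσ, rfl⟩ := isSeqLen_iff.1 hl
    obtain ⟨hρ, rfl⟩ := isSeqLen_iff.1 hl'
    refine ⟨hσ, hρ, le_iff_lt_or_eq.2 hle, fun i hi => ?_⟩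
    exact (hρ.entry_iff.1 ((h i hi _).1 (hσ.entry_iff.2 ⟨hi, rfl⟩))).2.symm
  · rintro ⟨hσ, hρ, hle, h⟩
    refine ⟨_, _, hσ.isSeqLen, hρ.isSeqLen, le_iff_lt_or_eq.1 hle, fun i hi x => ?_⟩
    rw [hσ.entry_iff, hρ.entry_iff, h i hi]
    simp only [hi, hi.trans_le hle]

theorem isSnoc_iff {σ m ρ : M.Num} : IsSnoc σ m ρ ↔ IsSeq σ ∧ ρ = snoc σ m := by
  constructor
  · rintro ⟨l, hl, hl', h, hlast⟩
    obtain ⟨hσ, rfl⟩ := isSeqLen_iff.1 hl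
    obtain ⟨hρ, hlen⟩ := isSeqLen_iff.1 hl'
    refine ⟨hσ, (snoc_eq_iff.2 ⟨hρ, hlen, fun i hi => ?_, (hρ.entry_iff.1 hlast).2⟩).symm⟩
    exact (hρ.entry_iff.1 ((h i hi _).1 (hσ.entry_iff.2 ⟨hi, rfl⟩))).2
  · rintro ⟨hσ, rfl⟩
    refine ⟨len σ, hσ.isSeqLen, isSeqLen_iff.2 ⟨isSeq_snoc _ _, len_snoc _ _⟩, fun i hi x => ?_,
      (isSeq_snoc _ _).entry_iff.2 ⟨by rw [len_snoc]; exact lt_add_one _, entry_snoc_last _ _⟩⟩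
    rw [hσ.entry_iff, (isSeq_snoc _ _).entry_iff, entry_snoc_of_lt hi, len_snoc]
    simp only [hi, hi.trans (lt_add_one _)]

theorem isSingleton_iff {σ m : M.Num} : IsSingleton σ m ↔ σ = snoc nil m := by
  unfold IsSingleton
  rw [isSeqLen_iff, eq_comm (a := σ), snoc_eq_iff, len_nil, zero_add]
  constructor
  · rintro ⟨⟨hσ, hlen⟩, hm⟩
    exact ⟨hσ, hlen, fun i hi => absurd hi not_lt_zero, (hσ.entry_iff.1 hm).2⟩
  · rintro ⟨hσ, hlen, -, hm⟩
    exact ⟨⟨hσ, hlen⟩, hσ.entry_iff.2 ⟨hlen ▸ zero_lt_one, hm⟩⟩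

theorem isLast_iff {σ a : M.Num} :
    IsLast σ a ↔ IsSeq σ ∧ ∃ l, len σ = l + 1 ∧ entry σ l = a := by
  constructor
  · rintro ⟨n, hn, ha⟩
    obtain ⟨hσ, hlen⟩ := isSeqLen_iff.1 hn
    exact ⟨hσ, n, hlen, (hσ.entry_iff.1 ha).2⟩
  · rintro ⟨hσ, n, hlen, ha⟩
    exact ⟨n, isSeqLen_iff.2 ⟨hσ, hlen⟩, hσ.entry_iff.2 ⟨hlen ▸ lt_add_one _, ha⟩⟩

theorem isLast_snoc {σ m a : M.Num} : IsLast (snoc σ m) a ↔ a = m := by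
  rw [isLast_iff]
  constructor
  · rintro ⟨_, l, hlen, rfl⟩
    rw [len_snoc] at hlen
    rw [← add_right_cancel hlen, entry_snoc_last]
  · rintro rfl
    exact ⟨isSeq_snoc _ _, len σ, len_snoc _ _, entry_snoc_last _ _⟩

/-! ### Recursion and choice -/

theorem exists_internalFun_choice {Q : M.Num → M.Num → Prop}
    (hQ : Internal fun z => Q (fst z) (snd z)) (h : ∀ a, ∃ b, Q a b) :
    ∃ F : M.Num → M.Num, InternalFun F ∧ ∀ a, Q a (F a) := by
  have hleast (a : M.Num) : ∃ b, Q a b ∧ ∀ k < b, ¬ Q a k :=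
    Internal.exists_least (hQ.comp₂ (.const a) .id) (h a).choose_spec
  choose F hF hmin using hleast
  refine ⟨F, .of_graph (fun a b => Q a b ∧ ∀ k < b, ¬ Q a k) ?_ fun a b => ⟨?_, ?_⟩, hF⟩
  · exact hQ.and (.forall_lt (P := fun z k => ¬ Q (fst z) k) (by fun_prop)
      (hQ.comp₂ (by fun_prop) (by fun_prop)).not)
  · rintro rfl
    exact ⟨hF a, hmin a⟩
  · rintro ⟨hb, hbmin⟩
    exact le_antisymm (not_lt.1 fun hlt => hmin a _ hlt hb) (not_lt.1 fun hlt => hbmin _ hlt (hF a))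

/-- The sequence `σ` consists of `a`, `F a`, `F (F a)`, … up to the `n`-th iterate. -/
def IsIterates (F : M.Num → M.Num) (a n σ : M.Num) : Prop :=
  IsSeq σ ∧ len σ = n + 1 ∧ entry σ 0 = a ∧ ∀ i < n, entry σ (i + 1) = F (entry σ i)

theorem exists_isIterates {F : M.Num → M.Num} (hF : InternalFun F) (a n : M.Num) :
    ∃ σ, IsIterates F a n σ := by
  refine sigma1_induction (by unfold IsIterates; fun_prop) ?_ ?_ n
  · refine ⟨snoc nil a, isSeq_snoc _ _, by simp, ?_, fun i hi => absurd hi not_lt_zero⟩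
    have hlast := entry_snoc_last (nil : M.Num) a
    rwa [len_nil] at hlast
  · rintro n ⟨σ, -, hlen, hzero, hsucc⟩
    refine ⟨snoc σ (F (entry σ n)), isSeq_snoc _ _, by rw [len_snoc, hlen], ?_, fun i hi => ?_⟩
    · rw [entry_snoc_of_lt (hlen ▸ Order.lt_add_one_iff.2 zero_le), hzero]
    · rw [entry_snoc_of_lt (i := i) (by rwa [hlen])]
      rcases (Order.lt_add_one_iff.1 hi).lt_or_eq with h | rfl
      · rw [entry_snoc_of_lt (by rw [hlen]; gcongr), hsucc i h]
      · rw [← hlen, entry_snoc_last]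

theorem IsIterates.entry_eq {F : M.Num → M.Num} {a n n' σ σ' : M.Num} (h : IsIterates F a n σ)
    (h' : IsIterates F a n' σ') : ∀ i, i ≤ n → i ≤ n' → entry σ i = entry σ' i := by
  refine Internal.induction (by fun_prop) (fun _ _ => h.2.2.1.trans h'.2.2.1.symm) ?_
  intro i ih hi hi'
  rw [h.2.2.2 i (Order.add_one_le_iff.1 hi), h'.2.2.2 i (Order.add_one_le_iff.1 hi'),
    ih (le_self_add.trans hi) (le_self_add.trans hi')]

theorem InternalFun.exists_iterate {F : M.Num → M.Num} (hF : InternalFun F) (a : M.Num) :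
    ∃ g : M.Num → M.Num, InternalFun g ∧ g 0 = a ∧ ∀ n, g (n + 1) = F (g n) := by
  obtain ⟨s, hs, hsF⟩ := exists_internalFun_choice (by unfold IsIterates; fun_prop)
    (exists_isIterates hF a)
  refine ⟨fun n => entry (s n) n, by fun_prop, (hsF 0).2.2.1, fun n => ?_⟩
  change entry (s (n + 1)) (n + 1) = F (entry (s n) n)
  rw [(hsF (n + 1)).2.2.2 n (lt_add_one n), (hsF (n + 1)).entry_eq (hsF n) n le_self_add le_rfl]

theorem exists_dependent_choice {P : M.Num → Prop} (hP : Internal P)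
    {T : M.Num → M.Num → M.Num → Prop}
    (hT : Internal fun z => T (fst z) (fst (snd z)) (snd (snd z))) {a : M.Num} (ha : P a)
    (h : ∀ n a, P a → ∃ b, P b ∧ T n a b) :
    ∃ g : M.Num → M.Num, InternalFun g ∧ g 0 = a ∧ ∀ n, P (g n) ∧ T n (g n) (g (n + 1)) := by
  have hstep : Internal fun z =>
      P (snd (fst z)) → P (snd z) ∧ T (fst (fst z)) (snd (fst z)) (snd z) := by
    have hT' := hT.comp (f := fun z => pair (fst (fst z)) (pair (snd (fst z)) (snd z)))
      (by fun_prop)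
    simp only [fst_pair, snd_pair] at hT'
    exact (hP.comp (by fun_prop)).imp ((hP.comp (by fun_prop)).and hT')
  obtain ⟨F, hF, hPF⟩ := exists_internalFun_choice
    (Q := fun s b => P (snd s) → P b ∧ T (fst s) (snd s) b) hstep fun s => by
      by_cases hs : P (snd s)
      · exact (h _ _ hs).imp fun _ hb _ => hb
      · exact ⟨0, fun h => absurd h hs⟩
  obtain ⟨g, hg, hg_zero, hg_succ⟩ :=
    InternalFun.exists_iterate (F := fun s => pair (fst s + 1) (F s)) (by fun_prop) (pair 0 a)
  have hstage : ∀ n, fst (g n) = n :=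
    Internal.induction (by fun_prop) (by simp [hg_zero]) fun n hn => by simp [hg_succ, hn]
  have hPg : ∀ n, P (snd (g n)) :=
    Internal.induction (hP.comp (by fun_prop)) (by simpa [hg_zero]) fun n hn => by
      simpa [hg_succ] using (hPF _ hn).1
  refine ⟨fun n => snd (g n), by fun_prop, by simp [hg_zero], fun n => ⟨hPg n, ?_⟩⟩
  simpa [hg_succ, hstage] using (hPF _ (hPg n)).2

/-! ### Functions of the model as sets -/

theorem isFun_graph {g : M.Num → M.Num} {A : Set M.Num} (h : ∀ n, g n ∈ A) :
    IsFun (graph g) Set.univ A :=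
  ⟨fun _ ⟨c, hc⟩ => ⟨c, trivial, g c, h c, hc⟩,
    fun a _ => ⟨g a, pair_mem_graph.2 rfl, fun _ hb => (pair_mem_graph.1 hb).symm⟩⟩

theorem IsFun.exists_eq_graph {F A : Set M.Num} (h : IsFun F Set.univ A) (hF : F ∈ M.Sets) :
    ∃ g : M.Num → M.Num, InternalFun g ∧ F = graph g ∧ ∀ a, g a ∈ A := by
  choose g hg huniq using fun a => h.2 a trivial
  have hgraph : F = graph g := by
    ext z
    constructor
    · intro hz
      obtain ⟨a, _, b, _, rfl⟩ := h.1 z hz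
      exact pair_mem_graph.2 (huniq a b hz).symm
    · rintro ⟨c, rfl⟩
      exact hg c
  refine ⟨g, show graph g ∈ M.Sets from hgraph ▸ hF, hgraph, fun a => ?_⟩
  obtain ⟨c, _, b, hb, hpair⟩ := h.1 _ (hg a)
  exact (pair_inj hpair).2 ▸ hb

theorem isRestriction_graph {g : M.Num → M.Num} {l σ : M.Num} :
    IsRestriction (graph g) l σ ↔ IsSeq σ ∧ len σ = l ∧ ∀ i < l, entry σ i = g i := by
  unfold IsRestriction
  rw [isSeqLen_iff]
  constructor
  · rintro ⟨⟨hσ, rfl⟩, h⟩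
    exact ⟨hσ, rfl, fun i hi => (hσ.entry_iff.1 ((h i hi _).2 (pair_mem_graph.2 rfl))).2⟩
  · rintro ⟨hσ, rfl, h⟩
    refine ⟨⟨hσ, rfl⟩, fun i hi x => ?_⟩
    rw [hσ.entry_iff, pair_mem_graph, h i hi, and_iff_right hi]

theorem num_eq_cast (n : ℕ) : M.num n = (n : M.Num) := by
  induction n with
  | zero => simp [num]
  | succ n ih => simp [num, ih]

theorem two_mul_add_inj {q q' b b' : M.Num} (hb : b < 2) (hb' : b' < 2)
    (h : 2 * q + b = 2 * q' + b') : q = q' ∧ b = b' := by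
  have lt_of_lt {q q' b b' : M.Num} (hb : b < 2) (hq : q < q') : 2 * q + b < 2 * q' + b' := by
    calc 2 * q + b < 2 * q + 2 := by gcongr
      _ = 2 * (q + 1) := by ring
      _ ≤ 2 * q' := mul_le_mul_of_nonneg_left (Order.add_one_le_iff.2 hq) zero_le
      _ ≤ 2 * q' + b' := le_self_add
  rcases lt_trichotomy q q' with hlt | rfl | hgt
  · exact absurd h (lt_of_lt hb hlt).ne
  · exact ⟨rfl, add_left_cancel h⟩
  · exact absurd h.symm (lt_of_lt hb' hgt).ne

theorem two_mul_ne_two_mul_add_one (a b : M.Num) : 2 * a ≠ 2 * b + 1 := by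
  intro h
  rw [← add_zero (2 * a)] at h
  exact zero_ne_one (two_mul_add_inj two_pos one_lt_two h).2

theorem exists_half (a : M.Num) : ∃ q, a = 2 * q ∨ a = 2 * q + 1 := by
  refine sigma1_induction (P := fun a q => a = 2 * q ∨ a = 2 * q + 1) (by fun_prop)
    ⟨0, by simp⟩ ?_ a
  rintro n ⟨q, rfl | rfl⟩
  · exact ⟨q, Or.inr rfl⟩
  · exact ⟨q + 1, Or.inl (by ring)⟩

@[fun_prop]
protected theorem Internal.isLast {f g : M.Num → M.Num} (hf : InternalFun f) (hg : InternalFun g) :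
    Internal fun c => IsLast (f c) (g c) := by
  have hbounded : Internal fun c =>
      IsSeq (f c) ∧ ∃ l < len (f c), len (f c) = l + 1 ∧ entry (f c) l = g c := by fun_prop
  refine hbounded.congr fun c =>
    isLast_iff.trans (and_congr_right fun _ => exists_congr fun l => ?_)
  exact ⟨fun h => ⟨h.1 ▸ lt_add_one l, h⟩, fun h => h.2⟩

/-! ### Trees of paths through a relation -/

/-- The tree of the finite paths through the relation `A` that start at `a₀`. -/
def pathTree (A : M.Num → M.Num → Prop) (a₀ : M.Num) : Set M.Num :=
  {σ | IsSeq σ ∧ (0 < len σ → entry σ 0 = a₀) ∧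
    ∀ i < len σ, i + 1 < len σ → A (entry σ i) (entry σ (i + 1))}

section PathTree

variable {A : M.Num → M.Num → Prop} {a₀ : M.Num}

theorem pathTree_mem_sets (hA : Internal fun z => A (fst z) (snd z)) : pathTree A a₀ ∈ M.Sets := by
  have hstep : Internal fun σ : M.Num =>
      ∀ i < len σ, i + 1 < len σ → A (entry σ i) (entry σ (i + 1)) :=
    .forall_lt (P := fun σ i => i + 1 < len σ → A (entry σ i) (entry σ (i + 1))) (by fun_prop)
      (.imp (by fun_prop) (hA.comp₂ (by fun_prop) (by fun_prop)))
  have hroot : Internal fun σ : M.Num => IsSeq σ ∧ (0 < len σ → entry σ 0 = a₀) := by fun_prop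
  exact (hroot.and hstep).congr fun σ => and_assoc.symm

theorem singleton_mem_pathTree {m : M.Num} : snoc nil m ∈ pathTree A a₀ ↔ m = a₀ := by
  have h0 : entry (snoc (nil : M.Num) m) 0 = m := by
    have hlast := entry_snoc_last (nil : M.Num) m
    rwa [len_nil] at hlast
  constructor
  · rintro ⟨_, h, _⟩
    rw [← h (by simp), h0]
  · rintro rfl
    refine ⟨isSeq_snoc _ _, fun _ => h0, fun i _ hi' => ?_⟩
    rw [len_snoc, len_nil, zero_add] at hi'
    exact absurd hi' (not_lt.2 le_add_self)

theorem IsPrefix.mem_pathTree {σ ρ : M.Num} (h : IsPrefix ρ σ) (hσ : σ ∈ pathTree A a₀)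
    (hρ : IsSeq ρ) : ρ ∈ pathTree A a₀ := by
  refine ⟨hρ, fun h0 => ?_, fun i hi hi' => ?_⟩
  · rw [h.2 0 h0]
    exact hσ.2.1 (h0.trans_le h.1)
  · rw [h.2 i hi, h.2 _ hi']
    exact hσ.2.2 i (hi.trans_le h.1) (hi'.trans_le h.1)

theorem snoc_snoc_mem_pathTree {σ a b : M.Num} :
    snoc (snoc σ a) b ∈ pathTree A a₀ ↔ snoc σ a ∈ pathTree A a₀ ∧ A a b := by
  have hlt : len σ < len (snoc σ a) := by rw [len_snoc]; exact lt_add_one _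
  have ha : entry (snoc (snoc σ a) b) (len σ) = a := by
    rw [entry_snoc_of_lt hlt, entry_snoc_last]
  have hb : entry (snoc (snoc σ a) b) (len σ + 1) = b := by
    have hlast := entry_snoc_last (snoc σ a) b
    rwa [len_snoc] at hlast
  constructor
  · intro h
    refine ⟨(isPrefix_snoc _ _).mem_pathTree h (isSeq_snoc _ _), ?_⟩
    have hab := h.2.2 (len σ) (by simp [add_assoc]) (by simp)
    rwa [ha, hb] at hab
  · rintro ⟨⟨_, hroot, hstep⟩, hab⟩
    have hpos : 0 < len (snoc σ a) := zero_le.trans_lt hlt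
    refine ⟨isSeq_snoc _ _, fun _ => by rw [entry_snoc_of_lt hpos, hroot hpos], fun i hi hi' => ?_⟩
    have hi₁ : i < len (snoc σ a) := by rwa [len_snoc, add_lt_add_iff_right] at hi'
    rw [entry_snoc_of_lt hi₁]
    by_cases hi₂ : i + 1 < len (snoc σ a)
    · rw [entry_snoc_of_lt hi₂]
      exact hstep i hi₁ hi₂
    · obtain rfl : i = len σ := by
        rw [len_snoc] at hi₁ hi₂
        exact le_antisymm (Order.lt_add_one_iff.1 hi₁) (by simpa using hi₂)
      rw [entry_snoc_last, hb]
      exact hab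

theorem isBorelCode_pathTree (hA : Internal fun z => A (fst z) (snd z))
    (h : ¬ ∃ g : M.Num → M.Num, InternalFun g ∧ g 0 = a₀ ∧ ∀ n, A (g n) (g (n + 1))) :
    M.IsBorelCode (pathTree A a₀) where
  mem_sets := pathTree_mem_sets hA
  tree := ⟨fun σ hσ => hσ.1, fun σ hσ ρ hρ =>
    (initSeg_iff.1 hρ).2.2.mem_pathTree hσ (initSeg_iff.1 hρ).1⟩
  no_path := by
    rintro ⟨G, hG, hG', hp⟩
    obtain ⟨g, hg, rfl, -⟩ := hG'.exists_eq_graph hG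
    refine h ⟨g, hg, ?_, fun n => ?_⟩
    · obtain ⟨σ, hσ, hσ'⟩ := hp 1
      rw [isRestriction_graph] at hσ'
      rw [← hσ'.2.2 0 zero_lt_one]
      exact hσ.2.1 (by rw [hσ'.2.1]; exact zero_lt_one)
    · obtain ⟨σ, hσ, hσ'⟩ := hp (n + 1 + 1)
      rw [isRestriction_graph] at hσ'
      have hn₁ : n + 1 < n + 1 + 1 := lt_add_one _
      have hn : n < n + 1 + 1 := (lt_add_one _).trans hn₁
      rw [← hσ'.2.2 n hn, ← hσ'.2.2 (n + 1) hn₁]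
      exact hσ.2.2 n (hσ'.2.1 ▸ hn) (hσ'.2.1 ▸ hn₁)
  root := by
    refine ⟨a₀, ⟨snoc nil a₀, singleton_mem_pathTree.2 rfl, isSingleton_iff.2 rfl⟩, ?_⟩
    rintro m ⟨σ, hσ, hm⟩
    rw [isSingleton_iff] at hm
    subst hm
    exact singleton_mem_pathTree.1 hσ

theorem isLeaf_pathTree {σ a : M.Num} :
    IsLeaf (pathTree A a₀) (snoc σ a) ↔ snoc σ a ∈ pathTree A a₀ ∧ ∀ b, ¬ A a b := by
  refine and_congr_right fun h => ?_
  simp only [isSnoc_iff]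
  constructor
  · intro hleaf b hb
    exact hleaf ⟨b, _, snoc_snoc_mem_pathTree.2 ⟨h, hb⟩, isSeq_snoc _ _, rfl⟩
  · rintro hA ⟨b, ρ, hρ, _, rfl⟩
    exact hA b (snoc_snoc_mem_pathTree.1 hρ).2

variable {τ x f : Set M.Num} (hf : M.IsEvaluation τ (pathTree A a₀) x f) {σ : M.Num}
include hf

theorem IsEvaluation.pathTree_union {a b₀ : M.Num} (ha : snoc σ (2 * a) ∈ pathTree A a₀)
    (hb₀ : A (2 * a) b₀) : pair (snoc σ (2 * a)) 1 ∈ f ↔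
      ∃ b, A (2 * a) b ∧ pair (snoc (snoc σ (2 * a)) b) 1 ∈ f := by
  rw [hf.union _ (2 * a) ha (fun h => (isLeaf_pathTree.1 h).2 _ hb₀) (isLast_snoc.2 rfl)
    ⟨a, by simp [num_eq_cast]⟩]
  constructor
  · rintro ⟨b, ρ, hρ, hsnoc, hval⟩
    obtain ⟨_, rfl⟩ := isSnoc_iff.1 hsnoc
    exact ⟨b, (snoc_snoc_mem_pathTree.1 hρ).2, hval⟩
  · rintro ⟨b, hb, hval⟩
    exact ⟨b, _, snoc_snoc_mem_pathTree.2 ⟨ha, hb⟩, isSnoc_iff.2 ⟨isSeq_snoc _ _, rfl⟩, hval⟩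

theorem IsEvaluation.pathTree_inter {a b₀ : M.Num} (ha : snoc σ (2 * a + 1) ∈ pathTree A a₀)
    (hb₀ : A (2 * a + 1) b₀) : pair (snoc σ (2 * a + 1)) 1 ∈ f ↔
      ∀ b, A (2 * a + 1) b → pair (snoc (snoc σ (2 * a + 1)) b) 1 ∈ f := by
  rw [hf.inter _ (2 * a + 1) ha (fun h => (isLeaf_pathTree.1 h).2 _ hb₀) (isLast_snoc.2 rfl)
    ⟨a, by simp [num_eq_cast]⟩]
  constructor
  · intro h b hb
    exact h b _ (snoc_snoc_mem_pathTree.2 ⟨ha, hb⟩) (isSnoc_iff.2 ⟨isSeq_snoc _ _, rfl⟩)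
  · rintro h b ρ hρ hsnoc
    obtain ⟨_, rfl⟩ := isSnoc_iff.1 hsnoc
    exact h b (snoc_snoc_mem_pathTree.1 hρ).2

theorem IsEvaluation.pathTree_leaf_zero (ha : snoc σ 0 ∈ pathTree A a₀) (hleaf : ∀ b, ¬ A 0 b) :
    pair (snoc σ 0) 1 ∉ f := by
  rw [hf.leaf _ 0 (isLeaf_pathTree.2 ⟨ha, hleaf⟩) (isLast_snoc.2 rfl)]
  rintro (h | ⟨m, t, -, ⟨h, -⟩ | ⟨h, -⟩⟩)
  · exact zero_ne_one h
  all_goals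
    replace h := h.symm
    simp [num_eq_cast] at h

theorem IsEvaluation.pathTree_leaf_one (ha : snoc σ 1 ∈ pathTree A a₀) (hleaf : ∀ b, ¬ A 1 b) :
    pair (snoc σ 1) 1 ∈ f :=
  (hf.leaf _ 1 (isLeaf_pathTree.2 ⟨ha, hleaf⟩) (isLast_snoc.2 rfl)).2 (.inl rfl)

end PathTree

/-! ### Well founded games -/

/-- The node labels `2 * (q + 2)` (`b = 0`) and `2 * (q + 2) + 1` (`b = 1`) stand for the position
`q` of a game; as Borel codes alternate on parity, the first is a union and the second an
intersection. The labels below `4` are left for the root and for the leaves. -/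
noncomputable def label (q b : M.Num) : M.Num := 2 * (q + 2) + b

theorem le_label (q b : M.Num) : q ≤ label q b :=
  calc q ≤ q + (q + 4 + b) := le_self_add
    _ = 2 * (q + 2) + b := by ring

theorem two_lt_label (q b : M.Num) : 2 < label q b :=
  calc (2 : M.Num) < 4 := by norm_num
    _ ≤ 4 + (2 * q + b) := le_self_add
    _ = 2 * (q + 2) + b := by ring

theorem label_inj {q q' b b' : M.Num} (hb : b < 2) (hb' : b' < 2) (h : label q b = label q' b') :
    q = q' ∧ b = b' :=
  (two_mul_add_inj hb hb' h).imp_left add_right_cancel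

/-- The tree relation of a game with the moves `R`. The root has the label `2`, and every position
is reached from it; the parity of the labels alternates along a play. Each node of a position has
one more child, a leaf labelled by the neutral element of the operation at the node, so that the
node itself is no leaf. -/
def gameRel (R : M.Num → M.Num → Prop) (a a' : M.Num) : Prop :=
  (a = 2 ∧ 4 ≤ a') ∨ ∃ q b b', b + b' = 1 ∧ a = label q b ∧
    (a' = b ∨ ∃ q', a' = label q' b' ∧ R q q')

/-- The position `q` is won according to the value that `f` gives to the node `σ⌢label q b`. A
position is won if some move leads to a position that is not won; on this reading unions are won if
they have the value `1`, and intersections if they have the value `0`. -/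
def IsWonAt (f : Set M.Num) (σ q b : M.Num) : Prop := b = 0 ↔ pair (snoc σ (label q b)) 1 ∈ f

section Game

variable {R : M.Num → M.Num → Prop}

theorem lt_two_of_add_eq_one {b b' : M.Num} (h : b + b' = 1) : b < 2 ∧ b' < 2 :=
  ⟨(le_self_add.trans h.le).trans_lt one_lt_two, (le_add_self.trans h.le).trans_lt one_lt_two⟩

theorem eq_zero_or_one_of_add_eq_one {b b' : M.Num} (h : b + b' = 1) :
    b = 0 ∧ b' = 1 ∨ b = 1 ∧ b' = 0 := by
  rcases eq_zero_or_exists_add_one b with rfl | ⟨c, rfl⟩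
  · exact .inl ⟨rfl, by simpa using h⟩
  · rw [add_right_comm] at h
    have hc : c + b' = 0 := by simpa using h
    obtain ⟨rfl, rfl⟩ := add_eq_zero.1 hc
    exact .inr ⟨zero_add 1, rfl⟩

protected theorem Internal.gameRel (hR : Internal fun z => R (fst z) (snd z)) :
    Internal fun z => gameRel R (fst z) (snd z) := by
  have hbounded : Internal fun z : M.Num => (fst z = 2 ∧ 4 ≤ snd z) ∨
      ∃ q ≤ fst z, ∃ b ≤ 1, ∃ b' ≤ 1, b + b' = 1 ∧ fst z = label q b ∧
        (snd z = b ∨ ∃ q' ≤ snd z, snd z = label q' b' ∧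
          pair q q' ∈ {z | R (fst z) (snd z)}) := by
    have hR_mem : {z | R (fst z) (snd z)} ∈ M.Sets := hR
    unfold label
    fun_prop (disch := assumption)
  refine hbounded.congr fun z => or_congr_right ⟨?_, ?_⟩
  · rintro ⟨q, b, b', hb, hz, hz'⟩
    refine ⟨q, hz ▸ le_label q b, b, hb ▸ le_self_add, b', hb ▸ le_add_self, hb, hz,
      hz'.imp_right ?_⟩
    rintro ⟨q', hz', hq'⟩
    exact ⟨q', hz' ▸ le_label q' b', hz', by simpa using hq'⟩
  · rintro ⟨q, -, b, -, b', -, hb, hz, hz'⟩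
    refine ⟨q, b, b', hb, hz, hz'.imp_right ?_⟩
    rintro ⟨q', -, hz', hq'⟩
    exact ⟨q', hz', by simpa using hq'⟩

theorem gameRel_root (q : M.Num) : gameRel R 2 (label q 0) :=
  .inl ⟨rfl, calc
    (4 : M.Num) ≤ 4 + 2 * q := le_self_add
    _ = 2 * (q + 2) + 0 := by ring⟩

theorem not_gameRel_of_lt_two {a a' : M.Num} (ha : a < 2) : ¬ gameRel R a a' := by
  rintro (⟨rfl, _⟩ | ⟨q, b, b', _, rfl, _⟩)
  · exact lt_irrefl _ ha
  · exact lt_asymm ha (two_lt_label q b)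

theorem gameRel_label {q b b' a' : M.Num} (hb : b + b' = 1) :
    gameRel R (label q b) a' ↔ a' = b ∨ ∃ q', a' = label q' b' ∧ R q q' := by
  constructor
  · rintro (⟨h, _⟩ | ⟨q₁, b₁, b₁', hb₁, h, h'⟩)
    · exact absurd h (two_lt_label q b).ne'
    · obtain ⟨rfl, rfl⟩ := label_inj (lt_two_of_add_eq_one hb).1 (lt_two_of_add_eq_one hb₁).1 h
      rwa [add_left_cancel (hb.trans hb₁.symm)]
  · exact fun h => .inr ⟨q, b, b', hb, rfl, h⟩

theorem ne_two_of_gameRel {a a' : M.Num} (h : gameRel R a a') : a' ≠ 2 := by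
  rintro rfl
  rcases h with ⟨_, h⟩ | ⟨q, b, b', hb, _, h | ⟨q', h, _⟩⟩
  · exact absurd h (not_le.2 (by norm_num))
  · exact (lt_two_of_add_eq_one hb).1.ne' h
  · exact (two_lt_label q' b').ne h

theorem no_path_gameRel (h : ¬ ∃ g : M.Num → M.Num, InternalFun g ∧ ∀ n, R (g n) (g (n + 1))) :
    ¬ ∃ g : M.Num → M.Num, InternalFun g ∧ g 0 = 2 ∧ ∀ n, gameRel R (g n) (g (n + 1)) := by
  rintro ⟨g, hg, -, hgR⟩
  have hlabel (n : M.Num) : ∃ q, ∃ b < 2, g (n + 1) = label q b := by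
    rcases hgR (n + 1) with ⟨h2, _⟩ | ⟨q, b, b', hb, hq, _⟩
    · exact absurd h2 (ne_two_of_gameRel (hgR n))
    · exact ⟨q, b, (lt_two_of_add_eq_one hb).1, hq⟩
  obtain ⟨p, hp, hpg⟩ := exists_internalFun_choice (by unfold label; fun_prop) hlabel
  refine h ⟨p, hp, fun n => ?_⟩
  obtain ⟨b, hb, hn⟩ := hpg n
  obtain ⟨b₁, hb₁, hn₁⟩ := hpg (n + 1)
  rcases hgR (n + 1) with ⟨h2, _⟩ | ⟨q, c, c', hc, hq, hlast | ⟨q', hq', hR⟩⟩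
  · exact absurd h2 (ne_two_of_gameRel (hgR n))
  · rw [hn₁] at hlast
    exact absurd (hlast ▸ (lt_two_of_add_eq_one hc).1) (two_lt_label _ _).le.not_gt
  · rw [(label_inj hb (lt_two_of_add_eq_one hc).1 (hn.symm.trans hq)).1,
      (label_inj hb₁ (lt_two_of_add_eq_one hc).2 (hn₁.symm.trans hq')).1]
    exact hR

theorem label_mem_pathTree {σ q b b' q' : M.Num} (hb : b + b' = 1)
    (hσ : snoc σ (label q b) ∈ pathTree (gameRel R) 2) (hq' : R q q') :
    snoc (snoc σ (label q b)) (label q' b') ∈ pathTree (gameRel R) 2 :=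
  snoc_snoc_mem_pathTree.2 ⟨hσ, (gameRel_label hb).2 (.inr ⟨q', rfl, hq'⟩)⟩

theorem IsEvaluation.isWonAt_iff {τ x f : Set M.Num}
    (hf : M.IsEvaluation τ (pathTree (gameRel R) 2) x f) {σ q b b' : M.Num} (hb : b + b' = 1)
    (hσ : snoc σ (label q b) ∈ pathTree (gameRel R) 2) :
    IsWonAt f σ q b ↔ ∃ q', R q q' ∧ ¬ IsWonAt f (snoc σ (label q b)) q' b' := by
  have hleaf : gameRel R (label q b) b := (gameRel_label hb).2 (.inl rfl)
  have hmem := snoc_snoc_mem_pathTree.2 ⟨hσ, hleaf⟩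
  rcases eq_zero_or_one_of_add_eq_one hb with ⟨rfl, rfl⟩ | ⟨rfl, rfl⟩
  · have hvalue : pair (snoc σ (label q 0)) 1 ∈ f ↔
        ∃ a, gameRel R (label q 0) a ∧ pair (snoc (snoc σ (label q 0)) a) 1 ∈ f := by
      have hlabel : label q 0 = 2 * (q + 2) := add_zero _
      rw [hlabel] at hσ hleaf ⊢
      exact hf.pathTree_union hσ hleaf
    have hzero := hf.pathTree_leaf_zero hmem fun b => not_gameRel_of_lt_two two_pos
    simp only [IsWonAt, hvalue, gameRel_label hb, true_iff, one_ne_zero, false_iff, not_not]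
    constructor
    · rintro ⟨b, rfl | ⟨q', rfl, hq'⟩, hval⟩
      · exact absurd hval hzero
      · exact ⟨q', hq', hval⟩
    · exact fun ⟨q', hq', hval⟩ => ⟨_, .inr ⟨q', rfl, hq'⟩, hval⟩
  · have hvalue : pair (snoc σ (label q 1)) 1 ∈ f ↔
        ∀ a, gameRel R (label q 1) a → pair (snoc (snoc σ (label q 1)) a) 1 ∈ f :=
      hf.pathTree_inter hσ hleaf
    have hone := hf.pathTree_leaf_one hmem fun b => not_gameRel_of_lt_two one_lt_two
    simp only [IsWonAt, hvalue, gameRel_label hb, true_iff, one_ne_zero, false_iff]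
    push Not
    constructor
    · rintro ⟨b, rfl | ⟨q', rfl, hq'⟩, hval⟩
      · exact absurd hone hval
      · exact ⟨q', hq', hval⟩
    · exact fun ⟨q', hq', hval⟩ => ⟨_, .inr ⟨q', rfl, hq'⟩, hval⟩

/-- Verdicts on the positions of a well founded game that are consistent along the moves do not
depend on the place `p` at which a position is judged: a disagreement would propagate along an
infinite play. -/
theorem won_congr_place {Node Won : M.Num → M.Num → Prop}
    (hR : Internal fun z => R (fst z) (snd z))
    (hwf : ¬ ∃ g : M.Num → M.Num, InternalFun g ∧ ∀ n, R (g n) (g (n + 1)))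
    (hNode : Internal fun z => Node (fst z) (snd z)) (hWon : Internal fun z => Won (fst z) (snd z))
    (consistent : ∀ q p, Node q p → ∃ p', (∀ q', R q q' → Node q' p') ∧
      (Won q p ↔ ∃ q', R q q' ∧ ¬ Won q' p'))
    {q p₁ p₂ : M.Num} (h₁ : Node q p₁) (h₂ : Node q p₂) : Won q p₁ ↔ Won q p₂ := by
  suffices h : ∀ {p₁ p₂}, Node q p₁ → Node q p₂ → Won q p₁ → Won q p₂ from ⟨h h₁ h₂, h h₂ h₁⟩
  intro p₁ p₂ h₁ h₂ hw₁
  by_contra hw₂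
  let Disagree (z : M.Num) : Prop := (Node (fst z) (fst (snd z)) ∧ Node (fst z) (snd (snd z))) ∧
    Won (fst z) (fst (snd z)) ∧ ¬ Won (fst z) (snd (snd z))
  have hDisagree : Internal Disagree :=
    ((hNode.comp₂ (by fun_prop) (by fun_prop)).and (hNode.comp₂ (by fun_prop) (by fun_prop))).and
      ((hWon.comp₂ (by fun_prop) (by fun_prop)).and (hWon.comp₂ (by fun_prop) (by fun_prop)).not)
  have next (z : M.Num) (hz : Disagree z) : ∃ z', Disagree z' ∧ R (fst z) (fst z') := by
    obtain ⟨⟨hz₁, hz₂⟩, hwon, hlost⟩ := hz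
    obtain ⟨p₁', hp₁', hiff₁⟩ := consistent _ _ hz₁
    obtain ⟨p₂', hp₂', hiff₂⟩ := consistent _ _ hz₂
    obtain ⟨q', hq', hlost₁⟩ := hiff₁.1 hwon
    have hwon₂ : Won q' p₂' := by_contra fun h => hlost (hiff₂.2 ⟨q', hq', h⟩)
    exact ⟨pair q' (pair p₂' p₁'),
      by simpa [Disagree] using ⟨⟨hp₂' q' hq', hp₁' q' hq'⟩, hwon₂, hlost₁⟩, by simpa using hq'⟩
  obtain ⟨g, hg, _, hg_path⟩ := exists_dependent_choice hDisagree
    (T := fun _ z z' => R (fst z) (fst z')) (a := pair q (pair p₁ p₂))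
    (hR.comp₂ (by fun_prop) (by fun_prop)) (by simpa [Disagree] using ⟨⟨h₁, h₂⟩, hw₁, hw₂⟩)
    fun _ => next
  exact hwf ⟨fun n => fst (g n), by fun_prop, fun n => (hg_path n).2⟩

theorem IsEvaluation.exists_game_value {τ x f : Set M.Num}
    (hf : M.IsEvaluation τ (pathTree (gameRel R) 2) x f)
    (hR : Internal fun z => R (fst z) (snd z))
    (hwf : ¬ ∃ g : M.Num → M.Num, InternalFun g ∧ ∀ n, R (g n) (g (n + 1))) :
    ∃ V : M.Num → Prop, Internal V ∧ ∀ q, V q ↔ ∃ q', R q q' ∧ ¬ V q' := by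
  have hfs := hf.mem_sets
  have hT : pathTree (gameRel R) 2 ∈ M.Sets := pathTree_mem_sets (.gameRel hR)
  let Node (q p : M.Num) : Prop :=
    (∃ b' ≤ 1, snd p + b' = 1) ∧ snoc (fst p) (label q (snd p)) ∈ pathTree (gameRel R) 2
  let Won (q p : M.Num) : Prop := IsWonAt f (fst p) q (snd p)
  have hNode : Internal fun z => Node (fst z) (snd z) := by
    simp only [Node, label]
    fun_prop (disch := assumption)
  have hWon : Internal fun z => Won (fst z) (snd z) := by
    simp only [Won, IsWonAt, label]
    fun_prop (disch := assumption)
  have consistent (q p : M.Num) (hp : Node q p) : ∃ p', (∀ q', R q q' → Node q' p') ∧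
      (Won q p ↔ ∃ q', R q q' ∧ ¬ Won q' p') := by
    obtain ⟨⟨b', _, hb⟩, hp⟩ := hp
    refine ⟨pair (snoc (fst p) (label q (snd p))) b', fun q' hq' => ?_, ?_⟩
    · refine ⟨⟨snd p, hb ▸ le_self_add, by rw [snd_pair, add_comm, hb]⟩, ?_⟩
      simpa using label_mem_pathTree hb hp hq'
    · simpa [Won] using hf.isWonAt_iff hb hp
  have hroot (q : M.Num) : Node q (pair (snoc nil 2) 0) := by
    refine ⟨⟨1, le_rfl, by simp⟩, ?_⟩
    simpa using snoc_snoc_mem_pathTree.2 ⟨singleton_mem_pathTree.2 rfl, gameRel_root (R := R) q⟩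
  refine ⟨fun q => Won q (pair (snoc nil 2) 0), hWon.comp₂ (by fun_prop) (by fun_prop), fun q => ?_⟩
  obtain ⟨p', hp', hiff⟩ := consistent q _ (hroot q)
  refine hiff.trans (exists_congr fun q' => and_congr_right fun hq' => not_congr ?_)
  exact won_congr_place hR hwf hNode hWon consistent (hp' q' hq') (hroot q')

theorem exists_game_value {k : ℕ} {τ : Set M.Num} (h : M.BorelCodesHaveEvaluatedPoint k τ)
    (hR : Internal fun z => R (fst z) (snd z))
    (hwf : ¬ ∃ g : M.Num → M.Num, InternalFun g ∧ ∀ n, R (g n) (g (n + 1))) :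
    ∃ V : M.Num → Prop, Internal V ∧ ∀ q, V q ↔ ∃ q', R q q' ∧ ¬ V q' := by
  obtain ⟨x, _, ⟨f, hf, _⟩ | ⟨f, hf, _⟩⟩ :=
    h _ (isBorelCode_pathTree (.gameRel hR) (no_path_gameRel hwf))
  exacts [hf.exists_game_value hR hwf, hf.exists_game_value hR hwf]

end Game

/-! ### Arithmetical formulas as games with queries -/

@[fun_prop]
protected theorem InternalFun.termVal (t : ATerm) {v : ℕ → M.Num → M.Num}
    (hv : ∀ i, InternalFun (v i)) : InternalFun fun c => M.termVal (fun i => v i c) t := by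
  induction t with
  | var i => exact hv i
  | zero => exact .const 0
  | one => exact .const 1
  | add s t hs ht => exact .add hs ht
  | mul s t hs ht => exact .mul hs ht

omit hM in
@[fun_prop]
protected theorem InternalFun.pushVar {w : M.Num → M.Num} (hw : InternalFun w)
    {v : ℕ → M.Num → M.Num} (hv : ∀ i, InternalFun (v i)) :
    ∀ i, InternalFun fun c => pushVar (w c) (fun i => v i c) i
  | 0 => hw
  | i + 1 => hv i

@[fun_prop]
protected theorem Internal.exists_eq_pair {P : M.Num → M.Num → Prop} {f : M.Num → M.Num}
    {a : M.Num → M.Num} (hf : InternalFun f) (ha : InternalFun a)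
    (hP : Internal fun z => P (fst z) (snd z)) :
    Internal fun c => ∃ y, f c = pair (a c) y ∧ P c y := by
  have hsnd : Internal fun c => f c = pair (a c) (snd (f c)) ∧ P c (snd (f c)) :=
    .and (by fun_prop) (hP.comp₂ .id (by fun_prop))
  refine hsnd.congr fun c => ⟨?_, fun h => ⟨_, h⟩⟩
  rintro ⟨y, hy, hP⟩
  simpa [hy] using hP

/-- A well founded game of `M` whose positions may ask questions about a set `Y`: the player to move
at `q` wins if some pair `⟨q, z⟩` is a query with `z ∉ Y`.  Well-foundedness is meant in the
metatheory. -/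
structure QueryGame (M : L2Structure.{u}) where
  moves : Set M.Num
  queries : Set M.Num
  moves_mem : moves ∈ M.Sets
  queries_mem : queries ∈ M.Sets
  wf : WellFounded fun q' q => pair q q' ∈ moves

/-- `V` is the predicate of being won by the player to move, when the set that is asked about is
`Y`. -/
def QueryGame.IsValue (G : QueryGame M) (Y : Set M.Num) (V : M.Num → Prop) : Prop :=
  ∀ q, V q ↔ (∃ q', pair q q' ∈ G.moves ∧ ¬ V q') ∨ ∃ z, pair q z ∈ G.queries ∧ z ∉ Y

/-- The property `Φ n Y` of numbers `n` and sets `Y`, internal or not, is decided by a query game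
started at the position `⟨0, n⟩`. -/
def HasQueryGame (Φ : M.Num → Set M.Num → Prop) : Prop :=
  ∃ G : QueryGame M, ∀ Y V, G.IsValue Y V → ∀ n, V (pair 0 n) ↔ Φ n Y

omit hM in
theorem QueryGame.IsValue.comp {G G' : QueryGame M} {i : M.Num → M.Num}
    (hmoves : ∀ q p, pair (i q) p ∈ G'.moves ↔ ∃ q', p = i q' ∧ pair q q' ∈ G.moves)
    (hqueries : ∀ q z, pair (i q) z ∈ G'.queries ↔ pair q z ∈ G.queries) {Y : Set M.Num}
    {V : M.Num → Prop} (h : G'.IsValue Y V) : G.IsValue Y fun q => V (i q) := by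
  intro q
  refine (h (i q)).trans ?_
  simp only [hmoves, hqueries]
  refine or_congr_left ⟨?_, fun ⟨q', hq, hV⟩ => ⟨i q', ⟨q', rfl, hq⟩, hV⟩⟩
  rintro ⟨_, ⟨q', rfl, hq⟩, hV⟩
  exact ⟨q', hq, hV⟩

omit hM in
theorem acc_pair_of_wellFounded {R S : Set M.Num} (a : M.Num)
    (hwf : WellFounded fun q' q => pair q q' ∈ R)
    (hS : ∀ q p, pair (pair a q) p ∈ S → ∃ q', p = pair a q' ∧ pair q q' ∈ R) (q : M.Num) :
    Acc (fun p' p => pair p p' ∈ S) (pair a q) :=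
  (hwf.apply q).of_fibration _ fun q p h =>
    have ⟨q', hp, hq⟩ := hS q p h
    ⟨q', hq, hp.symm⟩

namespace HasQueryGame

variable {Φ Ψ : M.Num → Set M.Num → Prop}

omit hM in
protected theorem congr (h : HasQueryGame Φ) (hiff : ∀ n Y, Ψ n Y ↔ Φ n Y) : HasQueryGame Ψ := by
  obtain ⟨G, hG⟩ := h
  exact ⟨G, fun Y V hV n => (hG Y V hV n).trans (hiff n Y).symm⟩

theorem exists_query {Q : M.Num → M.Num → Prop} (hQ : Internal fun z => Q (fst z) (snd z)) :
    HasQueryGame fun n Y => ∃ z, Q n z ∧ z ∉ Y := by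
  let G : QueryGame M :=
    { moves := ∅
      queries := {w | Q (snd (fst w)) (snd w)}
      moves_mem := Internal.const False
      queries_mem := hQ.comp₂ (by fun_prop) (by fun_prop)
      wf := ⟨fun q => ⟨q, fun _ h => h.elim⟩⟩ }
  refine ⟨G, fun Y V hV n => ?_⟩
  rw [hV]
  simp [G]

/-- The game starts with the move from `⟨0, n⟩` to `⟨1, ⟨0, m⟩⟩` and continues with the game for `Φ`
on the positions `⟨1, q⟩`. -/
theorem exists_and_not {P : M.Num → M.Num → Prop} (hP : Internal fun z => P (fst z) (snd z))
    (h : HasQueryGame Φ) : HasQueryGame fun n Y => ∃ m, P n m ∧ ¬ Φ m Y := by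
  obtain ⟨⟨R, Q, hR, hQ, hwf⟩, hG⟩ := h
  let A : Set M.Num := {z | P (fst z) (snd z)}
  have hA : A ∈ M.Sets := hP
  let R' : Set M.Num := {w |
    (∃ n, fst w = pair 0 n ∧ ∃ y, snd w = pair 1 y ∧ ∃ m, y = pair 0 m ∧ pair n m ∈ A) ∨
      ∃ q, fst w = pair 1 q ∧ ∃ q', snd w = pair 1 q' ∧ pair q q' ∈ R}
  let G' : QueryGame M :=
    { moves := R'
      queries := {w | ∃ q, fst w = pair 1 q ∧ pair q (snd w) ∈ Q}
      moves_mem := by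
        change Internal _
        fun_prop (disch := assumption)
      queries_mem := by
        change Internal _
        fun_prop (disch := assumption)
      wf := by
        refine ⟨fun p => ⟨p, fun p' h => ?_⟩⟩
        obtain ⟨q', rfl⟩ : ∃ q', p' = pair 1 q' := by
          rcases h with ⟨_, _, q', h, _⟩ | ⟨_, _, q', h, _⟩ <;> exact ⟨q', by simpa using h⟩
        exact acc_pair_of_wellFounded 1 hwf (by simp [R']) q' }
  refine ⟨G', fun Y V hV n => ?_⟩
  have hone := hG Y _ (hV.comp (i := pair 1) (by simp [G', R']) (by simp [G']))
  simp [hV (pair 0 n), ← hone, G', R', A]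

/-- The position `⟨0, n⟩` has the moves and queries of both games, which continue on the positions
`⟨1, q⟩` and `⟨2, q⟩`. -/
protected theorem or (h : HasQueryGame Φ) (h' : HasQueryGame Ψ) :
    HasQueryGame fun n Y => Φ n Y ∨ Ψ n Y := by
  obtain ⟨⟨R, Q, hR, hQ, hwf⟩, hG⟩ := h
  obtain ⟨⟨R', Q', hR', hQ', hwf'⟩, hG'⟩ := h'
  let S : Set M.Num := {w |
    (∃ q', snd w = pair 1 q' ∧
      (fst (fst w) = 0 ∧ pair (fst w) q' ∈ R ∨ ∃ q, fst w = pair 1 q ∧ pair q q' ∈ R)) ∨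
    ∃ q', snd w = pair 2 q' ∧
      (fst (fst w) = 0 ∧ pair (fst w) q' ∈ R' ∨ ∃ q, fst w = pair 2 q ∧ pair q q' ∈ R')}
  let G : QueryGame M :=
    { moves := S
      queries := {w | fst (fst w) = 0 ∧ (w ∈ Q ∨ w ∈ Q') ∨
        (∃ q, fst w = pair 1 q ∧ pair q (snd w) ∈ Q) ∨ ∃ q, fst w = pair 2 q ∧ pair q (snd w) ∈ Q'}
      moves_mem := by
        change Internal _
        fun_prop (disch := assumption)
      queries_mem := by
        change Internal _
        fun_prop (disch := assumption)
      wf := by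
        refine ⟨fun p => ⟨p, fun p' h => ?_⟩⟩
        rcases h with ⟨q', h, _⟩ | ⟨q', h, _⟩ <;> rw [snd_pair] at h <;> subst h
        · exact acc_pair_of_wellFounded 1 hwf (by simp [S]) q'
        · exact acc_pair_of_wellFounded 2 hwf' (by simp [S]) q' }
  refine ⟨G, fun Y V hV n => ?_⟩
  have hone := hV.comp (G := ⟨R, Q, hR, hQ, hwf⟩) (i := pair 1) (by simp [G, S]) (by simp [G])
  have htwo := hV.comp (G := ⟨R', Q', hR', hQ', hwf'⟩) (i := pair 2) (by simp [G, S]) (by simp [G])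
  have hΦ := (hG Y _ hone n).symm.trans (hone (pair 0 n))
  have hΨ := (hG' Y _ htwo n).symm.trans (htwo (pair 0 n))
  simp only [hΦ, hΨ, hV (pair 0 n)]
  simpa [G, S, or_and_right, exists_or] using or_or_or_comm

protected theorem not (h : HasQueryGame Φ) : HasQueryGame fun n Y => ¬ Φ n Y :=
  (exists_and_not (P := fun n m => m = n) (by fun_prop) h).congr fun n Y => by simp

theorem exists_and {P : M.Num → M.Num → Prop} (hP : Internal fun z => P (fst z) (snd z))
    (h : HasQueryGame Φ) : HasQueryGame fun n Y => ∃ m, P n m ∧ Φ m Y :=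
  (exists_and_not hP h.not).congr fun n Y => by simp

protected theorem and (h : HasQueryGame Φ) (h' : HasQueryGame Ψ) :
    HasQueryGame fun n Y => Φ n Y ∧ Ψ n Y :=
  (h.not.or h'.not).not.congr fun n Y => by tauto

protected theorem imp (h : HasQueryGame Φ) (h' : HasQueryGame Ψ) :
    HasQueryGame fun n Y => Φ n Y → Ψ n Y :=
  (h.not.or h').congr fun n Y => by tauto

theorem of_internal {P : M.Num → Prop} (hP : Internal P) :
    HasQueryGame fun n (_ : Set M.Num) => P n := by
  have hfalse : HasQueryGame fun (_ : M.Num) _ => False :=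
    (exists_query (Q := fun _ _ => False) (.const False)).congr fun _ _ => by simp
  exact (exists_and_not (P := fun n _ => P n) (hP.comp (.fst .id)) hfalse).congr
    fun _ _ => by simp

theorem mem {f : M.Num → M.Num} (hf : InternalFun f) : HasQueryGame fun n Y => f n ∈ Y :=
  (exists_query (Q := fun n z => z = f n) (by fun_prop)).not.congr fun n Y => by simp

/-- The variable `x` is introduced by a move from `n` to `⟨n, x⟩`. -/
theorem exists_pair {P : M.Num → M.Num → Prop} (hP : Internal fun z => P (fst z) (snd z))
    {Θ : M.Num → M.Num → Set M.Num → Prop} (h : HasQueryGame fun z => Θ (fst z) (snd z)) :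
    HasQueryGame fun n Y => ∃ x, P n x ∧ Θ n x Y := by
  have hmove : Internal fun z : M.Num =>
      IsPair (snd z) ∧ fst (snd z) = fst z ∧ P (fst z) (snd (snd z)) :=
    .and (by fun_prop) (.and (by fun_prop) (hP.comp₂ (by fun_prop) (by fun_prop)))
  refine (exists_and (P := fun n m => IsPair m ∧ fst m = n ∧ P n (snd m)) hmove h).congr
    fun n Y => ⟨?_, ?_⟩
  · rintro ⟨x, hP, hΘ⟩
    exact ⟨pair n x, ⟨isPair_pair _ _, by simp, by simpa⟩, by simpa⟩
  · rintro ⟨m, ⟨-, rfl, hP⟩, hΘ⟩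
    exact ⟨snd m, hP, hΘ⟩

theorem forall_pair {P : M.Num → M.Num → Prop} (hP : Internal fun z => P (fst z) (snd z))
    {Θ : M.Num → M.Num → Set M.Num → Prop} (h : HasQueryGame fun z => Θ (fst z) (snd z)) :
    HasQueryGame fun n Y => ∀ x, P n x → Θ n x Y :=
  (exists_pair hP (Θ := fun n x Y => ¬ Θ n x Y) h.not).not.congr fun n Y => by
    push Not
    rfl

/-- The values `F i Y` of the set variables may depend on the set `Y` that is asked about. -/
theorem sat {F : ℕ → Set M.Num → Set M.Num}
    (hF : ∀ i (f : M.Num → M.Num), InternalFun f → HasQueryGame fun n Y => f n ∈ F i Y)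
    (φ : AFormula) : ∀ {v : ℕ → M.Num → M.Num}, (∀ i, InternalFun (v i)) →
      HasQueryGame fun n Y => M.Sat φ (fun i => v i n) fun i => F i Y := by
  have hpush {v : ℕ → M.Num → M.Num} (hv : ∀ i, InternalFun (v i)) (i : ℕ) :
      InternalFun fun z => pushVar (snd z) (fun i => v i (fst z)) i :=
    .pushVar (by fun_prop) (fun i => (hv i).comp (.fst .id)) i
  induction φ with
  | eq s t => exact fun hv => .of_internal (.eq (.termVal s hv) (.termVal t hv))
  | lt s t => exact fun hv => .of_internal (.lt (.termVal s hv) (.termVal t hv))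
  | mem t X => exact fun hv => hF X _ (.termVal t hv)
  | neg φ ih => exact fun hv => (ih hv).not
  | and φ ψ ih ih' => exact fun hv => (ih hv).and (ih' hv)
  | or φ ψ ih ih' => exact fun hv => (ih hv).or (ih' hv)
  | imp φ ψ ih ih' => exact fun hv => (ih hv).imp (ih' hv)
  | allLt t φ ih =>
    intro v hv
    exact forall_pair (P := fun n x => x < M.termVal (fun i => v i n) t) (by fun_prop)
      (Θ := fun n x Y => M.Sat φ (pushVar x fun i => v i n) fun i => F i Y) (ih (hpush hv))
  | exLt t φ ih =>
    intro v hv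
    exact exists_pair (P := fun n x => x < M.termVal (fun i => v i n) t) (by fun_prop)
      (Θ := fun n x Y => M.Sat φ (pushVar x fun i => v i n) fun i => F i Y) (ih (hpush hv))
  | all φ ih =>
    intro v hv
    exact (forall_pair (P := fun _ _ => True) (.const True)
      (Θ := fun n x Y => M.Sat φ (pushVar x fun i => v i n) fun i => F i Y)
      (ih (hpush hv))).congr fun n Y => by simp [Sat]
  | ex φ ih =>
    intro v hv
    exact (exists_pair (P := fun _ _ => True) (.const True)
      (Θ := fun n x Y => M.Sat φ (pushVar x fun i => v i n) fun i => F i Y)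
      (ih (hpush hv))).congr fun n Y => by simp [Sat]

end HasQueryGame

/-! ### Hierarchies from well founded games -/

@[fun_prop]
protected theorem Internal.relLT {X : Set M.Num} (hX : X ∈ M.Sets) {f g : M.Num → M.Num}
    (hf : InternalFun f) (hg : InternalFun g) : Internal fun c => relLT X (f c) (g c) := by
  unfold relLT relLE
  fun_prop (disch := assumption)

/-- The moves of the game that computes the hierarchy of `G` along `X`.  The position
`⟨1, ⟨j, q⟩⟩` is the position `q` of `G` at the level `j`, where the queries are about `Y^j`.  The
query of an element `⟨n, i⟩` with `i <_X j` is answered by the computation of that element, at the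
start `⟨0, n⟩` of `G` on the level `i`; all other queries win, by a move to a dead end `⟨0, z⟩`. -/
def HierarchyMove (G : QueryGame M) (X : Set M.Num) (p p' : M.Num) : Prop :=
  ∃ u, p = pair 1 u ∧
    ((∃ u', p' = pair 1 u' ∧ ∃ q', u' = pair (fst u) q' ∧ pair (snd u) q' ∈ G.moves) ∨
    (∃ u', p' = pair 1 u' ∧ IsPair u' ∧ relLT X (fst u') (fst u) ∧
      ∃ n, snd u' = pair 0 n ∧ pair (snd u) (pair n (fst u')) ∈ G.queries) ∨
    ∃ z, p' = pair 0 z ∧ pair (snd u) z ∈ G.queries ∧ ¬ (IsPair z ∧ relLT X (snd z) (fst u)))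

theorem internal_hierarchyMove (G : QueryGame M) {X : Set M.Num} (hX : X ∈ M.Sets) :
    Internal fun z => HierarchyMove G X (fst z) (snd z) := by
  have hmoves := G.moves_mem
  have hqueries := G.queries_mem
  unfold HierarchyMove
  fun_prop (disch := assumption)

theorem hierarchyMove_iff {G : QueryGame M} {X : Set M.Num} {j q p : M.Num} :
    HierarchyMove G X (pair 1 (pair j q)) p ↔
      (∃ q', p = pair 1 (pair j q') ∧ pair q q' ∈ G.moves) ∨
      (∃ n i, p = pair 1 (pair i (pair 0 n)) ∧ relLT X i j ∧ pair q (pair n i) ∈ G.queries) ∨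
      ∃ z, p = pair 0 z ∧ pair q z ∈ G.queries ∧ ¬ ∃ n i, z = pair n i ∧ relLT X i j := by
  have hquery (z : M.Num) : IsPair z ∧ relLT X (snd z) j ↔ ∃ n i, z = pair n i ∧ relLT X i j := by
    constructor
    · rintro ⟨⟨n, i, rfl⟩, h⟩
      exact ⟨n, i, rfl, by simpa using h⟩
    · rintro ⟨n, i, rfl, h⟩
      exact ⟨isPair_pair n i, by simpa using h⟩
  have hanswer : (∃ u', p = pair 1 u' ∧ IsPair u' ∧ relLT X (fst u') j ∧
      ∃ n, snd u' = pair 0 n ∧ pair q (pair n (fst u')) ∈ G.queries) ↔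
      ∃ n i, p = pair 1 (pair i (pair 0 n)) ∧ relLT X i j ∧ pair q (pair n i) ∈ G.queries := by
    constructor
    · rintro ⟨_, rfl, ⟨i, v, rfl⟩, hlt, n, hn, hq⟩
      rw [fst_pair] at hlt hq
      exact ⟨n, i, by rw [← hn, snd_pair], hlt, hq⟩
    · rintro ⟨n, i, rfl, hlt, hq⟩
      exact ⟨_, rfl, isPair_pair _ _, by simpa using hlt, n, by simpa using hq⟩
  simp [HierarchyMove, ← hquery, ← hanswer]

/-- The level never increases, and decreases after finitely many moves, as `G` is well founded. -/
theorem exists_relLT_of_hierarchyMove {G : QueryGame M} {X : Set M.Num} {g : M.Num → M.Num}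
    (hg : ∀ n, HierarchyMove G X (g n) (g (n + 1))) (n : M.Num) :
    ∃ m, relLT X (fst (snd (g m))) (fst (snd (g n))) := by
  have key : ∀ q n, snd (snd (g n)) = q → ∃ m, relLT X (fst (snd (g m))) (fst (snd (g n))) := by
    intro q
    induction q using G.wf.induction with
    | _ q ih =>
    rintro n rfl
    obtain ⟨u, hu, ⟨u', hu', q', rfl, hq'⟩ | ⟨u', hu', -, hlt, -⟩ | ⟨z, hz, -⟩⟩ := hg n
    · have := ih q' (by simpa [hu] using hq') (n + 1) (by simp [hu'])
      simpa [hu, hu'] using this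
    · exact ⟨n + 1, by simpa [hu, hu'] using hlt⟩
    · obtain ⟨u', hu', -⟩ := hg (n + 1)
      simp [hz] at hu'
  exact key _ n rfl

theorem not_exists_hierarchyMove_path (G : QueryGame M) {X : Set M.Num} (hX : X ∈ M.Sets)
    (hwo : IsWO X) :
    ¬ ∃ g : M.Num → M.Num, InternalFun g ∧ ∀ n, HierarchyMove G X (g n) (g (n + 1)) := by
  rintro ⟨g, hg, hmove⟩
  obtain ⟨F, hF, hdesc⟩ := exists_internalFun_choice
    (Q := fun n m => relLT X (fst (snd (g m))) (fst (snd (g n))))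
    (by fun_prop (disch := assumption)) (exists_relLT_of_hierarchyMove hmove)
  obtain ⟨s, hs, -, hsucc⟩ := hF.exists_iterate 0
  refine hwo.2 ⟨graph fun n => fst (snd (g (s n))), ?_, isFun_graph fun n => ?_, fun n a b => ?_⟩
  · change InternalFun _
    fun_prop
  · exact (hwo.1.refl _ _ (hdesc (s n)).1).2
  · rw [pair_mem_graph, pair_mem_graph, hsucc]
    rintro rfl rfl
    exact hdesc (s n)

theorem QueryGame.isValue_of_hierarchyMove {G : QueryGame M} {X Y : Set M.Num} {V : M.Num → Prop}
    (hvalue : ∀ q, V q ↔ ∃ q', HierarchyMove G X q q' ∧ ¬ V q') {j : M.Num}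
    (hY : ∀ z, z ∈ Y ↔ ∃ n i, z = pair n i ∧ relLT X i j ∧ V (pair 1 (pair i (pair 0 n)))) :
    G.IsValue Y fun q => V (pair 1 (pair j q)) := by
  have hdead (z : M.Num) : ¬ V (pair 0 z) := by simp [hvalue (pair 0 z), HierarchyMove]
  intro q
  refine (hvalue _).trans ?_
  simp only [hierarchyMove_iff, hY, or_and_right, exists_or]
  refine or_congr (by simp) ⟨?_, ?_⟩
  · rintro (⟨_, ⟨n, i, rfl, -, hquery⟩, hV⟩ | ⟨_, ⟨z, rfl, hquery, hz⟩, -⟩)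
    · refine ⟨_, hquery, ?_⟩
      rintro ⟨n', i', heq, -, hV'⟩
      obtain ⟨rfl, rfl⟩ := pair_inj heq
      exact hV hV'
    · exact ⟨z, hquery, fun ⟨n, i, heq, hlt, _⟩ => hz ⟨n, i, heq, hlt⟩⟩
  · rintro ⟨z, hquery, hz⟩
    by_cases hbelow : ∃ n i, z = pair n i ∧ relLT X i j
    · obtain ⟨n, i, rfl, hlt⟩ := hbelow
      exact .inl ⟨_, ⟨n, i, rfl, hlt, hquery⟩, fun hV => hz ⟨n, i, rfl, hlt, hV⟩⟩
    · exact .inr ⟨_, ⟨z, rfl, hquery, hbelow⟩, hdead z⟩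

theorem HasQueryGame.exists_hierarchy {k : ℕ} {τ : Set M.Num}
    (h : M.BorelCodesHaveEvaluatedPoint k τ) {Φ : M.Num → Set M.Num → Prop} (hΦ : HasQueryGame Φ)
    {X : Set M.Num} (hX : X ∈ M.Sets) (hwo : IsWO X) :
    ∃ Y ∈ M.Sets, ∀ z, z ∈ Y ↔ ∃ n j, z = pair n j ∧ j ∈ field X ∧ Φ n (below X Y j) := by
  obtain ⟨G, hG⟩ := hΦ
  obtain ⟨V, hV, hvalue⟩ := exists_game_value h (internal_hierarchyMove G hX)
    (not_exists_hierarchyMove_path G hX hwo)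
  let Y : Set M.Num := {z | IsPair z ∧ pair (snd z) (snd z) ∈ X ∧
    V (pair 1 (pair (snd z) (pair 0 (fst z))))}
  have hY : Y ∈ M.Sets := by
    change Internal _
    fun_prop (disch := assumption)
  have hpair (n j : M.Num) : pair n j ∈ Y ↔ j ∈ field X ∧ V (pair 1 (pair j (pair 0 n))) := by
    simp [Y, field, relLE, isPair_pair]
  have hbelow (z j : M.Num) : z ∈ below X Y j ↔
      ∃ n i, z = pair n i ∧ relLT X i j ∧ V (pair 1 (pair i (pair 0 n))) := by
    simp only [below, hpair, Set.mem_ofPred_eq]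
    refine exists₂_congr fun n i => and_congr_right fun _ => and_congr_right fun hlt => ?_
    exact and_iff_right (hwo.1.refl _ _ hlt.1).1
  have hGvalue (j : M.Num) : G.IsValue (below X Y j) fun q => V (pair 1 (pair j q)) :=
    QueryGame.isValue_of_hierarchyMove hvalue fun z => hbelow z j
  refine ⟨Y, hY, fun z => ⟨fun hz => ?_, ?_⟩⟩
  · obtain ⟨n, j, rfl⟩ := hz.1
    rw [hpair, hG _ _ (hGvalue j)] at hz
    exact ⟨n, j, rfl, hz⟩
  · rintro ⟨n, j, rfl, hj, hΦ⟩
    exact (hpair n j).2 ⟨hj, (hG _ _ (hGvalue j) n).2 hΦ⟩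

theorem arithmeticalTransfiniteRecursion_of_evaluated {k : ℕ} {τ : Set M.Num}
    (h : M.BorelCodesHaveEvaluatedPoint k τ) : M.ArithmeticalTransfiniteRecursion := by
  intro θ e E hE X hX hwo
  have hsat := HasQueryGame.sat (M := M) (F := fun i Y => pushVar Y E i) (fun i f hf => by
    cases i with
    | zero => exact .mem hf
    | succ i => exact .of_internal (.mem (hE i) hf)) θ
    (v := fun i n => pushVar n e i) (.pushVar .id fun i => .const (e i))
  obtain ⟨Y, hY, hiff⟩ := hsat.exists_hierarchy h hX hwo
  exact ⟨Y, hY, hwo.1, hiff⟩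

/-- Arithmetical comprehension is transfinite recursion along an order with one element. -/
theorem arithmeticalComprehension_of_evaluated {k : ℕ} {τ : Set M.Num}
    (h : M.BorelCodesHaveEvaluatedPoint k τ) : M.ArithmeticalComprehension := by
  intro φ e E hE
  have hrel : ∀ i j : M.Num, pair i j ∈ ({pair 0 0} : Set M.Num) ↔ i = 0 ∧ j = 0 := by simp
  have hX : {pair 0 0} ∈ M.Sets := by
    change Internal fun c => c = _
    fun_prop
  have hwo : IsWO ({pair 0 0} : Set M.Num) := by
    refine ⟨⟨?_, ?_, ?_, ?_⟩, ?_⟩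
    all_goals simp only [relLE, field, relLT, hrel, Set.mem_ofPred_eq]
    iterate 4 grind
    rintro ⟨f, -, hfun, hdesc⟩
    obtain ⟨a, ha, -⟩ := hfun.2 0 trivial
    obtain ⟨b, hb, -⟩ := hfun.2 (0 + 1) trivial
    have := hdesc 0 a b ha hb
    tauto
  have hsat := HasQueryGame.sat (M := M) (F := fun i _ => E i)
    (fun i f hf => .of_internal (.mem (hE i) hf)) φ
    (v := fun i n => pushVar n e i) (.pushVar .id fun i => .const (e i))
  obtain ⟨Y, hY, hiff⟩ := hsat.exists_hierarchy h hX hwo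
  have hYzero : Internal fun n => pair n 0 ∈ Y := by fun_prop (disch := assumption)
  exact ⟨_, hYzero, fun n => by simp [hiff, field, relLE]⟩

theorem atr0_of_evaluated {k : ℕ} {τ : Set M.Num} (h : M.BorelCodesHaveEvaluatedPoint k τ) :
    M.ATR0 :=
  ⟨⟨hM.out, arithmeticalComprehension_of_evaluated h⟩,
    arithmeticalTransfiniteRecursion_of_evaluated h⟩

/-! ### The space of partitions -/

theorem mem_finPartition {k : ℕ} {σ : M.Num} : σ ∈ M.FinPartition k ↔ IsSeq σ ∧
    (∀ n < len σ, entry σ n < (k : M.Num)) ∧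
    (∀ n < len σ, ∀ j < entry σ n, ∃ m < n, entry σ m = j) ∧
    ∀ i < (k : M.Num), ∃ n < len σ, entry σ n = i := by
  rw [← num_eq_cast]
  constructor
  · rintro ⟨l, hl, hlt, hord, hsurj⟩
    obtain ⟨hσ, rfl⟩ := isSeqLen_iff.1 hl
    refine ⟨hσ, fun n hn => hlt n _ hn (hσ.entry_iff.2 ⟨hn, rfl⟩), fun n hn j hj => ?_,
      fun i hi => ?_⟩
    · obtain ⟨m, hm, hentry⟩ := hord n _ hn (hσ.entry_iff.2 ⟨hn, rfl⟩) j hj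
      exact ⟨m, hm, (hσ.entry_iff.1 hentry).2⟩
    · obtain ⟨n, hn, hentry⟩ := hsurj i hi
      exact ⟨n, hn, (hσ.entry_iff.1 hentry).2⟩
  · rintro ⟨hσ, hlt, hord, hsurj⟩
    refine ⟨len σ, hσ.isSeqLen, fun n i hn hi => ?_, fun n i hn hi j hj => ?_, fun i hi => ?_⟩
    · exact (hσ.entry_iff.1 hi).2 ▸ hlt n hn
    · obtain ⟨m, hm, hentry⟩ := hord n hn j ((hσ.entry_iff.1 hi).2 ▸ hj)
      exact ⟨m, hm, hσ.entry_iff.2 ⟨hm.trans hn, hentry⟩⟩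
    · obtain ⟨n, hn, hentry⟩ := hsurj i hi
      exact ⟨n, hn, hσ.entry_iff.2 ⟨hn, hentry⟩⟩

theorem finPartition_mem_sets (k : ℕ) : M.FinPartition k ∈ M.Sets :=
  Internal.congr (by fun_prop) fun _ => mem_finPartition

@[fun_prop]
protected theorem Internal.mem_finPartition (k : ℕ) {f : M.Num → M.Num} (hf : InternalFun f) :
    Internal fun c => f c ∈ M.FinPartition k :=
  .mem (finPartition_mem_sets k) hf

theorem isSeq_of_mem_finPartition {k : ℕ} {σ : M.Num} (h : σ ∈ M.FinPartition k) : IsSeq σ :=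
  (mem_finPartition.1 h).1

theorem finPartition_nonempty (k : ℕ) : (M.FinPartition k).Nonempty := by
  obtain ⟨σ, hσ, hlen, hentry⟩ := InternalFun.exists_seq (M := M) .id k
  refine ⟨σ, mem_finPartition.2 ⟨hσ, ?_, ?_, ?_⟩⟩
  · intro n hn
    rw [hlen] at hn
    rwa [hentry n hn]
  · intro n hn j hj
    rw [hlen] at hn
    rw [hentry n hn] at hj
    exact ⟨j, hj, hentry j (hj.trans hn)⟩
  · exact fun i hi => ⟨i, by rwa [hlen], hentry i hi⟩

theorem snoc_zero_mem_finPartition {k : ℕ} (hk : 0 < k) {σ : M.Num} (h : σ ∈ M.FinPartition k) :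
    snoc σ 0 ∈ M.FinPartition k := by
  obtain ⟨-, hlt, hord, hsurj⟩ := mem_finPartition.1 h
  refine mem_finPartition.2 ⟨isSeq_snoc _ _, fun n hn => ?_, fun n hn j hj => ?_, fun i hi => ?_⟩
  · rw [len_snoc, Order.lt_add_one_iff] at hn
    rcases hn.lt_or_eq with hn | rfl
    · rw [entry_snoc_of_lt hn]
      exact hlt n hn
    · rw [entry_snoc_last]
      exact_mod_cast hk
  · rw [len_snoc, Order.lt_add_one_iff] at hn
    rcases hn.lt_or_eq with hn | rfl
    · rw [entry_snoc_of_lt hn] at hj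
      obtain ⟨m, hm, hentry⟩ := hord n hn j hj
      exact ⟨m, hm, by rwa [entry_snoc_of_lt (hm.trans hn)]⟩
    · rw [entry_snoc_last] at hj
      exact absurd hj not_lt_zero
  · obtain ⟨n, hn, hentry⟩ := hsurj i hi
    exact ⟨n, by rw [len_snoc]; exact hn.trans (lt_add_one _), by rwa [entry_snoc_of_lt hn]⟩

theorem exists_isEnumeration (k : ℕ) : ∃ τ, M.IsEnumeration k τ := by
  classical
  obtain ⟨σ₀, hσ₀⟩ := finPartition_nonempty (M := M) k
  have hf : InternalFun fun m => if m ∈ M.FinPartition k then m else σ₀ := by fun_prop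
  refine ⟨graph _, hf, isFun_graph fun n => ?_, fun σ hσ => ⟨σ, pair_mem_graph.2 (if_pos hσ)⟩⟩
  split_ifs with hn
  exacts [hn, hσ₀]

theorem mem_partition {k : ℕ} {p : Set M.Num} : p ∈ M.Partition k ↔
    ∃ g : M.Num → M.Num, InternalFun g ∧ p = graph g ∧ (∀ n, g n < (k : M.Num)) ∧
      (∀ n, ∀ j < g n, ∃ m < n, g m = j) ∧ ∀ i < (k : M.Num), ∃ n, g n = i := by
  rw [← num_eq_cast]
  constructor
  · rintro ⟨hp, hfun, hord, hsurj⟩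
    obtain ⟨g, hg, rfl, hlt⟩ := hfun.exists_eq_graph hp
    simp only [pair_mem_graph] at hord hsurj
    exact ⟨g, hg, rfl, hlt, fun n j hj => hord n _ rfl j hj, hsurj⟩
  · rintro ⟨g, hg, rfl, hlt, hord, hsurj⟩
    refine ⟨hg, isFun_graph hlt, ?_, by simpa only [pair_mem_graph] using hsurj⟩
    simp only [pair_mem_graph]
    rintro n _ rfl j hj
    exact hord n j hj

theorem precFun_graph {g : M.Num → M.Num} {σ : M.Num} :
    PrecFun σ (graph g) ↔ IsSeq σ ∧ ∀ i < len σ, entry σ i = g i := by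
  simp only [PrecFun, isRestriction_graph]
  exact ⟨fun ⟨_, hσ, hlen, h⟩ => ⟨hσ, hlen ▸ h⟩, fun ⟨hσ, h⟩ => ⟨_, hσ, rfl, h⟩⟩

theorem PrecFun.isPrefix_or_isPrefix {g : M.Num → M.Num} {σ ρ : M.Num} (hσ : PrecFun σ (graph g))
    (hρ : PrecFun ρ (graph g)) : IsPrefix σ ρ ∨ IsPrefix ρ σ := by
  rw [precFun_graph] at hσ hρ
  rcases le_total (len σ) (len ρ) with hl | hl
  · exact .inl ⟨hl, fun i hi => (hσ.2 i hi).trans (hρ.2 i (hi.trans_le hl)).symm⟩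
  · exact .inr ⟨hl, fun i hi => (hρ.2 i hi).trans (hσ.2 i (hi.trans_le hl)).symm⟩

theorem PrecFun.of_isPrefix {g : M.Num → M.Num} {σ ρ : M.Num} (h : PrecFun σ (graph g))
    (hρ : IsSeq ρ) (hinit : IsPrefix ρ σ) : PrecFun ρ (graph g) := by
  rw [precFun_graph] at h ⊢
  exact ⟨hρ, fun i hi => (hinit.2 i hi).trans (h.2 i (hi.trans_le hinit.1))⟩

theorem pair_mem_openSlice {D : Set M.Num} {i n σ : M.Num} :
    pair n σ ∈ openSlice D i ↔ pair i (pair n σ) ∈ D := by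
  simp [openSlice]

theorem IsOpenCode.mem_finPartition {k : ℕ} {O : Set M.Num} (hO : M.IsOpenCode k O) {n σ : M.Num}
    (h : pair n σ ∈ O) : σ ∈ M.FinPartition k := by
  obtain ⟨n', σ', hσ', heq⟩ := hO.2 _ h
  rwa [(pair_inj heq).2]

theorem IsOpenSeqCode.isOpenCode_openSlice {k : ℕ} {D : Set M.Num} (hD : M.IsOpenSeqCode k D)
    (i : M.Num) : M.IsOpenCode k (openSlice D i) := by
  have hDs := hD.1
  constructor
  · change Internal fun z => ∃ n σ, z = pair n σ ∧ pair i (pair n σ) ∈ D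
    refine Internal.congr (P := fun z => IsPair z ∧ pair i z ∈ D)
      (by fun_prop (disch := assumption)) fun z => ⟨?_, ?_⟩
    · rintro ⟨n, σ, rfl, h⟩
      exact ⟨isPair_pair n σ, h⟩
    · rintro ⟨⟨n, σ, rfl⟩, h⟩
      exact ⟨n, σ, rfl, h⟩
  · rintro _ ⟨n, σ, rfl, h⟩
    obtain ⟨_, _, σ', hσ', heq⟩ := hD.2 _ h
    rw [(pair_inj (pair_inj heq).2).2]
    exact ⟨n, σ', hσ', rfl⟩

theorem IsDenseOpen.exists_isPrefix {k : ℕ} (hk : 0 < k) {O : Set M.Num} (hO : M.IsOpenCode k O)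
    (hdense : IsDenseOpen k O) {σ : M.Num} (hσ : σ ∈ M.FinPartition k) :
    ∃ π ∈ M.FinPartition k, IsPrefix σ π ∧ len σ < len π ∧ ∃ n ρ, pair n ρ ∈ O ∧ IsPrefix ρ π := by
  obtain ⟨n, ρ, hnρ, hcomp⟩ := hdense σ hσ
  obtain ⟨π, hπ, hσπ, hρπ⟩ : ∃ π ∈ M.FinPartition k, IsPrefix σ π ∧ IsPrefix ρ π := by
    rcases hcomp with h | h
    · exact ⟨σ, hσ, .refl _, (initSeg_iff.1 h).2.2⟩
    · exact ⟨ρ, hO.mem_finPartition hnρ, (initSeg_iff.1 h).2.2, .refl _⟩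
  refine ⟨snoc π 0, snoc_zero_mem_finPartition hk hπ, hσπ.trans (isPrefix_snoc _ _), ?_, n, ρ, hnρ,
    hρπ.trans (isPrefix_snoc _ _)⟩
  rw [len_snoc]
  exact Order.lt_add_one_iff.2 hσπ.1

theorem isPrefix_of_le {s : M.Num → M.Num} (hs : InternalFun s)
    (hinit : ∀ n, IsPrefix (s n) (s (n + 1))) {m n : M.Num} (h : m ≤ n) :
    IsPrefix (s m) (s n) := by
  obtain ⟨d, rfl⟩ := exists_add_of_le h
  have hadd : ∀ d, IsPrefix (s m) (s (m + d)) :=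
    Internal.induction (by fun_prop) (by rw [add_zero]; exact .refl _) fun d hd => by
      rw [← add_assoc]
      exact hd.trans (hinit _)
  exact hadd d

theorem exists_limit_of_isPrefix {s : M.Num → M.Num} (hs : InternalFun s)
    (hinit : ∀ n, IsPrefix (s n) (s (n + 1))) (hlen : ∀ n, len (s n) < len (s (n + 1))) :
    ∃ g : M.Num → M.Num, InternalFun g ∧
      ∀ n, n ≤ len (s n) ∧ ∀ i < len (s n), entry (s n) i = g i := by
  have hle : ∀ n, n ≤ len (s n) := Internal.induction (by fun_prop) zero_le fun n hn =>
    Order.add_one_le_iff.2 (hn.trans_lt (hlen n))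
  refine ⟨fun i => entry (s (i + 1)) i, by fun_prop, fun n => ⟨hle n, fun i hi => ?_⟩⟩
  rcases le_total n (i + 1) with h | h
  · exact (isPrefix_of_le hs hinit h).2 i hi
  · exact ((isPrefix_of_le hs hinit h).2 i ((lt_add_one i).trans_le (hle _))).symm

theorem exists_partition_of_isPrefix {k : ℕ} {s : M.Num → M.Num} (hs : InternalFun s)
    (hmem : ∀ n, s n ∈ M.FinPartition k) (hinit : ∀ n, IsPrefix (s n) (s (n + 1)))
    (hlen : ∀ n, len (s n) < len (s (n + 1))) :
    ∃ x ∈ M.Partition k, ∀ n, PrecFun (s n) x := by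
  obtain ⟨g, hg, hsg⟩ := exists_limit_of_isPrefix hs hinit hlen
  have hlt (n : M.Num) : n < len (s (n + 1)) := (lt_add_one n).trans_le (hsg _).1
  refine ⟨graph g, mem_partition.2 ⟨g, hg, rfl, fun n => ?_, fun n j hj => ?_, fun i hi => ?_⟩,
    fun n => precFun_graph.2 ⟨isSeq_of_mem_finPartition (hmem n), (hsg n).2⟩⟩
  · rw [← (hsg _).2 n (hlt n)]
    exact (mem_finPartition.1 (hmem (n + 1))).2.1 n (hlt n)
  · rw [← (hsg _).2 n (hlt n)] at hj
    obtain ⟨m, hm, rfl⟩ := (mem_finPartition.1 (hmem (n + 1))).2.2.1 n (hlt n) j hj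
    exact ⟨m, hm, ((hsg _).2 m (hm.trans (hlt n))).symm⟩
  · obtain ⟨n, hn, rfl⟩ := (mem_finPartition.1 (hmem 0)).2.2.2 i hi
    exact ⟨n, ((hsg 0).2 n hn).symm⟩

theorem exists_partition_memOpen_openSlice {k : ℕ} (hk : 0 < k) {D : Set M.Num}
    (hD : M.IsOpenSeqCode k D) (hdense : ∀ n, IsDenseOpen k (openSlice D n)) {σ : M.Num}
    (hσ : σ ∈ M.FinPartition k) :
    ∃ x ∈ M.Partition k, PrecFun σ x ∧ ∀ n, MemOpen x (openSlice D n) := by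
  have hDs := hD.1
  obtain ⟨g, hg, hg_zero, hstep⟩ := exists_dependent_choice
    (P := fun z => fst z ∈ M.FinPartition k) (by fun_prop)
    (T := fun n z z' => IsPrefix (fst z) (fst z') ∧ len (fst z) < len (fst z') ∧
      pair n (snd z') ∈ D ∧ IsPrefix (snd (snd z')) (fst z'))
    (by fun_prop (disch := assumption)) (a := pair σ 0) (by simpa using hσ) fun n z hz => by
      obtain ⟨π, hπ, hinit, hlt, m, ρ, hmρ, hρπ⟩ :=
        (hdense n).exists_isPrefix hk (hD.isOpenCode_openSlice n) hz
      rw [pair_mem_openSlice] at hmρ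
      exact ⟨pair π (pair m ρ), by simp [hπ, hinit, hlt, hmρ, hρπ]⟩
  obtain ⟨x, hx, hprec⟩ := exists_partition_of_isPrefix (s := fun n => fst (g n)) (by fun_prop)
    (fun n => (hstep n).1) (fun n => (hstep n).2.1) fun n => (hstep n).2.2.1
  refine ⟨x, hx, by simpa [hg_zero] using hprec 0, fun n => ?_⟩
  obtain ⟨x, -, rfl, -⟩ := mem_partition.1 hx
  obtain ⟨-, -, -, hD_mem, hinit⟩ := hstep n
  obtain ⟨_, m, ρ, hρ, heq⟩ := hD.2 _ hD_mem
  rw [(pair_inj heq).2] at hD_mem hinit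
  rw [snd_pair] at hinit
  exact ⟨m, ρ, pair_mem_openSlice.2 hD_mem,
    (hprec _).of_isPrefix (isSeq_of_mem_finPartition hρ) hinit⟩

theorem evaluated_of_baireCode {k : ℕ} (hk : 0 < k) {τ : Set M.Num}
    (h : M.BorelCodesHaveBaireCode k τ) : M.BorelCodesHaveEvaluatedPoint k τ := by
  intro B hB
  obtain ⟨U, V, D, hcode⟩ := h B hB
  obtain ⟨σ, hσ⟩ := finPartition_nonempty (M := M) k
  obtain ⟨n, ρ, hρ, -⟩ := hcode.denseUV σ hσ
  have hρ_mem : ρ ∈ M.FinPartition k :=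
    hρ.elim hcode.openU.mem_finPartition hcode.openV.mem_finPartition
  obtain ⟨x, hx, hρx, hxD⟩ :=
    exists_partition_memOpen_openSlice hk hcode.openD hcode.denseD hρ_mem
  refine ⟨x, hx, hρ.imp (fun hU => ?_) fun hV => ?_⟩
  · exact hcode.mem_of_mem x hx hxD ⟨n, ρ, hU, hρx⟩
  · exact hcode.not_mem_of_mem x hx hxD ⟨n, ρ, hV, hρx⟩

end L2Structure

namespace L2Structure

variable {M : L2Structure.{u}}

/-! ### The Kleene–Brouwer order -/

section ArithmeticalComprehension

variable [hM : Fact M.ACA0]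

instance : Fact M.RCA0 := ⟨hM.out.rca0⟩

@[fun_prop]
protected theorem Internal.exists {P : M.Num → M.Num → Prop}
    (hP : Internal fun z => P (fst z) (snd z)) : Internal fun c => ∃ y, P c y := by
  obtain ⟨X, hX, hX_iff⟩ := hM.out.arithmetical_comprehension
    (.ex (.mem (pairTerm (.var 1) (.var 0)) 0)) (fun _ => 0) (fun _ => _) fun _ => hP
  have hiff (c : M.Num) : c ∈ X ↔ ∃ y, P (fst (pair c y)) (snd (pair c y)) := hX_iff c
  simp only [fst_pair, snd_pair] at hiff
  exact Internal.congr (P := (· ∈ X)) hX fun c => (hiff c).symm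

@[fun_prop]
protected theorem Internal.forall {P : M.Num → M.Num → Prop}
    (hP : Internal fun z => P (fst z) (snd z)) : Internal fun c => ∀ y, P c y :=
  (Internal.exists (P := fun c y => ¬ P c y) hP.not).not.congr fun _ => not_exists_not.symm

end ArithmeticalComprehension

section KleeneBrouwer

variable [hM : Fact M.RCA0]

/-- The strict Kleene–Brouwer order of finite sequences: `σ` properly extends `ρ`, or `σ` has the
smaller entry at the first place where the two differ. -/
def KBLT (σ ρ : M.Num) : Prop := ∃ i < len σ, i ≤ len ρ ∧ (∀ j < i, entry σ j = entry ρ j) ∧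
  (i < len ρ → entry σ i < entry ρ i)

@[fun_prop]
protected theorem Internal.kblt {f g : M.Num → M.Num} (hf : InternalFun f) (hg : InternalFun g) :
    Internal fun c => KBLT (f c) (g c) := by
  unfold KBLT
  fun_prop

theorem KBLT.trans {σ ρ π : M.Num} (h : KBLT σ ρ) (h' : KBLT ρ π) : KBLT σ π := by
  obtain ⟨i, hiσ, _, hi_eq, hi_lt⟩ := h
  obtain ⟨j, hjρ, hjπ, hj_eq, hj_lt⟩ := h'
  rcases lt_trichotomy i j with hij | rfl | hij
  · refine ⟨i, hiσ, hij.le.trans hjπ, fun l hl => (hi_eq l hl).trans (hj_eq l (hl.trans hij)),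
      fun _ => ?_⟩
    rw [← hj_eq i hij]
    exact hi_lt (hij.trans hjρ)
  · exact ⟨i, hiσ, hjπ, fun l hl => (hi_eq l hl).trans (hj_eq l hl),
      fun h => (hi_lt hjρ).trans (hj_lt h)⟩
  · refine ⟨j, hij.trans hiσ, hjπ, fun l hl => (hi_eq l (hl.trans hij)).trans (hj_eq l hl),
      fun h => ?_⟩
    rw [hi_eq j hij]
    exact hj_lt h

theorem KBLT.irrefl (σ : M.Num) : ¬ KBLT σ σ := fun ⟨_, hi, _, _, h⟩ => lt_irrefl _ (h hi)

theorem KBLT.total {σ ρ : M.Num} (hσ : IsSeq σ) (hρ : IsSeq ρ) (hne : σ ≠ ρ) :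
    KBLT σ ρ ∨ KBLT ρ σ := by
  by_cases h : ∃ i, i < len σ ∧ i < len ρ ∧ entry σ i ≠ entry ρ i
  · obtain ⟨i₀, hi₀⟩ := h
    obtain ⟨i, ⟨hiσ, hiρ, hi_ne⟩, hmin⟩ := Internal.exists_least
      (P := fun i => i < len σ ∧ i < len ρ ∧ entry σ i ≠ entry ρ i) (by fun_prop) hi₀
    have heq (j : M.Num) (hj : j < i) : entry σ j = entry ρ j :=
      not_not.1 fun hj_ne => hmin j hj ⟨hj.trans hiσ, hj.trans hiρ, hj_ne⟩
    rcases lt_or_gt_of_ne hi_ne with hlt | hlt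
    · exact .inl ⟨i, hiσ, hiρ.le, heq, fun _ => hlt⟩
    · exact .inr ⟨i, hiρ, hiσ.le, fun j hj => (heq j hj).symm, fun _ => hlt⟩
  · push Not at h
    rcases lt_trichotomy (len σ) (len ρ) with hlen | hlen | hlen
    · exact .inr ⟨len σ, hlen, le_rfl, fun j hj => (h j hj (hj.trans hlen)).symm,
        fun hlt => absurd hlt (lt_irrefl _)⟩
    · exact absurd (hσ.ext hρ hlen fun i hi => h i hi (hlen ▸ hi)) hne
    · exact .inl ⟨len ρ, hlen, le_rfl, fun j hj => h j (hj.trans hlen) hj,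
        fun hlt => absurd hlt (lt_irrefl _)⟩

theorem kblt_snoc (σ m : M.Num) : KBLT (snoc σ m) σ :=
  ⟨len σ, by rw [len_snoc]; exact lt_add_one _, le_rfl, fun _ hj => entry_snoc_of_lt hj,
    fun h => absurd h (lt_irrefl _)⟩

theorem KBLT.entry_len_le {σ ρ π : M.Num} (h : KBLT ρ π) (hρ : IsPrefix σ ρ) (hπ : IsPrefix σ π) :
    len σ < len ρ ∧ (len σ < len π → entry ρ (len σ) ≤ entry π (len σ)) := by
  obtain ⟨i, hiρ, hiπ, heq, hlt⟩ := h
  have hi : len σ ≤ i := by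
    by_contra! hi
    exact (hlt (hi.trans_le hπ.1)).ne ((hρ.2 i hi).symm.trans (hπ.2 i hi))
  refine ⟨hi.trans_lt hiρ, fun hσπ => ?_⟩
  rcases hi.lt_or_eq with hi | rfl
  · exact (heq _ hi).le
  · exact (hlt hσπ).le

/-- The Kleene–Brouwer order of a set of finite sequences. -/
def kbOrder (T : Set M.Num) : Set M.Num :=
  {z | IsPair z ∧ fst z ∈ T ∧ snd z ∈ T ∧ (fst z = snd z ∨ KBLT (fst z) (snd z))}

theorem kbOrder_mem_sets {T : Set M.Num} (hT : T ∈ M.Sets) : kbOrder T ∈ M.Sets := by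
  change Internal _
  fun_prop (disch := assumption)

theorem relLE_kbOrder {T : Set M.Num} {σ ρ : M.Num} :
    relLE (kbOrder T) σ ρ ↔ σ ∈ T ∧ ρ ∈ T ∧ (σ = ρ ∨ KBLT σ ρ) := by
  simp [relLE, kbOrder, isPair_pair]

theorem relLT_kbOrder {T : Set M.Num} {σ ρ : M.Num} :
    relLT (kbOrder T) σ ρ ↔ σ ∈ T ∧ ρ ∈ T ∧ KBLT σ ρ := by
  unfold relLT
  rw [relLE_kbOrder, relLE_kbOrder]
  constructor
  · rintro ⟨⟨hσ, hρ, rfl | h⟩, hn⟩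
    · exact absurd ⟨hσ, hσ, .inl rfl⟩ hn
    · exact ⟨hσ, hρ, h⟩
  · rintro ⟨hσ, hρ, h⟩
    refine ⟨⟨hσ, hρ, .inr h⟩, ?_⟩
    rintro ⟨_, _, rfl | h'⟩
    · exact KBLT.irrefl _ h
    · exact KBLT.irrefl _ (h.trans h')

theorem mem_field_kbOrder {T : Set M.Num} {σ : M.Num} : σ ∈ field (kbOrder T) ↔ σ ∈ T := by
  change relLE (kbOrder T) σ σ ↔ _
  simp [relLE_kbOrder]

theorem isLO_kbOrder {T : Set M.Num} (hT : ∀ σ ∈ T, IsSeq σ) : IsLO (kbOrder T) where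
  refl σ ρ h := by
    rw [relLE_kbOrder] at h
    exact ⟨mem_field_kbOrder.2 h.1, mem_field_kbOrder.2 h.2.1⟩
  trans σ ρ π h h' := by
    rw [relLE_kbOrder] at h h' ⊢
    refine ⟨h.1, h'.2.1, ?_⟩
    rcases h.2.2 with rfl | hlt
    · exact h'.2.2
    · rcases h'.2.2 with rfl | hlt'
      · exact .inr hlt
      · exact .inr (hlt.trans hlt')
  antisymm σ ρ h h' := by
    rw [relLE_kbOrder] at h h'
    rcases h.2.2 with rfl | hlt
    · rfl
    · rcases h'.2.2 with rfl | hlt'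
      · rfl
      · exact absurd (hlt.trans hlt') (KBLT.irrefl _)
  total σ hσ ρ hρ := by
    rw [mem_field_kbOrder] at hσ hρ
    rw [relLE_kbOrder, relLE_kbOrder]
    by_cases h : σ = ρ
    · exact .inl ⟨hσ, hρ, .inl h⟩
    · exact (KBLT.total (hT σ hσ) (hT ρ hρ) h).imp (fun hlt => ⟨hσ, hρ, .inr hlt⟩)
        fun hlt => ⟨hρ, hσ, .inr hlt⟩

end KleeneBrouwer

section WellOrder

variable [hM : Fact M.ACA0]

theorem exists_eventually_const {a : M.Num → M.Num} (ha : InternalFun a) {n : M.Num}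
    (hanti : ∀ m, n ≤ m → a (m + 1) ≤ a m) : ∃ n', n ≤ n' ∧ ∀ m, n' ≤ m → a m = a n' := by
  obtain ⟨_, ⟨n', hn', rfl⟩, hmin⟩ := Internal.exists_least (P := fun c => ∃ m, n ≤ m ∧ a m = c)
    (by fun_prop) ⟨n, le_rfl, rfl⟩
  have hconst : ∀ d, a (n' + d) = a n' :=
    Internal.induction (by fun_prop) (by rw [add_zero]) fun d hd => by
      rw [← add_assoc]
      exact le_antisymm ((hanti _ (hn'.trans le_self_add)).trans hd.le)
        (not_lt.1 fun hlt => hmin _ hlt ⟨_, (hn'.trans le_self_add).trans le_self_add, rfl⟩)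
  refine ⟨n', hn', fun m hm => ?_⟩
  obtain ⟨d, rfl⟩ := exists_add_of_le hm
  exact hconst d

variable {g : M.Num → M.Num}

theorem exists_snoc_eventually_isPrefix (hg : InternalFun g) (hdesc : ∀ n, KBLT (g (n + 1)) (g n))
    {σ n : M.Num} (h : ∀ m, n ≤ m → IsPrefix σ (g m)) :
    ∃ c n', ∀ m, n' ≤ m → IsPrefix (snoc σ c) (g m) := by
  have hstep (m : M.Num) (hm : n ≤ m) :=
    (hdesc m).entry_len_le (h (m + 1) (hm.trans le_self_add)) (h m hm)
  have hlen (m : M.Num) (hm : n + 1 ≤ m) : len σ < len (g m) := by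
    obtain ⟨d, rfl⟩ := exists_add_of_le hm
    rw [add_right_comm]
    exact (hstep (n + d) le_self_add).1
  obtain ⟨n', hn', hconst⟩ := exists_eventually_const (a := fun m => entry (g m) (len σ))
    (n := n + 1) (by fun_prop) fun m hm => (hstep m (le_self_add.trans hm)).2 (hlen m hm)
  refine ⟨entry (g n') (len σ), n', fun m hm => ⟨?_, fun i hi => ?_⟩⟩
  · rw [len_snoc]
    exact Order.add_one_le_iff.2 (hlen m (hn'.trans hm))
  · rw [len_snoc, Order.lt_add_one_iff] at hi
    rcases hi.lt_or_eq with hi | rfl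
    · rw [entry_snoc_of_lt hi]
      exact (h m ((le_self_add.trans hn').trans hm)).2 i hi
    · rw [entry_snoc_last]
      exact (hconst m hm).symm

/-- The sequences that are initial segments of almost all terms of a descending sequence form an
infinite path. -/
theorem exists_path_of_descending {T : Set M.Num} (hT : IsTree T) (hg : InternalFun g)
    (hgT : ∀ n, g n ∈ T) (hdesc : ∀ n, KBLT (g (n + 1)) (g n)) :
    ∃ p : M.Num → M.Num, InternalFun p ∧ ∀ n, ∃ σ ∈ T, IsRestriction (graph p) n σ := by
  obtain ⟨s, hs, hs_zero, hstep⟩ := exists_dependent_choice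
    (P := fun σ => IsSeq σ ∧ ∃ n, ∀ m, n ≤ m → IsPrefix σ (g m)) (by fun_prop)
    (T := fun _ σ σ' => ∃ c, σ' = snoc σ c) (by fun_prop) (a := nil)
    ⟨isSeq_nil, 0, fun m _ => ⟨by rw [len_nil]; exact zero_le,
      fun i hi => absurd (len_nil (M := M) ▸ hi) not_lt_zero⟩⟩
    fun _ σ ⟨_, m, hm⟩ => by
      obtain ⟨c, hc⟩ := exists_snoc_eventually_isPrefix hg hdesc hm
      exact ⟨snoc σ c, ⟨isSeq_snoc σ c, hc⟩, c, rfl⟩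
  have hinit (n : M.Num) : IsPrefix (s n) (s (n + 1)) := by
    obtain ⟨-, c, hc⟩ := hstep n
    rw [hc]
    exact isPrefix_snoc _ _
  have hlen_succ (n : M.Num) : len (s (n + 1)) = len (s n) + 1 := by
    obtain ⟨-, c, hc⟩ := hstep n
    rw [hc, len_snoc]
  have hlen : ∀ n, len (s n) = n := Internal.induction (by fun_prop) (by rw [hs_zero, len_nil])
    fun n hn => by rw [hlen_succ, hn]
  obtain ⟨p, hp, hsp⟩ := exists_limit_of_isPrefix hs hinit fun n => by
    rw [hlen_succ]
    exact lt_add_one _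
  refine ⟨p, hp, fun n => ⟨s n, ?_, isRestriction_graph.2 ⟨(hstep n).1.1, hlen n, ?_⟩⟩⟩
  · obtain ⟨⟨hseq, m, hm⟩, -⟩ := hstep n
    exact hT.2 _ (hgT m) _ (initSeg_iff.2 ⟨hseq, hT.1 _ (hgT m), hm m le_rfl⟩)
  · have hsp_n := (hsp n).2
    rwa [hlen n] at hsp_n

theorem isWO_kbOrder {T : Set M.Num} (hT : IsTree T)
    (hpath : ¬ ∃ g ∈ M.Sets, IsFun g Set.univ Set.univ ∧ ∀ n, ∃ σ ∈ T, IsRestriction g n σ) :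
    IsWO (kbOrder T) := by
  refine ⟨isLO_kbOrder hT.1, ?_⟩
  rintro ⟨F, hF, hF_fun, hdesc⟩
  obtain ⟨g, hg, rfl, hgT⟩ := hF_fun.exists_eq_graph hF
  obtain ⟨p, hp, hpT⟩ := exists_path_of_descending hT hg (fun n => mem_field_kbOrder.1 (hgT n))
    fun n => (relLT_kbOrder.1 (hdesc n _ _ (pair_mem_graph.2 rfl) (pair_mem_graph.2 rfl))).2.2
  exact hpath ⟨graph p, hp, isFun_graph fun _ => trivial, hpT⟩

end WellOrder

/-! ### Forcing -/

theorem IsHierarchy.pair_mem_iff {θ : AFormula} {e : ℕ → M.Num} {E : ℕ → Set M.Num}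
    {X Y : Set M.Num} [Fact M.RCA0] (hY : IsHierarchy θ e E X Y) {n j : M.Num} :
    pair n j ∈ Y ↔ j ∈ field X ∧ M.Sat θ (pushVar n e) (pushVar (below X Y j) E) := by
  rw [hY.2]
  constructor
  · rintro ⟨n, j, h, hj⟩
    obtain ⟨rfl, rfl⟩ := pair_inj h
    exact hj
  · exact fun hj => ⟨n, j, rfl, hj⟩

theorem pair_mem_below [Fact M.RCA0] {X Y : Set M.Num} {m a j : M.Num} :
    pair m a ∈ below X Y j ↔ relLT X a j ∧ pair m a ∈ Y := by
  constructor
  · rintro ⟨m, a, h, ha⟩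
    obtain ⟨rfl, rfl⟩ := pair_inj h
    exact ha
  · exact fun ha => ⟨m, a, rfl, ha⟩

/-- The relation `S` as a set of pairs, with the second argument `w` replaced by `⟨w, r w⟩`: in a
hierarchy, this pair records the membership of `w` at the stage `r w`. -/
def stagedRel (r : M.Num → M.Num) (S : M.Num → M.Num → Prop) : Set M.Num :=
  {v | snd v ∈ graph r ∧ S (fst v) (fst (snd v))}

theorem stagedRel_mem_sets [Fact M.RCA0] {r : M.Num → M.Num} (hr : InternalFun r)
    {S : M.Num → M.Num → Prop} (hS : Internal fun z => S (fst z) (snd z)) :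
    stagedRel r S ∈ M.Sets :=
  (Internal.mem hr (by fun_prop)).and (hS.comp₂ (by fun_prop) (by fun_prop))

theorem pair_mem_stagedRel [Fact M.RCA0] {r : M.Num → M.Num} {S : M.Num → M.Num → Prop}
    {a v : M.Num} : pair a v ∈ stagedRel r S ↔ ∃ w, v = pair w (r w) ∧ S a w := by
  change snd (pair a v) ∈ graph r ∧ S (fst (pair a v)) (fst (snd (pair a v))) ↔ _
  rw [fst_pair, snd_pair]
  constructor
  · rintro ⟨⟨w, rfl⟩, h⟩
    exact ⟨w, rfl, by rwa [fst_pair] at h⟩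
  · rintro ⟨w, rfl, h⟩
    exact ⟨⟨w, rfl⟩, by rwa [fst_pair]⟩

instance [h : Fact M.ATR0] : Fact M.ACA0 := ⟨h.out.aca0⟩

/-- Whether `c` belongs to the set defined by recursion is decided at the stage `r c`. -/
theorem exists_transfinite_recursion [hM : Fact M.ATR0] {X : Set M.Num} (hX_mem : X ∈ M.Sets)
    (hX : IsWO X) {r : M.Num → M.Num} (hr : InternalFun r) {A : M.Num → Prop} (hA : Internal A)
    {P Q N : M.Num → M.Num → Prop} (hP : Internal fun z => P (fst z) (snd z))
    (hQ : Internal fun z => Q (fst z) (snd z)) (hN : Internal fun z => N (fst z) (snd z))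
    (hP_lt : ∀ c w, P c w → relLT X (r w) (r c))
    (hN_lt : ∀ c z w, Q c z → N z w → relLT X (r w) (r c)) :
    ∃ W : M.Num → Prop, Internal W ∧ ∀ c, r c ∈ field X →
      (W c ↔ A c ∨ (∃ w, P c w ∧ W w) ∨ ∃ z, Q c z ∧ ∀ w, N z w → ¬ W w) := by
  obtain ⟨Y, hY, hY_hier⟩ := hM.out.transfinite_recursion
    (.or (.mem (.var 0) 1) (.or
      (.ex (.and (.mem (pairTerm (.var 1) (.var 0)) 2) (.mem (.var 0) 0)))
      (.ex (.and (.mem (pairTerm (.var 1) (.var 0)) 3)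
        (.all (.imp (.mem (pairTerm (.var 1) (.var 0)) 4) (.neg (.mem (.var 0) 0))))))))
    (fun _ => 0) (pushVar {c | A c} (pushVar (stagedRel r P)
      (pushVar {z | Q (fst z) (snd z)} fun _ => stagedRel r N)))
    (pushVar_mem_sets hA (pushVar_mem_sets (stagedRel_mem_sets hr hP)
      (pushVar_mem_sets hQ fun _ => stagedRel_mem_sets hr hN))) X hX_mem hX
  have hY_rec (c j : M.Num) : pair c j ∈ Y ↔ j ∈ field X ∧
      (A c ∨ (∃ v, pair c v ∈ stagedRel r P ∧ v ∈ below X Y j) ∨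
        ∃ z, Q (fst (pair c z)) (snd (pair c z)) ∧
          ∀ v, pair z v ∈ stagedRel r N → v ∉ below X Y j) :=
    hY_hier.pair_mem_iff
  refine ⟨fun c => pair c (r c) ∈ Y, by fun_prop (disch := assumption), fun c hc => ?_⟩
  simp only [hY_rec c (r c), hc, true_and, fst_pair, snd_pair, pair_mem_stagedRel]
  refine or_congr_right (or_congr ⟨?_, ?_⟩
    (exists_congr fun z => and_congr_right fun hz => ⟨?_, ?_⟩))
  · rintro ⟨_, ⟨w, rfl, hw⟩, h⟩
    exact ⟨w, hw, (pair_mem_below.1 h).2⟩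
  · rintro ⟨w, hw, h⟩
    exact ⟨_, ⟨w, rfl, hw⟩, pair_mem_below.2 ⟨hP_lt c w hw, h⟩⟩
  · exact fun h w hw hWw => h _ ⟨w, rfl, hw⟩ (pair_mem_below.2 ⟨hN_lt c z w hz hw, hWw⟩)
  · rintro h _ ⟨w, rfl, hw⟩ hWw
    exact h w hw (pair_mem_below.1 hWw).2

section Forcing

variable [hM : Fact M.RCA0]

/-- The last entry of `σ` is even: an interior node `σ` of a Borel code is a union. -/
def EvenLast (σ : M.Num) : Prop := ∃ c, IsLast σ (2 * c)

theorem IsLast.isLast_iff {σ a b : M.Num} (h : IsLast σ a) : IsLast σ b ↔ b = a := by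
  obtain ⟨hσ, l, hl, rfl⟩ := L2Structure.isLast_iff.1 h
  rw [L2Structure.isLast_iff, and_iff_right hσ]
  constructor
  · rintro ⟨l', hl', rfl⟩
    rw [add_right_cancel (hl.symm.trans hl')]
  · rintro rfl
    exact ⟨l, hl, rfl⟩

theorem evenLast_of_isLast {σ c : M.Num} (h : IsLast σ (2 * c)) : EvenLast σ := ⟨c, h⟩

theorem not_evenLast_of_isLast {σ c : M.Num} (h : IsLast σ (2 * c + 1)) : ¬ EvenLast σ := by
  rintro ⟨d, hd⟩
  exact two_mul_ne_two_mul_add_one d c (h.isLast_iff.1 hd)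

theorem isLeaf_iff {B : Set M.Num} (hB : IsTree B) {σ : M.Num} :
    IsLeaf B σ ↔ σ ∈ B ∧ ∀ m, snoc σ m ∉ B := by
  simp only [IsLeaf, isSnoc_iff]
  refine and_congr_right fun hσ => ⟨fun h m hm => h ⟨m, _, hm, hB.1 σ hσ, rfl⟩, ?_⟩
  rintro h ⟨m, _, hm, -, rfl⟩
  exact h m hm

variable (k : ℕ) (t : M.Num → M.Num) (B : Set M.Num) (W : M.Num → M.Num → Prop)

/-- The finite partition `s` forces the negation of `W σ`: no finite partition extending `s`
satisfies `W σ`. -/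
def NegForce (σ s : M.Num) : Prop :=
  ∀ r, r ∈ M.FinPartition k ∧ IsPrefix s r → ¬ W σ r

/-- The finite partition `s` decides the leaf `σ` against the default of its label: it puts a
generic partition into the set `[τ_m]` coded by an even label `2m + 2`, or out of the complement
of `[τ_m]` coded by `2m + 3`. -/
def LeafForce (σ s : M.Num) : Prop :=
  IsLeaf B σ ∧ ∃ m, (IsLast σ (2 * (m + 1)) ∨ IsLast σ (2 * (m + 1) + 1)) ∧ IsPrefix (t m) s

/-- The finite partition `s` forces a generic partition into the set coded by the subtree at `σ`
if `p` holds, and out of it otherwise; see `IsForcing` for the role of `W`. -/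
def Forces (p : Prop) (σ s : M.Num) : Prop :=
  ((EvenLast σ ↔ p) ∧ W σ s) ∨ (¬ (EvenLast σ ↔ p) ∧ NegForce k W σ s)

/-- The relation `W` is the forcing relation of the Borel code `B`: for a node `σ` with even last
entry, `W σ s` means that `s` forces a generic partition into the set coded by the subtree at `σ`,
and for the other nodes, that `s` forces it out of that set. In both cases, an interior node is
decided by one of its children, and the opposite decision is the forced negation of `W σ`. -/
structure IsForcing : Prop where
  internal : Internal fun z => W (fst z) (snd z)
  iff : ∀ σ ∈ B, ∀ s, W σ s ↔ LeafForce t B σ s ∨ ∃ m u, snoc σ m ∈ B ∧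
    u ∈ M.FinPartition k ∧ IsPrefix u s ∧ Forces k W (EvenLast σ) (snoc σ m) u

end Forcing

section Definability

variable [hM : Fact M.ACA0] {k : ℕ} {t : M.Num → M.Num} {B : Set M.Num}
  {W : M.Num → M.Num → Prop}

@[fun_prop]
protected theorem Internal.evenLast {f : M.Num → M.Num} (hf : InternalFun f) :
    Internal fun c => EvenLast (f c) := by
  unfold EvenLast
  fun_prop

theorem Internal.isLeaf (hB : B ∈ M.Sets) (hB_tree : IsTree B)
    {f : M.Num → M.Num} (hf : InternalFun f) : Internal fun c => IsLeaf B (f c) := by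
  simp only [isLeaf_iff hB_tree]
  fun_prop (disch := assumption)

theorem Internal.leafForce (ht : InternalFun t) (hB : B ∈ M.Sets) (hB_tree : IsTree B)
    {f g : M.Num → M.Num} (hf : InternalFun f) (hg : InternalFun g) :
    Internal fun c => LeafForce t B (f c) (g c) := by
  refine (Internal.isLeaf hB hB_tree hf).and ?_
  fun_prop

theorem Internal.negForce (hW : Internal fun z => W (fst z) (snd z)) {f g : M.Num → M.Num}
    (hf : InternalFun f) (hg : InternalFun g) : Internal fun c => NegForce k W (f c) (g c) :=
  .forall (.imp (by fun_prop) (hW.comp₂ (by fun_prop) (by fun_prop)).not)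

end Definability

section Recursion

/-- The pairs `w = ⟨σ', u⟩` on which the forcing relation at `c = ⟨σ, s⟩` depends: `σ'` is a child
of `σ` in `B`, and `u` is a finite partition that is an initial segment of `s`. -/
def ForcingChild [Fact M.RCA0] (k : ℕ) (B : Set M.Num) (c w : M.Num) : Prop :=
  ∃ m u, w = pair (snoc (fst c) m) u ∧ fst c ∈ B ∧ snoc (fst c) m ∈ B ∧
    u ∈ M.FinPartition k ∧ IsPrefix u (snd c)

theorem Internal.forcingChild [Fact M.ACA0] (k : ℕ) {B : Set M.Num} (hB : B ∈ M.Sets) :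
    Internal fun z => ForcingChild k B (fst z) (snd z) := by
  unfold ForcingChild
  fun_prop (disch := assumption)

theorem ForcingChild.relLT_kbOrder [Fact M.RCA0] {k : ℕ} {B : Set M.Num} {c w : M.Num}
    (h : ForcingChild k B c w) : relLT (kbOrder B) (fst w) (fst c) := by
  obtain ⟨m, u, rfl, hc, hm, -⟩ := h
  rw [fst_pair]
  exact L2Structure.relLT_kbOrder.2 ⟨hm, hc, kblt_snoc _ _⟩

theorem exists_isForcing [Fact M.ATR0] (k : ℕ) {t : M.Num → M.Num} (ht : InternalFun t)
    {B : Set M.Num} (hB : M.IsBorelCode B) : ∃ W, IsForcing k t B W := by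
  have hB_sets := hB.mem_sets
  have hchild := Internal.forcingChild k hB_sets
  obtain ⟨W, hW, hW_iff⟩ := exists_transfinite_recursion (kbOrder_mem_sets hB_sets)
    (isWO_kbOrder hB.tree hB.no_path) (r := fst) (by fun_prop)
    (A := fun c => LeafForce t B (fst c) (snd c))
    (.leafForce ht hB_sets hB.tree (by fun_prop) (by fun_prop))
    (P := fun c w => ForcingChild k B c w ∧ (EvenLast (fst w) ↔ EvenLast (fst c)))
    (Q := fun c z => ForcingChild k B c z ∧ ¬ (EvenLast (fst z) ↔ EvenLast (fst c)))
    (N := fun z w => ∃ r, w = pair (fst z) r ∧ r ∈ M.FinPartition k ∧ IsPrefix (snd z) r)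
    (hchild.and (by fun_prop)) (hchild.and (by fun_prop)) (by fun_prop)
    (fun c w h => h.1.relLT_kbOrder) fun c z w hz ⟨r, hw, _⟩ => by
      rw [hw, fst_pair]
      exact hz.1.relLT_kbOrder
  refine ⟨fun σ s => W (pair σ s), hW.comp (by fun_prop), fun σ hσ s => ?_⟩
  rw [hW_iff (pair σ s) (by rw [fst_pair]; exact mem_field_kbOrder.2 hσ)]
  simp only [ForcingChild, fst_pair, snd_pair]
  refine or_congr_right ⟨?_, ?_⟩
  · rintro (⟨_, ⟨⟨m, u, rfl, -, hm, hu, hus⟩, heven⟩, h⟩ |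
      ⟨_, ⟨⟨m, u, rfl, -, hm, hu, hus⟩, heven⟩, h⟩) <;> simp only [fst_pair, snd_pair] at heven h
    · exact ⟨m, u, hm, hu, hus, .inl ⟨heven, h⟩⟩
    · exact ⟨m, u, hm, hu, hus, .inr ⟨heven, fun r hr => h _ ⟨r, rfl, hr⟩⟩⟩
  · rintro ⟨m, u, hm, hu, hus, ⟨heven, h⟩ | ⟨heven, h⟩⟩
    · exact .inl ⟨_, ⟨⟨m, u, rfl, hσ, hm, hu, hus⟩, by rwa [fst_pair]⟩, h⟩
    · refine .inr ⟨_, ⟨⟨m, u, rfl, hσ, hm, hu, hus⟩, by rwa [fst_pair]⟩, ?_⟩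
      rw [fst_pair, snd_pair]
      rintro _ ⟨r, rfl, hr⟩
      exact h r hr

end Recursion

/-! ### Generic partitions -/

section Generic

variable [hM : Fact M.RCA0]

/-- The partition `x` is in the open set of the partitions with an initial segment in `(ω)^k_fin`
that satisfies `Φ`. -/
def Meets (k : ℕ) (x : Set M.Num) (Φ : M.Num → Prop) : Prop :=
  ∃ s ∈ M.FinPartition k, PrecFun s x ∧ Φ s

/-- The finite partition `s` forces `W σ` or its negation. -/
def Decides (k : ℕ) (W : M.Num → M.Num → Prop) (σ s : M.Num) : Prop :=
  W σ s ∨ NegForce k W σ s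

/-- The partition `x` is generic for the forcing relation `W` of the Borel code `B`: every node of
`B` is decided by an initial segment of `x`. -/
def IsGeneric (k : ℕ) (B : Set M.Num) (W : M.Num → M.Num → Prop) (x : Set M.Num) : Prop :=
  ∀ σ ∈ B, Meets k x (Decides k W σ)

/-- The initial segments of the partition `x` put it into the set coded by the subtree at `σ`,
according to the forcing relation `W`; see `IsForcing`. -/
def TrueAt (k : ℕ) (W : M.Num → M.Num → Prop) (x : Set M.Num) (σ : M.Num) : Prop :=
  EvenLast σ ↔ Meets k x (W σ)

variable {k : ℕ} {t : M.Num → M.Num} {B : Set M.Num} {W : M.Num → M.Num → Prop}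
  {g : M.Num → M.Num} {σ : M.Num}

theorem LeafForce.mono {s s' : M.Num} (h : LeafForce t B σ s) (hs : IsPrefix s s') :
    LeafForce t B σ s' :=
  h.imp_right fun ⟨m, hm, hinit⟩ => ⟨m, hm, hinit.trans hs⟩

theorem IsForcing.mono (hW : IsForcing k t B W) (hσ : σ ∈ B) {s s' : M.Num} (h : W σ s)
    (hs : IsPrefix s s') : W σ s' := by
  rw [hW.iff σ hσ] at h ⊢
  exact h.imp (·.mono hs) fun ⟨m, u, hm, hu, hus, hforces⟩ =>
    ⟨m, u, hm, hu, hus.trans hs, hforces⟩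

theorem exists_decides (k : ℕ) (W : M.Num → M.Num → Prop) (σ : M.Num) {s : M.Num}
    (hs : s ∈ M.FinPartition k) : ∃ r ∈ M.FinPartition k, IsPrefix s r ∧ Decides k W σ r := by
  by_cases h : NegForce k W σ s
  · exact ⟨s, hs, .refl s, .inr h⟩
  · simp only [NegForce, not_forall, not_not] at h
    obtain ⟨r, ⟨hr, hinit⟩, hWr⟩ := h
    exact ⟨r, hr, hinit, .inl hWr⟩

theorem IsForcing.meets_negForce_iff (hW : IsForcing k t B W) (hσ : σ ∈ B)
    (hgen : IsGeneric k B W (graph g)) :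
    Meets k (graph g) (NegForce k W σ) ↔ ¬ Meets k (graph g) (W σ) := by
  constructor
  · rintro ⟨s, hs, hsg, hneg⟩ ⟨r, hr, hrg, hWr⟩
    rcases hsg.isPrefix_or_isPrefix hrg with h | h
    · exact hneg r ⟨hr, h⟩ hWr
    · exact hneg s ⟨hs, .refl s⟩ (hW.mono hσ hWr h)
  · intro hnot
    obtain ⟨s, hs, hsg, hWs | hneg⟩ := hgen σ hσ
    · exact absurd ⟨s, hs, hsg, hWs⟩ hnot
    · exact ⟨s, hs, hsg, hneg⟩

theorem IsForcing.meets_forces_iff (hW : IsForcing k t B W) (hσ : σ ∈ B)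
    (hgen : IsGeneric k B W (graph g)) {p : Prop} :
    Meets k (graph g) (Forces k W p σ) ↔ (TrueAt k W (graph g) σ ↔ p) := by
  by_cases h : EvenLast σ ↔ p
  · have heq : Forces k W p σ = W σ := funext fun s => by simp [Forces, h]
    rw [heq, TrueAt]
    tauto
  · have heq : Forces k W p σ = NegForce k W σ := funext fun s => by simp [Forces, h]
    rw [heq, hW.meets_negForce_iff hσ hgen, TrueAt]
    tauto

theorem IsForcing.meets_iff_of_isLeaf (hW : IsForcing k t B W) (hB : IsTree B)
    (ht : ∀ m, t m ∈ M.FinPartition k) (hσ : IsLeaf B σ) : Meets k (graph g) (W σ) ↔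
      ∃ m, (IsLast σ (2 * (m + 1)) ∨ IsLast σ (2 * (m + 1) + 1)) ∧ PrecFun (t m) (graph g) := by
  constructor
  · rintro ⟨s, -, hsg, hWs⟩
    obtain ⟨-, m, hm, hinit⟩ | ⟨m, -, hm, -⟩ := (hW.iff σ hσ.1 s).1 hWs
    · exact ⟨m, hm, hsg.of_isPrefix (isSeq_of_mem_finPartition (ht m)) hinit⟩
    · exact absurd hm ((isLeaf_iff hB).1 hσ |>.2 m)
  · rintro ⟨m, hm, hprec⟩
    exact ⟨t m, ht m, hprec, (hW.iff σ hσ.1 _).2 (.inl ⟨hσ, m, hm, .refl _⟩)⟩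

theorem IsForcing.meets_iff_of_not_isLeaf (hW : IsForcing k t B W) (hσ : σ ∈ B)
    (hleaf : ¬ IsLeaf B σ) : Meets k (graph g) (W σ) ↔
      ∃ m, snoc σ m ∈ B ∧ Meets k (graph g) (Forces k W (EvenLast σ) (snoc σ m)) := by
  constructor
  · rintro ⟨s, -, hsg, hWs⟩
    obtain h | ⟨m, u, hm, hu, hus, hforces⟩ := (hW.iff σ hσ s).1 hWs
    · exact absurd h.1 hleaf
    · exact ⟨m, hm, u, hu, hsg.of_isPrefix (isSeq_of_mem_finPartition hu) hus, hforces⟩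
  · rintro ⟨m, hm, u, hu, hug, hforces⟩
    exact ⟨u, hu, hug, (hW.iff σ hσ u).2 (.inr ⟨m, u, hm, hu, .refl u, hforces⟩)⟩

theorem IsForcing.trueAt_iff_exists (hW : IsForcing k t B W) (hgen : IsGeneric k B W (graph g))
    (hσ : σ ∈ B) (hleaf : ¬ IsLeaf B σ) (heven : EvenLast σ) :
    TrueAt k W (graph g) σ ↔ ∃ m, snoc σ m ∈ B ∧ TrueAt k W (graph g) (snoc σ m) := by
  rw [TrueAt, iff_true_left heven, hW.meets_iff_of_not_isLeaf hσ hleaf]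
  refine exists_congr fun m => and_congr_right fun hm => ?_
  rw [hW.meets_forces_iff hm hgen, iff_true_right heven]

theorem IsForcing.trueAt_iff_forall (hW : IsForcing k t B W) (hgen : IsGeneric k B W (graph g))
    (hσ : σ ∈ B) (hleaf : ¬ IsLeaf B σ) (heven : ¬ EvenLast σ) :
    TrueAt k W (graph g) σ ↔ ∀ m, snoc σ m ∈ B → TrueAt k W (graph g) (snoc σ m) := by
  rw [TrueAt, iff_false_left heven, hW.meets_iff_of_not_isLeaf hσ hleaf]
  simp only [not_exists, not_and]
  refine forall_congr' fun m => forall_congr' fun hm => ?_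
  rw [hW.meets_forces_iff hm hgen, iff_false_right heven, not_not]

theorem leafHolds_graph {p : Set M.Num} {a : M.Num} : LeafHolds (graph t) p a ↔ a = 1 ∨
    ∃ m, (a = 2 * (m + 1) ∧ PrecFun (t m) p) ∨ (a = 2 * (m + 1) + 1 ∧ ¬ PrecFun (t m) p) := by
  have htwo (m : M.Num) : M.num 2 * m + M.num 2 = 2 * (m + 1) := by
    rw [num_eq_cast]
    push_cast
    ring
  have hthree (m : M.Num) : M.num 2 * m + M.num 3 = 2 * (m + 1) + 1 := by
    rw [num_eq_cast, num_eq_cast]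
    push_cast
    ring
  simp only [LeafHolds, pair_mem_graph, exists_eq_left', htwo, hthree]

theorem leafHolds_two_mul {p : Set M.Num} {c : M.Num} :
    LeafHolds (graph t) p (2 * c) ↔ ∃ m, c = m + 1 ∧ PrecFun (t m) p := by
  have hone : 2 * c ≠ 1 := by simpa using two_mul_ne_two_mul_add_one c 0
  have hodd m := two_mul_ne_two_mul_add_one c (m + 1)
  simp [leafHolds_graph, hone, hodd]

theorem leafHolds_two_mul_add_one {p : Set M.Num} {c : M.Num} :
    LeafHolds (graph t) p (2 * c + 1) ↔ ¬ ∃ m, c = m + 1 ∧ PrecFun (t m) p := by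
  have heven m := (two_mul_ne_two_mul_add_one (m + 1) c).symm
  rcases eq_zero_or_exists_add_one c with rfl | ⟨n, rfl⟩
  · simp [leafHolds_graph, eq_comm (a := (0 : M.Num))]
  · simp [leafHolds_graph, heven]
theorem IsForcing.trueAt_iff_leafHolds (hW : IsForcing k t B W) (hB : IsTree B)
    (ht : ∀ m, t m ∈ M.FinPartition k) (hσ : IsLeaf B σ) {a : M.Num} (ha : IsLast σ a) :
    TrueAt k W (graph g) σ ↔ LeafHolds (graph t) (graph g) a := by
  rw [TrueAt, hW.meets_iff_of_isLeaf hB ht hσ]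
  simp only [ha.isLast_iff]
  obtain ⟨c, rfl | rfl⟩ := exists_half a
  · have hodd m := two_mul_ne_two_mul_add_one c (m + 1)
    simp [evenLast_of_isLast ha, leafHolds_two_mul, hodd, eq_comm]
  · have heven m := two_mul_ne_two_mul_add_one (m + 1) c
    simp [not_evenLast_of_isLast ha, leafHolds_two_mul_add_one, heven, eq_comm]

end Generic

section Evaluation

variable {k : ℕ} {t : M.Num → M.Num} {B : Set M.Num} {W : M.Num → M.Num → Prop}
  {g : M.Num → M.Num}

/-- The (graph of the) characteristic function on `B` of the predicate `v`. -/
def charFun (B : Set M.Num) (v : M.Num → Prop) : Set M.Num :=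
  {z | IsPair z ∧ fst z ∈ B ∧ ((v (fst z) ∧ snd z = 1) ∨ (¬ v (fst z) ∧ snd z = 0))}

theorem charFun_mem_sets [Fact M.RCA0] {v : M.Num → Prop} (hB : B ∈ M.Sets) (hv : Internal v) :
    charFun B v ∈ M.Sets := by
  have hv_fst : Internal fun z => v (fst z) := hv.comp (by fun_prop)
  have hdom : Internal fun z => IsPair z ∧ fst z ∈ B := by fun_prop (disch := assumption)
  have hval : Internal fun z => (v (fst z) ∧ snd z = 1) ∨ (¬ v (fst z) ∧ snd z = 0) :=
    (hv_fst.and (by fun_prop)).or (hv_fst.not.and (by fun_prop))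
  exact (hdom.and hval).congr fun z => and_assoc.symm

theorem pair_one_mem_charFun [Fact M.RCA0] {v : M.Num → Prop} {σ : M.Num} :
    pair σ 1 ∈ charFun B v ↔ σ ∈ B ∧ v σ := by
  simp [charFun, isPair_pair]

theorem pair_zero_mem_charFun [Fact M.RCA0] {v : M.Num → Prop} {σ : M.Num} :
    pair σ 0 ∈ charFun B v ↔ σ ∈ B ∧ ¬ v σ := by
  simp [charFun, isPair_pair]

theorem isFun_charFun [Fact M.RCA0] {v : M.Num → Prop} : IsFun (charFun B v) B {0, 1} := by
  refine ⟨?_, fun σ hσ => ?_⟩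
  · rintro _ ⟨⟨σ, b, rfl⟩, hσ, hb⟩
    rw [fst_pair] at hσ
    rw [snd_pair] at hb
    exact ⟨σ, hσ, b, (hb.imp And.right And.right).symm, rfl⟩
  · by_cases h : v σ <;> simp [charFun, isPair_pair, hσ, h]

theorem IsBorelCode.nil_mem [Fact M.RCA0] (hB : M.IsBorelCode B) : nil ∈ B := by
  obtain ⟨m, ⟨σ, hσ, -⟩, -⟩ := hB.root
  refine hB.tree.2 σ hσ nil (initSeg_iff.2 ⟨isSeq_nil, hB.tree.1 σ hσ, ?_⟩)
  simp [IsPrefix]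

theorem IsBorelCode.forall_snoc_nil_iff [Fact M.RCA0] (hB : M.IsBorelCode B) {m : M.Num}
    (hm : snoc nil m ∈ B) {v : M.Num → Prop} :
    (∀ m, snoc nil m ∈ B → v (snoc nil m)) ↔ v (snoc nil m) := by
  refine ⟨fun h => h m hm, fun h m' hm' => ?_⟩
  rwa [hB.root.unique ⟨_, hm', isSingleton_iff.2 rfl⟩ ⟨_, hm, isSingleton_iff.2 rfl⟩]

theorem not_evenLast_nil [Fact M.RCA0] : ¬ EvenLast (nil : M.Num) := by
  rintro ⟨c, hc⟩
  obtain ⟨-, l, hl, -⟩ := isLast_iff.1 hc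
  rw [len_nil] at hl
  exact absurd hl.symm (by simp)

theorem isEvaluation_charFun [Fact M.RCA0] {v : M.Num → Prop} {τ p : Set M.Num}
    (hB : M.IsBorelCode B) (hv : Internal v)
    (leaf : ∀ σ a, IsLeaf B σ → IsLast σ a → (v σ ↔ LeafHolds τ p a))
    (union : ∀ σ ∈ B, ¬ IsLeaf B σ → EvenLast σ → (v σ ↔ ∃ m, snoc σ m ∈ B ∧ v (snoc σ m)))
    (inter : ∀ σ ∈ B, ¬ IsLeaf B σ → ¬ EvenLast σ → (v σ ↔ ∀ m, snoc σ m ∈ B → v (snoc σ m))) :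
    M.IsEvaluation τ B p (charFun B v) := by
  have isSeq_of_mem {σ : M.Num} (hσ : σ ∈ B) : IsSeq σ := hB.tree.1 σ hσ
  refine ⟨charFun_mem_sets hB.mem_sets hv, isFun_charFun, fun σ a hσ ha => ?_,
    fun σ a hσ hleaf ha hc => ?_, fun σ a hσ hleaf ha hc => ?_, fun σ ρ m hσ hρ hm => ?_⟩
  · rw [pair_one_mem_charFun, and_iff_right hσ.1, leaf σ a hσ ha]
  · obtain ⟨c, rfl⟩ := hc
    rw [num_eq_cast, Nat.cast_ofNat] at ha
    rw [pair_one_mem_charFun, and_iff_right hσ, union σ hσ hleaf (evenLast_of_isLast ha)]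
    simp [isSnoc_iff, isSeq_of_mem hσ, pair_one_mem_charFun]
  · obtain ⟨c, rfl⟩ := hc
    rw [num_eq_cast, Nat.cast_ofNat] at ha
    rw [pair_one_mem_charFun, and_iff_right hσ, inter σ hσ hleaf (not_evenLast_of_isLast ha)]
    simp only [isSnoc_iff, isSeq_of_mem hσ, pair_one_mem_charFun]
    exact forall_congr' fun m => ⟨by rintro h _ hm ⟨-, rfl⟩; exact ⟨hm, h hm⟩,
      fun h hm => (h _ hm ⟨trivial, rfl⟩).2⟩
  · rw [isSeqLen_iff] at hσ
    obtain rfl := hσ.1.eq_nil hσ.2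
    rw [isSingleton_iff] at hm
    subst hm
    rw [pair_one_mem_charFun, pair_one_mem_charFun, and_iff_right hρ, and_iff_right hB.nil_mem]
    have hleaf : ¬ IsLeaf B nil := fun h => ((isLeaf_iff hB.tree).1 h).2 m hρ
    exact (inter nil hB.nil_mem hleaf not_evenLast_nil).trans (hB.forall_snoc_nil_iff hρ)

theorem Internal.meets [Fact M.ACA0] {Φ : M.Num → M.Num → Prop} (hg : InternalFun g)
    (hΦ : Internal fun z => Φ (fst z) (snd z)) : Internal fun c => Meets k (graph g) (Φ c) := by
  unfold Meets
  simp only [precFun_graph]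
  exact .exists (.and (by fun_prop) (.and (by fun_prop) (hΦ.comp₂ (by fun_prop) (by fun_prop))))

theorem Internal.decides [Fact M.ACA0] (hW : Internal fun z => W (fst z) (snd z)) :
    Internal fun z => Decides k W (fst z) (snd z) :=
  hW.or (.negForce hW (by fun_prop) (by fun_prop))

theorem IsForcing.isEvaluation [Fact M.ACA0] (hW : IsForcing k t B W) (hB : M.IsBorelCode B)
    (ht : ∀ m, t m ∈ M.FinPartition k) (hg : InternalFun g) (hgen : IsGeneric k B W (graph g)) :
    M.IsEvaluation (graph t) B (graph g) (charFun B (TrueAt k W (graph g))) :=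
  isEvaluation_charFun hB (.iff (by fun_prop) (.meets hg hW.internal))
    (fun _ _ hσ ha => hW.trueAt_iff_leafHolds hB.tree ht hσ ha)
    (fun _ => hW.trueAt_iff_exists hgen) fun _ => hW.trueAt_iff_forall hgen

end Evaluation

section OpenCode

variable {k : ℕ} {Φ Ψ : M.Num → Prop}

/-- The code of the open set of the partitions with an initial segment in
`(ω)^k_fin` that satisfies `Φ`. -/
def openCode (k : ℕ) (Φ : M.Num → Prop) : Set M.Num :=
  {z | IsPair z ∧ snd z ∈ M.FinPartition k ∧ Φ (snd z)}

/-- The code of the sequence of the open sets coded by `openCode k (Φ i)`. -/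
def openSeqCode (k : ℕ) (Φ : M.Num → M.Num → Prop) : Set M.Num :=
  {z | IsPair z ∧ snd z ∈ openCode k (Φ (fst z))}

theorem openCode_union : openCode k Φ ∪ openCode k Ψ = openCode k fun s => Φ s ∨ Ψ s := by
  ext z
  simp only [openCode, Set.mem_union, Set.mem_ofPred_eq]
  tauto

variable [hM : Fact M.RCA0]

theorem pair_mem_openCode {n σ : M.Num} :
    pair n σ ∈ openCode k Φ ↔ σ ∈ M.FinPartition k ∧ Φ σ := by
  simp [openCode, isPair_pair]

theorem isOpenCode_openCode (hΦ : Internal Φ) : M.IsOpenCode k (openCode k Φ) := by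
  constructor
  · change Internal fun z => IsPair z ∧ snd z ∈ M.FinPartition k ∧ Φ (snd z)
    exact .and (by fun_prop) (.and (by fun_prop) (hΦ.comp (by fun_prop)))
  · rintro _ ⟨⟨n, σ, rfl⟩, hσ, -⟩
    exact ⟨n, σ, by rwa [snd_pair] at hσ, rfl⟩

theorem isOpenSeqCode_openSeqCode {Φ : M.Num → M.Num → Prop}
    (hΦ : Internal fun z => Φ (fst z) (snd z)) : M.IsOpenSeqCode k (openSeqCode k Φ) := by
  constructor
  · change Internal fun z => IsPair z ∧ IsPair (snd z) ∧ snd (snd z) ∈ M.FinPartition k ∧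
      Φ (fst z) (snd (snd z))
    exact .and (by fun_prop) (.and (by fun_prop)
      (.and (by fun_prop) (hΦ.comp₂ (by fun_prop) (by fun_prop))))
  · rintro _ ⟨⟨i, z, rfl⟩, hz⟩
    rw [fst_pair, snd_pair] at hz
    obtain ⟨⟨n, σ, rfl⟩, hσ, -⟩ := hz
    exact ⟨i, n, σ, by rwa [snd_pair] at hσ, rfl⟩

theorem openSlice_openSeqCode {Φ : M.Num → M.Num → Prop} (i : M.Num) :
    openSlice (openSeqCode k Φ) i = openCode k (Φ i) := by
  ext z
  constructor
  · rintro ⟨n, σ, rfl, -, h⟩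
    rwa [fst_pair, snd_pair] at h
  · intro h
    obtain ⟨n, σ, rfl⟩ := h.1
    exact ⟨n, σ, rfl, isPair_pair _ _, by rwa [fst_pair, snd_pair]⟩

theorem memOpen_openCode {x : Set M.Num} : MemOpen x (openCode k Φ) ↔ Meets k x Φ := by
  simp only [MemOpen, pair_mem_openCode, exists_const, Meets]
  exact exists_congr fun s => by tauto

theorem isDenseOpen_openCode (h : ∀ s ∈ M.FinPartition k, ∃ r ∈ M.FinPartition k,
    IsPrefix s r ∧ Φ r) : IsDenseOpen k (openCode k Φ) := by
  intro s hs
  obtain ⟨r, hr, hinit, hΦ⟩ := h s hs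
  exact ⟨0, r, pair_mem_openCode.2 ⟨hr, hΦ⟩, .inr (initSeg_iff.2
    ⟨isSeq_of_mem_finPartition hs, isSeq_of_mem_finPartition hr, hinit⟩)⟩

end OpenCode

/- The empty sequence has no last entry, so that the root of `B` counts as an intersection, and
`W nil` forces a generic partition out of the set coded by `B`. -/
theorem IsForcing.isBaireCode [Fact M.ACA0] {k : ℕ} {t : M.Num → M.Num} {B : Set M.Num}
    {W : M.Num → M.Num → Prop} (hW : IsForcing k t B W) (hB : M.IsBorelCode B)
    (ht : ∀ m, t m ∈ M.FinPartition k) :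
    M.IsBaireCode k (graph t) B (openCode k (NegForce k W nil)) (openCode k (W nil))
      (openSeqCode k (Decides k W)) := by
  have hU : Internal (NegForce k W nil) := .negForce hW.internal (.const nil) .id
  have hV : Internal (W nil) := hW.internal.comp₂ (by fun_prop) (by fun_prop)
  have dense (σ : M.Num) := isDenseOpen_openCode fun s => exists_decides k W σ
  have generic {x : Set M.Num} (hx : ∀ n, MemOpen x (openSlice (openSeqCode k (Decides k W)) n)) :
      IsGeneric k B W x := fun σ _ => by
    simpa only [openSlice_openSeqCode, memOpen_openCode] using hx σ
  refine ⟨isOpenCode_openCode hU, isOpenCode_openCode hV,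
    isOpenSeqCode_openSeqCode (.decides hW.internal),
    fun σ => by rw [openSlice_openSeqCode]; exact dense σ, ?_, fun x hx hxD hxU => ?_,
    fun x hx hxD hxV => ?_⟩
  · rw [Set.union_comm, openCode_union]
    exact dense nil
  · obtain ⟨g, hg, rfl, -⟩ := mem_partition.1 hx
    rw [memOpen_openCode, hW.meets_negForce_iff hB.nil_mem (generic hxD)] at hxU
    have hval : TrueAt k W (graph g) nil := iff_of_false not_evenLast_nil hxU
    exact ⟨_, hW.isEvaluation hB ht hg (generic hxD), nil, isSeqLen_iff.2 ⟨isSeq_nil, len_nil⟩,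
      pair_one_mem_charFun.2 ⟨hB.nil_mem, hval⟩⟩
  · obtain ⟨g, hg, rfl, -⟩ := mem_partition.1 hx
    rw [memOpen_openCode] at hxV
    have hval : ¬ TrueAt k W (graph g) nil := fun h => not_evenLast_nil (h.2 hxV)
    exact ⟨_, hW.isEvaluation hB ht hg (generic hxD), nil, isSeqLen_iff.2 ⟨isSeq_nil, len_nil⟩,
      pair_zero_mem_charFun.2 ⟨hB.nil_mem, hval⟩⟩

theorem baireCode_of_atr0 [Fact M.ATR0] {k : ℕ} {τ : Set M.Num} (hτ : M.IsEnumeration k τ) :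
    M.BorelCodesHaveBaireCode k τ := by
  intro B hB
  obtain ⟨t, ht, rfl, ht_mem⟩ := hτ.2.1.exists_eq_graph hτ.1
  obtain ⟨W, hW⟩ := exists_isForcing k ht hB
  exact ⟨_, _, _, hW.isBaireCode hB ht_mem⟩

end L2Structure

theorem mainTheorem2 (M : L2Structure.{u}) (hM : M.RCA0) (k : ℕ) (hk : 2 ≤ k) :
    (∃ τ, M.IsEnumeration k τ) ∧
      ∀ τ, M.IsEnumeration k τ →
        List.TFAE [M.ATR0, M.BorelCodesHaveEvaluatedPoint k τ, M.BorelCodesHaveBaireCode k τ] := by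
  have : Fact M.RCA0 := ⟨hM⟩
  refine ⟨L2Structure.exists_isEnumeration k, fun τ hτ => ?_⟩
  tfae_have 1 → 3 := fun h =>
    have : Fact M.ATR0 := ⟨h⟩
    L2Structure.baireCode_of_atr0 hτ
  tfae_have 3 → 2 := L2Structure.evaluated_of_baireCode (by lia)
  tfae_have 2 → 1 := L2Structure.atr0_of_evaluated
  tfae_finish
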